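/- Let $p$ be a prime, $q=p^a$ with $a\ge 1$ (the cardinality of the residue field of a finite extension of $\mathbb{Q}_p$), let $\Bbbk$ be an algebraically closed field of characteristic $\ell\neq p$, $\ell\ge 0$, with $q\not\equiv 1 \bmod \ell$, fix a square root $q^{1/2}\in\Bbbk$, and let $n\geq 2$. Let $\mathrm{W}=\mathfrak{S}_n\ltimes\mathfrak{X}$ be the extended affine Weyl group of $\mathrm{GL}_n$, where $\mathfrak{X}$ is the free abelian multiplicative group on $X_1,\dots,X_n$, permuted by $\mathfrak{S}_n$. Let $\mathbb{I}=\{s_1,\dots,s_{n-1}\}$ be the set of simple transpositions, $s_0=s_{n-1}\cdots s_2s_1s_2\cdots s_{n-1}X_1X_n^{-1}$ and $\tau=s_{n-1}\cdots s_1X_1$. Every $w\in\mathrm{W}$ is of the form $x\tau^j$ with $j\in\mathbb{Z}$ and $x$ in the subgroup generated by $s_0,\dots,s_{n-1}$; the length $\ell(w)$ is the least $r$ such that $x$ is a product of $r$ of the $s_i$. For $J,K\subseteq\mathbb{I}$ let $\mathrm{W}_J=\langle J\rangle$, and let $D_{K,J}$ be the set of shortest double coset representatives in $\mathrm{W}_K\backslash\mathrm{W}/\mathrm{W}_J$.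 For $L\subseteq K$ let $D^K_{\emptyset,L}\subseteq \mathrm{W}_K$ be the set of shortest coset representatives in $\mathrm{W}_K/\mathrm{W}_L$. For $d\in D_{K,J}$ put $K\cap dJ=\{s\in K\mid d^{-1}sd\in J\}$. Let $\mathcal{H}$ be the unital $\Bbbk$-algebra generated by $T_1,\dots,T_{n-1},X_1^{\pm1},\dots,X_n^{\pm1}$ with relations: $(T_i-q)(T_i+1)=0$; $T_iT_j=T_jT_i$ for $|i-j|>1$; $T_iT_{i+1}T_i=T_{i+1}T_iT_{i+1}$; $X_jX_j^{-1}=1=X_j^{-1}X_j$; $X_iX_j=X_jX_i$; $T_iX_j=X_jT_i$ for $j\ne i,i+1$; $T_iX_iT_i=qX_{i+1}$. Put $T_{s_i}=T_i$ for $1\le i\le n-1$, $T_{s_0}=q^{n-1}X_1^{-1}X_n(T_{n-1}\cdots T_2T_1T_2\cdots T_{n-1})^{-1}$ and $T_\tau=q^{-(n-1)/2}T_{n-1}\cdots T_1X_1$, and for $w\in\mathrm{W}$ with reduced expression $w=s_{i_1}\cdots s_{i_r}\tau^j$ put $T_w=T_{s_{i_1}}\cdots T_{s_{i_r}}T_\tau^j$.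 Let $\mathbf{v}_J=\sum_{w\in\mathrm{W}_J}T_w$ and let $$\mathcal{S}=\mathrm{End}_{\mathcal{H}}\Big(\bigoplus_{J\subseteq\mathbb{I}}\mathbf{v}_J\mathcal{H}\Big)$$ be the affine Schur algebra (endomorphisms of right $\mathcal{H}$-modules). Let $U=\sum_{i=1}^{n-1}\mathcal{H}(T_i-q)$, consider the left $\mathcal{H}$-module $\mathcal{H}/U$, and let $\mathbf{v}\in\mathcal{H}/U$ be the class of $1$. Let $$\mathbb{P}(\mathcal{S})=\bigoplus_{K\subseteq\mathbb{I}}\Bbbk[X_1^{\pm1},\dots,X_n^{\pm1}]^{\mathrm{W}_K}\,\mathbf{v}^{(K)},$$ where $\mathrm{W}_K$ permutes the variables and $\mathbf{v}^{(K)}$ is a copy of $\mathbf{v}$, the superscript being a formal index. Then the following hold. 1. The map $f\mapsto f\mathbf{v}$ is a bijection from $\Bbbk[X_1^{\pm1},\dots,X_n^{\pm1}]$ onto $\mathcal{H}/U$. In this way $\mathcal{H}$ acts on $\Bbbk[X_1^{\pm1},\dots,X_n^{\pm1}]\mathbf{v}$. 2. For all $J,K\subseteq\mathbb{I}$ and $d\in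 D_{K,J}$ there is a unique homomorphism of right $\mathcal{H}$-modules $\mathbf{b}^d_{K,J}:\mathbf{v}_J\mathcal{H}\to\mathbf{v}_K\mathcal{H}$ with $\mathbf{b}^d_{K,J}(\mathbf{v}_J)=\sum_{w\in\mathrm{W}_Kd\mathrm{W}_J}T_w$. Extended by zero, it is an element of $\mathcal{S}$ (the standard basis element labelled by $K,J,d$). 3. There is a faithful representation $\rho$ of the $\Bbbk$-algebra $\mathcal{S}$ on $\mathbb{P}(\mathcal{S})$ such that, for all $J,K\subseteq\mathbb{I}$, $d\in D_{K,J}$ and $f\in\Bbbk[X_1^{\pm1},\dots,X_n^{\pm1}]^{\mathrm{W}_J}$, $$\rho(\mathbf{b}^d_{K,J})\,f\mathbf{v}^{(J)}=\sum_{a\in D^K_{\emptyset,K\cap dJ}}T_aT_d\,f\,\mathbf{v}^{(K)},$$ where the right-hand side is computed in $\mathcal{H}/U=\Bbbk[X_1^{\pm1},\dots,X_n^{\pm1}]\mathbf{v}$, lies in $\Bbbk[X_1^{\pm1},\dots,X_n^{\pm1}]^{\mathrm{W}_K}\mathbf{v}$, and is placed in the summand of index $K$; and $\rho(\mathbf{b}^d_{K,J})$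 vanishes on the summands of index different from $J$. -/

import Mathlib

/- Throughout, `n = m + 1`. The simple reflections `s_1, …, s_{n-1}` are indexed by `Fin m`
(so `i : Fin m` stands for `s_{i+1}`, which swaps the positions `i.castSucc` and `i.succ`), and
`X_1, …, X_n` are indexed by `Fin (m + 1)`. A subset of `𝕀 = {s_1, …, s_{n-1}}` is a
`Finset (Fin m)`. -/

namespace AffSchur

noncomputable section

/-! ### The extended affine Weyl group -/

/-- The free abelian group `𝔛` on `X_1, …, X_n`, written multiplicatively: `X_1^{a_1} ⋯ X_n^{a_n}`
is the function `j ↦ a_j`. -/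
abbrev Lattice (m : ℕ) : Type := Fin (m + 1) → Multiplicative ℤ

/-- The extended affine Weyl group `W = 𝔖 ⋉ 𝔛`, where `σ X_j σ⁻¹ = X_{σ j}`. -/
abbrev W (m : ℕ) : Type :=
  Lattice m ⋊[(mulAutArrow : Equiv.Perm (Fin (m + 1)) →* MulAut (Lattice m))]
    Equiv.Perm (Fin (m + 1))

variable {m : ℕ}

/-- The element `X_j` of `W`. -/
def X (j : Fin (m + 1)) : W m :=
  SemidirectProduct.inl (Pi.mulSingle j (Multiplicative.ofAdd 1))

/-- The finite simple reflections `s_1, …, s_{n-1}`. -/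
def s (i : Fin m) : W m := SemidirectProduct.inr (Equiv.swap i.castSucc i.succ)

/-- `τ = s_{n-1} ⋯ s_1 X_1`. -/
def tau (m : ℕ) : W m := (List.ofFn (s (m := m))).reverse.prod * X 0

/-- `s_0 = s_{n-1} ⋯ s_2 s_1 s_2 ⋯ s_{n-1} X_1 X_n⁻¹`. -/
def s0 (m : ℕ) : W m :=
  (List.ofFn (s (m := m))).reverse.prod * (List.ofFn (s (m := m))).tail.prod
    * (X 0 * (X (Fin.last m))⁻¹)

/-- All simple reflections `s_0, s_1, …, s_{n-1}`; here the index `0` stands for `s_0`, and the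
index `i.succ` stands for the `i`-th finite simple reflection. -/
def sAff : Fin (m + 1) → W m := Fin.cases (s0 m) s

/-- `w = s_{i_1} ⋯ s_{i_r} τ^j`, where `e = ([i_1, …, i_r], j)`. -/
def IsExpr (w : W m) (e : List (Fin (m + 1)) × ℤ) : Prop :=
  w = (e.1.map sAff).prod * tau m ^ e.2

/-- The length of `w = x τ^j`: the least `r` such that `x` is a product of `r` simple
reflections. -/
def length (w : W m) : ℕ :=
  sInf {r | ∃ e : List (Fin (m + 1)) × ℤ, IsExpr w e ∧ e.1.length = r}

/-- The standard parabolic subgroup `W_J`, for `J ⊆ 𝕀`. -/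
def parabolic (J : Finset (Fin m)) : Subgroup (W m) := Subgroup.closure (s '' (J : Set (Fin m)))

/-- The double coset `W_K w W_J`. -/
def dcoset (K J : Finset (Fin m)) (w : W m) : Set (W m) :=
  DoubleCoset.doubleCoset w (parabolic K : Set (W m)) (parabolic J : Set (W m))

/-- `D_{K,J}`: the shortest double coset representatives in `W_K \ W / W_J`. -/
def D (K J : Finset (Fin m)) : Set (W m) := {d | ∀ w ∈ dcoset K J d, length d ≤ length w}

/-- `D^K_{J₁,J₂}`: the shortest double coset representatives in `W_{J₁} \ W_K / W_{J₂}`, for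
`J₁, J₂ ⊆ K`. -/
def DIn (K J₁ J₂ : Finset (Fin m)) : Set (W m) := {a | a ∈ parabolic K ∧ a ∈ D J₁ J₂}

open Classical in
/-- `K ∩ dJ = {s ∈ K | d⁻¹ s d ∈ J}`. -/
def interConj (K : Finset (Fin m)) (d : W m) (J : Finset (Fin m)) : Finset (Fin m) :=
  K.filter fun i => ∃ j ∈ J, d⁻¹ * s i * d = s j

/-! ### The Hecke algebra -/

/-- Generators of the Hecke algebra; `Xinv j` stands for `X_j⁻¹`. -/
inductive Gen (m : ℕ) : Type
  | T (i : Fin m) : Gen m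
  | X (j : Fin (m + 1)) : Gen m
  | Xinv (j : Fin (m + 1)) : Gen m

section Hecke

variable {k : Type*} [Field k]

/-- A generator, as an element of the free algebra. -/
abbrev gen (k : Type*) [Field k] (g : Gen m) : FreeAlgebra k (Gen m) := FreeAlgebra.ι k g

/-- Bernstein's defining relations of the Hecke algebra. -/
inductive Rel (q : k) (m : ℕ) : FreeAlgebra k (Gen m) → FreeAlgebra k (Gen m) → Prop
  | quad (i : Fin m) :
      Rel q m ((gen k (.T i) - algebraMap k _ q) * (gen k (.T i) + 1)) 0
  | comm (i j : Fin m) (h : (i : ℕ) + 1 < j ∨ (j : ℕ) + 1 < i) :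
      Rel q m (gen k (.T i) * gen k (.T j)) (gen k (.T j) * gen k (.T i))
  | braid (i j : Fin m) (h : (j : ℕ) = i + 1) :
      Rel q m (gen k (.T i) * gen k (.T j) * gen k (.T i))
        (gen k (.T j) * gen k (.T i) * gen k (.T j))
  | mul_inv (j : Fin (m + 1)) : Rel q m (gen k (.X j) * gen k (.Xinv j)) 1
  | inv_mul (j : Fin (m + 1)) : Rel q m (gen k (.Xinv j) * gen k (.X j)) 1
  | X_comm (i j : Fin (m + 1)) :
      Rel q m (gen k (.X i) * gen k (.X j)) (gen k (.X j) * gen k (.X i))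
  | T_X_comm (i : Fin m) (j : Fin (m + 1)) (h₁ : j ≠ i.castSucc) (h₂ : j ≠ i.succ) :
      Rel q m (gen k (.T i) * gen k (.X j)) (gen k (.X j) * gen k (.T i))
  | T_X_T (i : Fin m) :
      Rel q m (gen k (.T i) * gen k (.X i.castSucc) * gen k (.T i))
        (algebraMap k _ q * gen k (.X i.succ))

/-- The Iwahori-Matsumoto Hecke algebra `ℋ = ℋ_n` (in Bernstein's presentation), `n = m + 1`. -/
def Hecke (q : k) (m : ℕ) : Type _ := RingQuot (Rel q m)

instance (q : k) (m : ℕ) : Ring (Hecke q m) := inferInstanceAs (Ring (RingQuot (Rel q m)))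

instance (q : k) (m : ℕ) : Algebra k (Hecke q m) :=
  inferInstanceAs (Algebra k (RingQuot (Rel q m)))

/-- The quotient map from the free algebra onto `ℋ`. -/
def toHecke (q : k) (m : ℕ) : FreeAlgebra k (Gen m) →ₐ[k] Hecke q m :=
  RingQuot.mkAlgHom k (Rel q m)

theorem toHecke_rel {q : k} {a b : FreeAlgebra k (Gen m)} (h : Rel q m a b) :
    toHecke q m a = toHecke q m b :=
  RingQuot.mkAlgHom_rel k h

/-- The generator `T_i` of `ℋ`. -/
def T (q : k) (i : Fin m) : Hecke q m := toHecke q m (gen k (.T i))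

/-- The generator `X_j` of `ℋ`, as a unit with inverse the generator `X_j⁻¹`. -/
def XH (q : k) (j : Fin (m + 1)) : (Hecke q m)ˣ where
  val := toHecke q m (gen k (.X j))
  inv := toHecke q m (gen k (.Xinv j))
  val_inv := by rw [← map_mul, toHecke_rel (.mul_inv j), map_one]
  inv_val := by rw [← map_mul, toHecke_rel (.inv_mul j), map_one]

theorem XH_commute (q : k) (i j : Fin (m + 1)) : Commute (XH q i) (XH q j) := by
  apply Units.ext
  change toHecke q m _ * toHecke q m _ = toHecke q m _ * toHecke q m _
  rw [← map_mul, toHecke_rel (.X_comm i j), map_mul]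

/-- The image in `ℋ` of the element `T_τ = q^{-(n-1)/2} T_{n-1} ⋯ T_1 X_1` of the Iwahori-Matsumoto
presentation; `r` is a square root of `q`. -/
def Ttau (q r : k) (m : ℕ) : Hecke q m :=
  (r ^ m)⁻¹ • ((List.ofFn (T (m := m) q)).reverse.prod * (XH q 0 : (Hecke q m)ˣ))

/-- `T_τ^j` for an integer `j`. -/
def TtauPow (q r : k) (m : ℕ) : ℤ → Hecke q m
  | .ofNat a => Ttau q r m ^ a
  | .negSucc a => Ring.inverse (Ttau q r m) ^ (a + 1)

/-- The image in `ℋ` of the element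
`T_{s_0} = q^{n-1} X_1⁻¹ X_n (T_{n-1} ⋯ T_2 T_1 T_2 ⋯ T_{n-1})⁻¹` of the Iwahori-Matsumoto
presentation. -/
def T0 (q : k) (m : ℕ) : Hecke q m :=
  q ^ m • (((XH q 0)⁻¹ * XH q (Fin.last m) : (Hecke q m)ˣ)
    * Ring.inverse
        ((List.ofFn (T (m := m) q)).reverse.prod * (List.ofFn (T (m := m) q)).tail.prod))

/-- `T_{s_0}, T_{s_1}, …, T_{s_{n-1}}`, indexed as in `sAff`. -/
def TAff (q : k) : Fin (m + 1) → Hecke q m := Fin.cases (T0 q m) (T q)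

/-- A reduced expression of `w`: one that attains the length of `w`. -/
def reducedExpr (w : W m) : List (Fin (m + 1)) × ℤ :=
  Classical.epsilon fun e => IsExpr w e ∧ e.1.length = length w

/-- `T_w = T_{s_{i_1}} ⋯ T_{s_{i_r}} T_τ^j` for a reduced expression `w = s_{i_1} ⋯ s_{i_r} τ^j`
(every `w` has one, and the braid relations make the product independent of the one chosen). -/
def Tw (q r : k) (w : W m) : Hecke q m :=
  ((reducedExpr w).1.map (TAff q)).prod * TtauPow q r m (reducedExpr w).2

/-! ### The right ideals `v_J ℋ` and the affine Schur algebra -/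

/-- `v_J = ∑_{w ∈ W_J} T_w`. -/
def v (q r : k) (J : Finset (Fin m)) : Hecke q m := ∑ᶠ w ∈ (parabolic J : Set (W m)), Tw q r w

/-- The right ideal `v_J ℋ`. A right `ℋ`-module is a module over `ℋᵐᵒᵖ`. -/
def vIdeal (q r : k) (J : Finset (Fin m)) : Submodule (Hecke q m)ᵐᵒᵖ (Hecke q m) :=
  Submodule.span _ {v q r J}

/-- `v_J`, as an element of `v_J ℋ`. -/
def vGen (q r : k) (J : Finset (Fin m)) : vIdeal q r J :=
  ⟨v q r J, Submodule.mem_span_singleton_self _⟩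

/-- The affine Schur algebra `𝒮 = End_ℋ(⨁_{J ⊆ 𝕀} v_J ℋ)`; the finite direct sum is written as a
product. -/
abbrev Schur (q r : k) (m : ℕ) : Type _ :=
  Module.End (Hecke q m)ᵐᵒᵖ (∀ J : Finset (Fin m), vIdeal q r J)

/-- The element of `𝒮` that a homomorphism `v_J ℋ → v_K ℋ` of right `ℋ`-modules gives by extension
by zero. -/
def ofHom {q r : k} {J K : Finset (Fin m)}
    (φ : vIdeal q r J →ₗ[(Hecke q m)ᵐᵒᵖ] vIdeal q r K) : Schur q r m :=
  LinearMap.single _ (fun L : Finset (Fin m) => vIdeal q r L) K ∘ₗ φ ∘ₗ LinearMap.proj J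

/-- `φ : v_J ℋ → v_K ℋ` is the homomorphism `b^d_{K,J}`: it sends `v_J` to
`∑_{w ∈ W_K d W_J} T_w`. -/
def IsB {q r : k} {J K : Finset (Fin m)} (d : W m)
    (φ : vIdeal q r J →ₗ[(Hecke q m)ᵐᵒᵖ] vIdeal q r K) : Prop :=
  (φ (vGen q r J) : Hecke q m) = ∑ᶠ w ∈ dcoset K J d, Tw q r w

/-! ### The representation spaces -/

/-- The Laurent polynomial ring `k[X_1^{±1}, …, X_n^{±1}]`. -/
abbrev Laurent (k : Type*) [Field k] (m : ℕ) : Type _ := MonoidAlgebra k (Lattice m)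

/-- The permutation action of `𝔖` on Laurent polynomials, `σ X_j = X_{σ j}`. -/
def permAct (k : Type*) [Field k] (σ : Equiv.Perm (Fin (m + 1))) : Laurent k m ≃ₐ[k] Laurent k m :=
  MonoidAlgebra.domCongr k k (mulAutArrow σ)

/-- The invariants `k[X_1^{±1}, …, X_n^{±1}]^{W_K}`. -/
def Inv (k : Type*) [Field k] (K : Finset (Fin m)) : Submodule k (Laurent k m) where
  carrier := {f | ∀ w ∈ parabolic K, permAct k w.right f = f}
  add_mem' ha hb w hw := by rw [map_add, ha w hw, hb w hw]
  zero_mem' w _ := map_zero _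
  smul_mem' c f hf w hw := by rw [map_smul, hf w hw]

/-- `ℙ(𝒮) = ⨁_{K ⊆ 𝕀} k[X_1^{±1}, …, X_n^{±1}]^{W_K} v^{(K)}`; an element is the family of the
coefficients of the formal symbols `v^{(K)}`. -/
abbrev PS (k : Type*) [Field k] (m : ℕ) : Type _ := ∀ K : Finset (Fin m), Inv k K

open Classical in
/-- The element `f v^{(J)}` of `ℙ(𝒮)`. -/
def single {J : Finset (Fin m)} (f : Inv k J) : PS k m := Pi.single J f

/-- The left ideal `U = ∑_i ℋ (T_i - q)`. -/
def U (q : k) (m : ℕ) : Submodule (Hecke q m) (Hecke q m) :=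
  Submodule.span _ (Set.range fun i : Fin m => T q i - algebraMap k _ q)

/-- The left `ℋ`-module `ℙ(ℋ) = ℋ / U`. -/
abbrev PH (q : k) (m : ℕ) : Type _ := Hecke q m ⧸ U q m

/-- The homomorphism `𝔛 → ℋˣ`, `X_1^{a_1} ⋯ X_n^{a_n} ↦ X_1^{a_1} ⋯ X_n^{a_n}`. -/
def latticeToHecke (q : k) (m : ℕ) : Lattice m →* (Hecke q m)ˣ :=
  MonoidHom.noncommPiCoprod (fun j => zpowersHom _ (XH q j)) fun i j _ _ _ =>
    (XH_commute q i j).zpow_zpow _ _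

/-- The map `k[X_1^{±1}, …, X_n^{±1}] → ℋ`. -/
def laurentToHecke (q : k) (m : ℕ) : Laurent k m →ₐ[k] Hecke q m :=
  MonoidAlgebra.lift k (Hecke q m) (Lattice m) ((Units.coeHom _).comp (latticeToHecke q m))

/-- The map `f ↦ f v` from Laurent polynomials to `ℙ(ℋ)`, where `v` is the class of `1`. -/
def mulV (q : k) (m : ℕ) : Laurent k m →ₗ[k] PH q m :=
  (U q m).mkQ.restrictScalars k ∘ₗ (laurentToHecke q m).toLinearMap

end Hecke

end

end AffSchur

/-!
The group `W` acts on `ℤ` by affine permutations, in such a way that length and descents can be read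
off from inversions. This yields Matsumoto's theorem, so that `T_w` does not depend on the reduced
expression, and the usual rules for `T_s T_w` and for sums of the `T_w` over double cosets; the
latter give the homomorphisms `b^d_{K,J}`.

Over the rational functions in `X_1, …, X_n`, the algebra `ℋ` acts by Demazure-Lusztig operators,
and `U` kills `1`. Comparing leading terms shows that the `X^λ T_w`, with `w` in the finite Weyl
group, are linearly independent; Bernstein's relation shows that they span. Hence
`ℋ = ⨁_w 𝕜[X^{±1}] T_w` acts faithfully on Laurent polynomials, and `ℋ / U` is
`𝕜[X^{±1}] v`.

Since `U` is the left annihilator of `v_𝕀`, the module `ℋ / U` is isomorphic to `ℋ v_𝕀`, and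
`f v ↦ f v_𝕀` embeds `ℙ(𝒮)` in `⨁_J v_J ℋ`. The image consists of all the elements on which each
`T_i` acts on the right as `q`, hence is stable under `𝒮`. This is the representation. It is
faithful because `φ(x) g v_𝕀 = φ(x g v_𝕀)`, which is zero for all `g` only if `φ(x) = 0`.
-/

namespace AffSchur

noncomputable section

variable {m : ℕ}

/-! ### Affine generators from Bernstein relations -/

section Group

variable {G : Type*} [Group G]

/-- The product `t_{j-1} ⋯ t_0`. -/
def descProd (t : ℕ → G) (j : ℕ) : G := (List.ofFn fun i : Fin j => t i).reverse.prod

/-- The product `t_0 ⋯ t_{j-1}`. -/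
def ascProd (t : ℕ → G) (j : ℕ) : G := (List.ofFn fun i : Fin j => t i).prod

@[simp] theorem descProd_zero (t : ℕ → G) : descProd t 0 = 1 := by simp [descProd]

@[simp] theorem ascProd_zero (t : ℕ → G) : ascProd t 0 = 1 := by simp [ascProd]

theorem descProd_succ (t : ℕ → G) (j : ℕ) : descProd t (j + 1) = t j * descProd t j := by
  rw [descProd, List.ofFn_succ']
  simp [descProd]

theorem ascProd_succ (t : ℕ → G) (j : ℕ) : ascProd t (j + 1) = ascProd t j * t j := by
  rw [ascProd, List.ofFn_succ']
  simp [ascProd]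

/-- The element that corresponds to `τ`, up to a scalar, in a group with elements `t_0, …, t_{m-1}`
and `x_0`. -/
def rotator (m : ℕ) (t x : ℕ → G) : G := descProd t m * x 0

/-- The family of the `t_i` together with the conjugate of `t_0` by the rotator, indexed like the
simple reflections `s_0, …, s_{n-1}`. -/
def affineGen (m : ℕ) (t x : ℕ → G) : Fin (m + 1) → G :=
  Fin.cases (rotator m t x * t 0 * (rotator m t x)⁻¹) fun i => t i

theorem zpow_mul_of_mul_eq {ι : Type*} {u : G} {t : ι → G} {σ : Equiv.Perm ι}
    (h : ∀ a, u * t a = t (σ a) * u) (e : ℤ) (a : ι) : u ^ e * t a = t ((σ ^ e) a) * u ^ e := by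
  induction e generalizing a with
  | zero => simp
  | succ n ih =>
    rw [zpow_add_one, zpow_add_one, mul_assoc, h, ← mul_assoc, ih, mul_assoc, Equiv.Perm.mul_apply]
  | pred n ih =>
    have hinv : u⁻¹ * t a = t (σ⁻¹ a) * u⁻¹ := by
      rw [inv_mul_eq_iff_eq_mul, ← mul_assoc, eq_mul_inv_iff_mul_eq, h]
      simp
    rw [zpow_sub_one, zpow_sub_one, mul_assoc, hinv, ← mul_assoc, ih, mul_assoc,
      Equiv.Perm.mul_apply]

theorem zpow_mul_prod_map_of_mul_eq {ι : Type*} {u : G} {t : ι → G} {σ : Equiv.Perm ι}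
    (h : ∀ a, u * t a = t (σ a) * u) (e : ℤ) (l : List ι) :
    u ^ e * (l.map t).prod = ((l.map (σ ^ e)).map t).prod * u ^ e := by
  induction l with
  | nil => simp
  | cons a l ih =>
    simp only [List.map_cons, List.prod_cons]
    rw [← mul_assoc, zpow_mul_of_mul_eq h, mul_assoc, ih, mul_assoc]

/-- The rotation `a ↦ a - 1` of the affine Dynkin diagram. -/
def rot (m : ℕ) : Equiv.Perm (Fin (m + 1)) := Equiv.subRight 1

theorem rot_zero : rot m 0 = Fin.last m := by
  ext; simp [rot, Equiv.subRight, Fin.coe_neg_one]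

theorem rot_succ (i : Fin m) : rot m i.succ = i.castSucc := by
  simp only [rot, Equiv.subRight_apply, sub_eq_iff_eq_add]
  ext; simp

theorem rot_add_one (a : Fin (m + 1)) : rot m (a + 1) = a := by
  simp [rot]

theorem val_rot_of_ne_zero {a : Fin (m + 1)} (h : a ≠ 0) : (rot m a : ℕ) = a - 1 := by
  obtain ⟨i, rfl⟩ := Fin.exists_succ_eq.2 h
  simp [rot_succ]

theorem fin_add_one_ne (hm : 0 < m) (a : Fin (m + 1)) : a + 1 ≠ a := by
  simpa using hm.ne'

/-- The braid and Bernstein relations, without the quadratic ones, between elements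
`t_0, …, t_{m-1}` and `x_0, …, x_m` of a group; in `W` the scalar `z` is `1`, in `ℋ` it is `q`. -/
structure BernsteinRel (m : ℕ) (t x : ℕ → G) (z : G) : Prop where
  comm : ∀ i j, i + 1 < j → j < m → t i * t j = t j * t i
  braid : ∀ i, i + 1 < m → t i * t (i + 1) * t i = t (i + 1) * t i * t (i + 1)
  x_comm : ∀ i j, i ≤ m → j ≤ m → x i * x j = x j * x i
  t_x_comm : ∀ i j, i < m → j ≤ m → j ≠ i → j ≠ i + 1 → t i * x j = x j * t i
  t_x_t : ∀ i, i < m → t i * x i * t i = z * x (i + 1)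
  central : ∀ g, z * g = g * z

namespace BernsteinRel

variable {t x : ℕ → G} {z : G} (h : BernsteinRel m t x z)
include h

theorem descProd_comm {i j : ℕ} (hj : j < i) (hi : i < m) :
    descProd t j * t i = t i * descProd t j := by
  induction j with
  | zero => simp
  | succ j ih =>
    rw [descProd_succ, mul_assoc, ih (by omega), ← mul_assoc, h.comm j i (by omega) hi, mul_assoc]

theorem descProd_mul {i j : ℕ} (hij : i + 1 < j) (hj : j ≤ m) :
    descProd t j * t (i + 1) = t i * descProd t j := by
  induction j with
  | zero => omega
  | succ j ih =>
    rcases Nat.lt_or_ge (i + 1) j with hlt | hge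
    · rw [descProd_succ, mul_assoc, ih hlt (by omega), ← mul_assoc,
        ← h.comm i j (by omega) (by omega), mul_assoc]
    · obtain rfl : j = i + 1 := by omega
      rw [descProd_succ, descProd_succ, mul_assoc, mul_assoc, h.descProd_comm (by omega) (by omega)]
      simp only [← mul_assoc]
      rw [h.braid i (by omega)]

theorem descProd_mul_descProd {j : ℕ} (hj : j + 1 ≤ m) :
    descProd t m * (descProd t (j + 1) * (t 0)⁻¹) = descProd t j * descProd t m := by
  induction j with
  | zero => simp [descProd_succ]
  | succ j ih =>
    rw [descProd_succ, mul_assoc (t (j + 1)), ← mul_assoc, h.descProd_mul (by omega) le_rfl,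
      mul_assoc, ih (by omega), ← mul_assoc, ← descProd_succ]

theorem x_zero_mul_descProd {j : ℕ} (hj : j + 1 ≤ m) :
    x 0 * (descProd t (j + 1) * (t 0)⁻¹) = descProd t (j + 1) * (t 0)⁻¹ * x 0 := by
  induction j with
  | zero => simp [descProd_succ]
  | succ j ih =>
    rw [descProd_succ, mul_assoc (t (j + 1)), ← mul_assoc,
      ← h.t_x_comm (j + 1) 0 (by omega) (by omega) (by omega) (by omega), mul_assoc,
      ih (by omega), ← mul_assoc]

theorem descProd_x_ascProd {j : ℕ} (hj : j ≤ m) :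
    descProd t j * x 0 * ascProd t j = z ^ j * x j := by
  induction j with
  | zero => simp
  | succ j ih =>
    have hz : t j * z ^ j = z ^ j * t j := (Commute.pow_left (h.central (t j)) j).eq.symm
    calc descProd t (j + 1) * x 0 * ascProd t (j + 1)
        = t j * (descProd t j * x 0 * ascProd t j) * t j := by
          simp only [descProd_succ, ascProd_succ, mul_assoc]
      _ = z ^ j * (t j * x j * t j) := by
          rw [ih (by omega)]; simp only [← mul_assoc]; rw [hz]
      _ = z ^ (j + 1) * x (j + 1) := by rw [h.t_x_t j (by omega), ← mul_assoc, pow_succ]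

theorem t_x_t_mul_x_zero (hm : 0 < m) :
    t 0 * x 0 * t 0 * x 0 = x 0 * (t 0 * x 0 * t 0) := by
  rw [h.t_x_t 0 hm, mul_assoc, h.x_comm 1 0 (by omega) (by omega), ← mul_assoc, h.central,
    mul_assoc]

theorem rotator_mul_t_zero_mul_x_zero (hm : 0 < m) :
    rotator m t x * t 0 * x 0 = x 0 * (rotator m t x * t 0) := by
  obtain ⟨n, rfl⟩ : ∃ n, m = n + 1 := ⟨m - 1, by omega⟩
  have hx := h.x_zero_mul_descProd (j := n) le_rfl
  calc rotator (n + 1) t x * t 0 * x 0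
      = descProd t (n + 1) * (t 0)⁻¹ * (t 0 * x 0 * t 0 * x 0) := by rw [rotator]; group
    _ = descProd t (n + 1) * (t 0)⁻¹ * x 0 * (t 0 * x 0 * t 0) := by
        rw [h.t_x_t_mul_x_zero hm, ← mul_assoc]
    _ = x 0 * (rotator (n + 1) t x * t 0) := by rw [← hx, rotator]; group

theorem affineGen_zero (hm : 0 < m) :
    affineGen m t x 0 =
      z ^ m * ((x 0)⁻¹ * x m) * (descProd t m * ((t 0)⁻¹ * ascProd t m))⁻¹ := by
  have hz : z ^ m * ((x 0)⁻¹ * x m) = (x 0)⁻¹ * (descProd t m * x 0 * ascProd t m) := by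
    rw [h.descProd_x_ascProd le_rfl, ← mul_assoc, (Commute.pow_left (h.central (x 0)⁻¹) m).eq,
      mul_assoc]
  have hconj : rotator m t x * t 0 = (x 0)⁻¹ * (rotator m t x * t 0 * x 0) := by
    rw [h.rotator_mul_t_zero_mul_x_zero hm]; group
  change rotator m t x * t 0 * (rotator m t x)⁻¹ = _
  rw [hz, hconj, rotator]
  group

theorem rotator_mul_t_succ {i : ℕ} (hi : i + 1 < m) :
    rotator m t x * t (i + 1) = t i * rotator m t x := by
  rw [rotator, mul_assoc, ← h.t_x_comm _ _ hi (by omega) (by omega) (by omega), ← mul_assoc,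
    h.descProd_mul hi le_rfl, mul_assoc]

theorem rotator_sq_mul_t_zero {n : ℕ} (hn : m = n + 1) :
    rotator m t x * (rotator m t x * t 0) = t n * rotator m t x * rotator m t x := by
  subst hn
  have hx := h.x_zero_mul_descProd (j := n) le_rfl
  have hsq : descProd t (n + 1) * descProd t (n + 1) =
      t n * descProd t (n + 1) * (descProd t (n + 1) * (t 0)⁻¹) := by
    rw [mul_assoc, h.descProd_mul_descProd le_rfl, ← mul_assoc, ← descProd_succ]
  calc rotator (n + 1) t x * (rotator (n + 1) t x * t 0)
      = descProd t (n + 1) * (x 0 * (rotator (n + 1) t x * t 0)) := by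
        simp only [rotator, mul_assoc]
    _ = descProd t (n + 1) * descProd t (n + 1) * x 0 * t 0 * x 0 := by
        rw [← h.rotator_mul_t_zero_mul_x_zero n.succ_pos]; simp only [rotator, mul_assoc]
    _ = t n * descProd t (n + 1) * (descProd t (n + 1) * (t 0)⁻¹ * x 0) * t 0 * x 0 := by
        rw [hsq]; group
    _ = t n * rotator (n + 1) t x * rotator (n + 1) t x := by
        rw [← hx]; simp only [rotator]; group

theorem rotator_mul_affineGen (hm : 0 < m) (a : Fin (m + 1)) :
    rotator m t x * affineGen m t x a = affineGen m t x (rot m a) * rotator m t x := by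
  obtain ⟨n, rfl⟩ : ∃ n, m = n + 1 := ⟨m - 1, by omega⟩
  cases a using Fin.cases with
  | zero =>
    rw [rot_zero, ← Fin.succ_last]
    change _ * (_ * _ * _) = t n * _
    rw [← mul_assoc, mul_inv_eq_iff_eq_mul, h.rotator_sq_mul_t_zero rfl]
  | succ i =>
    rw [rot_succ]
    cases i using Fin.cases with
    | zero => exact (inv_mul_cancel_right _ _).symm
    | succ i => exact h.rotator_mul_t_succ (by simp)

theorem affineGen_eq_conj (hm : 0 < m) (a : Fin (m + 1)) :
    affineGen m t x a = MulAut.conj (rotator m t x) (affineGen m t x (a + 1)) := by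
  rw [MulAut.conj_apply, h.rotator_mul_affineGen hm, rot_add_one, mul_inv_cancel_right]

theorem affineGen_succ_comm {i j : Fin m} (hij : i ≠ j)
    (hj : j.succ ≠ i.succ + 1) (hi : i.succ ≠ j.succ + 1) :
    affineGen m t x i.succ * affineGen m t x j.succ =
      affineGen m t x j.succ * affineGen m t x i.succ := by
  have succ_add_one {i j : Fin m} (hne : j.succ ≠ i.succ + 1) : (j : ℕ) ≠ i + 1 := fun hval =>
    hne (by rw [← sub_eq_iff_eq_add]; exact (rot_succ j).trans (Fin.ext (by simp [hval])))
  have hj' := succ_add_one hj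
  have hi' := succ_add_one hi
  rw [Ne, Fin.ext_iff] at hij
  rcases Nat.lt_or_gt_of_ne hij with hlt | hgt
  · exact h.comm i j (by omega) j.2
  · exact (h.comm j i (by omega) i.2).symm

theorem affineGen_comm (hm : 0 < m) {a b : Fin (m + 1)} (hab : a ≠ b) (hb : b ≠ a + 1)
    (ha : a ≠ b + 1) :
    affineGen m t x a * affineGen m t x b = affineGen m t x b * affineGen m t x a := by
  have comm_of_ne_zero {a b : Fin (m + 1)} (hab : a ≠ b) (hb : b ≠ a + 1) (ha : a ≠ b + 1)
      (ha0 : a ≠ 0) (hb0 : b ≠ 0) :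
      affineGen m t x a * affineGen m t x b = affineGen m t x b * affineGen m t x a := by
    obtain ⟨i, rfl⟩ := Fin.exists_succ_eq.2 ha0
    obtain ⟨j, rfl⟩ := Fin.exists_succ_eq.2 hb0
    exact h.affineGen_succ_comm (fun hij => hab (congrArg _ hij)) hb ha
  by_cases h0 : a ≠ 0 ∧ b ≠ 0
  · exact comm_of_ne_zero hab hb ha h0.1 h0.2
  · have hne0 : a + 1 ≠ 0 ∧ b + 1 ≠ 0 := by
      have := fin_add_one_ne hm 0
      grind
    rw [h.affineGen_eq_conj hm a, h.affineGen_eq_conj hm b, ← map_mul, ← map_mul,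
      comm_of_ne_zero (by simpa) (by simpa) (by simpa) hne0.1 hne0.2]

theorem affineGen_braid (hm : 2 ≤ m) (a : Fin (m + 1)) :
    affineGen m t x a * affineGen m t x (a + 1) * affineGen m t x a =
      affineGen m t x (a + 1) * affineGen m t x a * affineGen m t x (a + 1) := by
  have braid_of_add_one (a : Fin (m + 1))
      (h' : affineGen m t x (a + 1) * affineGen m t x (a + 1 + 1) * affineGen m t x (a + 1) =
        affineGen m t x (a + 1 + 1) * affineGen m t x (a + 1) * affineGen m t x (a + 1 + 1)) :
      affineGen m t x a * affineGen m t x (a + 1) * affineGen m t x a =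
        affineGen m t x (a + 1) * affineGen m t x a * affineGen m t x (a + 1) := by
    have hconj := congrArg (MulAut.conj (rotator m t x)) h'
    simpa only [map_mul, ← h.affineGen_eq_conj (Nat.zero_lt_of_lt hm)] using hconj
  have braid_of_ne_zero (a : Fin (m + 1)) (ha : a ≠ 0) (ha' : a + 1 ≠ 0) :
      affineGen m t x a * affineGen m t x (a + 1) * affineGen m t x a =
        affineGen m t x (a + 1) * affineGen m t x a * affineGen m t x (a + 1) := by
    obtain ⟨i, rfl⟩ := Fin.exists_succ_eq.2 ha
    obtain ⟨j, hj⟩ := Fin.exists_succ_eq.2 ha'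
    have hval : (j : ℕ) = i + 1 := by
      have := congrArg (rot m) hj
      rw [rot_succ, rot_add_one] at this
      simpa using congrArg Fin.val this
    rw [← hj]
    change t i * t j * t i = t j * t i * t j
    rw [hval]
    exact h.braid i (by omega)
  have braid_zero : affineGen m t x 0 * affineGen m t x (0 + 1) * affineGen m t x 0 =
      affineGen m t x (0 + 1) * affineGen m t x 0 * affineGen m t x (0 + 1) := by
    refine braid_of_add_one 0 (braid_of_ne_zero _ (fin_add_one_ne (by omega) 0) ?_)
    rw [Ne, Fin.ext_iff]
    obtain ⟨n, rfl⟩ : ∃ n, m = n + 2 := ⟨m - 2, by omega⟩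
    simp [Fin.val_add, Nat.mod_eq_of_lt (show 2 < n + 2 + 1 by omega)]
  by_cases ha : a = 0
  · exact ha ▸ braid_zero
  by_cases ha' : a + 1 = 0
  · exact braid_of_add_one a (ha' ▸ braid_zero)
  exact braid_of_ne_zero a ha ha'

end BernsteinRel

/-- A family indexed by `Fin n`, extended by `1` to `ℕ`. -/
def extendOne {n : ℕ} (t : Fin n → G) : ℕ → G := Function.extend Fin.val t 1

@[simp] theorem extendOne_val {n : ℕ} (t : Fin n → G) (i : Fin n) : extendOne t i = t i :=
  Fin.val_injective.extend_apply t 1 i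

theorem extendOne_of_lt {n : ℕ} (t : Fin n → G) {i : ℕ} (h : i < n) :
    extendOne t i = t ⟨i, h⟩ :=
  extendOne_val t ⟨i, h⟩

theorem descProd_extendOne {n : ℕ} (t : Fin n → G) :
    descProd (extendOne t) n = (List.ofFn t).reverse.prod := by
  simp only [descProd, extendOne_val]

theorem prod_tail_ofFn {n : ℕ} (hn : 0 < n) (t : Fin n → G) :
    (List.ofFn t).tail.prod = (extendOne t 0)⁻¹ * ascProd (extendOne t) n := by
  obtain ⟨n, rfl⟩ : ∃ k, n = k + 1 := ⟨n - 1, by omega⟩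
  simp [ascProd, extendOne_of_lt _ n.succ_pos]

end Group

/-! ### The extended affine Weyl group as a group of affine permutations -/

theorem X_mul_X (i j : Fin (m + 1)) : (X i * X j : W m) = X j * X i := by
  simp only [X, ← map_mul, mul_comm]

theorem mulAutArrow_mulSingle (σ : Equiv.Perm (Fin (m + 1))) (j : Fin (m + 1))
    (c : Multiplicative ℤ) :
    mulAutArrow σ (Pi.mulSingle j c : Lattice m) = Pi.mulSingle (σ j) c := by
  funext i
  change (Pi.mulSingle j _ : Lattice m) (σ⁻¹ i) = _
  simp [Pi.mulSingle_apply, Equiv.symm_apply_eq]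

theorem closure_mulSingle (m : ℕ) : Subgroup.closure
    (Set.range fun j => (Pi.mulSingle j (Multiplicative.ofAdd 1) : Lattice m)) = ⊤ := by
  rw [eq_top_iff]
  intro f _
  rw [← Finset.univ_prod_mulSingle f]
  refine Subgroup.prod_mem _ fun j _ => ?_
  have hpow : (Pi.mulSingle j (f j) : Lattice m) =
      (Pi.mulSingle j (Multiplicative.ofAdd 1)) ^ (f j).toAdd := by
    rw [← Pi.mulSingle_zpow, ← ofAdd_zsmul]; simp
  rw [hpow]
  exact Subgroup.zpow_mem _ (Subgroup.subset_closure (Set.mem_range_self j)) _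

theorem inr_mul_X (σ : Equiv.Perm (Fin (m + 1))) (j : Fin (m + 1)) :
    (SemidirectProduct.inr σ * X j : W m) = X (σ j) * SemidirectProduct.inr σ := by
  ext1
  · simp only [X, SemidirectProduct.mul_left, SemidirectProduct.left_inr,
      SemidirectProduct.right_inr, SemidirectProduct.left_inl, one_mul, map_one, mul_one,
      SemidirectProduct.right_inl]
    exact mulAutArrow_mulSingle _ _ _
  · simp [X]

theorem s_mul_X (i : Fin m) (j : Fin (m + 1)) :
    s i * X j = X (Equiv.swap i.castSucc i.succ j) * s i := inr_mul_X _ _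

theorem s_mul_self (i : Fin m) : s i * s i = 1 := by
  rw [s, ← map_mul, Equiv.swap_mul_self, map_one]

theorem s_comm {i j : Fin m} (h : (i : ℕ) + 1 < j) : s i * s j = s j * s i := by
  simp only [s, ← map_mul]
  congr 1
  ext x
  simp only [Equiv.Perm.mul_apply, Equiv.swap_apply_def]
  grind

theorem s_braid {i j : Fin m} (h : (j : ℕ) = i + 1) : s i * s j * s i = s j * s i * s j := by
  have hij : i.succ = j.castSucc := Fin.ext h.symm
  simp only [s, ← map_mul]
  rw [hij, Equiv.swap_mul_swap_mul_swap, Equiv.swap_comm i.castSucc, Equiv.swap_comm _ j.succ,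
      Equiv.swap_mul_swap_mul_swap, Equiv.swap_comm] <;>
    simp [Fin.ext_iff] <;> omega

theorem bernsteinRel_W (m : ℕ) : BernsteinRel m (extendOne (s (m := m))) (extendOne X) 1 where
  comm i j hij hj := by
    rw [extendOne_of_lt s hj, extendOne_of_lt s (show i < m by omega), s_comm hij]
  braid i hi := by
    rw [extendOne_of_lt s hi, extendOne_of_lt s (show i < m by omega), s_braid rfl]
  x_comm i j hi hj := by
    rw [extendOne_of_lt X (Nat.lt_succ_of_le hi), extendOne_of_lt X (Nat.lt_succ_of_le hj), X_mul_X]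
  t_x_comm i j hi hj hne hne' := by
    rw [extendOne_of_lt s hi, extendOne_of_lt X (Nat.lt_succ_of_le hj), s_mul_X,
      Equiv.swap_apply_of_ne_of_ne] <;> simpa [Fin.ext_iff]
  t_x_t i hi := by
    rw [extendOne_of_lt s hi, extendOne_of_lt X (show i < m + 1 by omega),
      extendOne_of_lt X (show i + 1 < m + 1 by omega), s_mul_X, mul_assoc, s_mul_self, mul_one,
      one_mul]
    exact congrArg X (Equiv.swap_apply_left _ _)
  central g := by simp

theorem tau_eq_rotator (m : ℕ) : tau m = rotator m (extendOne s) (extendOne X) := by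
  rw [tau, rotator, descProd_extendOne, extendOne_of_lt X m.succ_pos]; rfl

theorem sAff_succ (i : Fin m) : sAff i.succ = s i := rfl

section NeZero

variable [NeZero m]

theorem sAff_eq_affineGen : sAff (m := m) = affineGen m (extendOne s) (extendOne X) := by
  have hm := NeZero.pos m
  funext a
  cases a using Fin.cases with
  | succ i => exact (extendOne_val s i).symm
  | zero =>
    have hinv : (s0 m)⁻¹ = affineGen m (extendOne s) (extendOne X) 0 := by
      rw [(bernsteinRel_W m).affineGen_zero hm, s0, prod_tail_ofFn hm, ← descProd_extendOne,
        one_pow, one_mul, mul_inv_rev, mul_inv_rev, inv_inv, extendOne_of_lt X m.succ_pos,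
        extendOne_of_lt X m.lt_succ_self]
      exact congrArg (· * _) (Commute.inv_left (X_mul_X _ _)).eq.symm
    rw [← inv_inj, show sAff 0 = s0 m from rfl, hinv]
    change _ = (_ * _ * _)⁻¹
    rw [mul_inv_rev, mul_inv_rev, inv_inv, extendOne_of_lt s hm,
      inv_eq_of_mul_eq_one_right (s_mul_self _), ← extendOne_of_lt s hm, ← mul_assoc]
    rfl

theorem tau_mul_sAff (a : Fin (m + 1)) : tau m * sAff a = sAff (rot m a) * tau m := by
  rw [tau_eq_rotator, sAff_eq_affineGen]
  exact (bernsteinRel_W m).rotator_mul_affineGen (NeZero.pos m) a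

theorem tau_zpow_mul_prod (e : ℤ) (l : List (Fin (m + 1))) :
    tau m ^ e * (l.map sAff).prod = ((l.map (rot m ^ e)).map sAff).prod * tau m ^ e :=
  zpow_mul_prod_map_of_mul_eq tau_mul_sAff e l

theorem sAff_comm {a b : Fin (m + 1)} (hab : a ≠ b) (hb : b ≠ a + 1) (ha : a ≠ b + 1) :
    sAff a * sAff b = sAff b * sAff a := by
  simpa only [sAff_eq_affineGen] using (bernsteinRel_W m).affineGen_comm (NeZero.pos m) hab hb ha

theorem sAff_braid (hm : 2 ≤ m) (a : Fin (m + 1)) :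
    sAff a * sAff (a + 1) * sAff a = sAff (a + 1) * sAff a * sAff (a + 1) := by
  simpa only [sAff_eq_affineGen] using (bernsteinRel_W m).affineGen_braid hm a

theorem sAff_mul_self (a : Fin (m + 1)) : sAff a * sAff a = 1 := by
  have sAff_succ_mul_self (i : Fin m) : sAff i.succ * sAff i.succ = 1 := s_mul_self i
  cases a using Fin.cases with
  | zero =>
    have hconj := (bernsteinRel_W m).affineGen_eq_conj (NeZero.pos m) 0
    obtain ⟨i, hi⟩ := Fin.exists_succ_eq.2 (fin_add_one_ne (NeZero.pos m) 0)
    rw [sAff_eq_affineGen, hconj, ← map_mul, ← sAff_eq_affineGen, ← hi, sAff_succ_mul_self, map_one]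
  | succ i => exact sAff_succ_mul_self i

theorem sAff_mul_cancel (a : Fin (m + 1)) (w : W m) : sAff a * (sAff a * w) = w := by
  rw [← mul_assoc, sAff_mul_self, one_mul]

theorem mul_sAff_cancel (a : Fin (m + 1)) (w : W m) : w * sAff a * sAff a = w := by
  rw [mul_assoc, sAff_mul_self, mul_one]

theorem sAff_inv (a : Fin (m + 1)) : (sAff a)⁻¹ = sAff a :=
  inv_eq_of_mul_eq_one_right (sAff_mul_self a)

end NeZero

/-- The residue of an integer modulo `n = m + 1`, as an index of `s_0, …, s_{n-1}`. -/
def res (m : ℕ) (x : ℤ) : Fin (m + 1) :=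
  ⟨(x % (m + 1)).toNat, by have := Int.emod_lt_of_pos x (b := m + 1) (by omega); omega⟩

theorem dvd_sub_res (x : ℤ) : (m + 1 : ℤ) ∣ x - res m x := by
  have hval : ((res m x : ℕ) : ℤ) = x % (m + 1) :=
    Int.toNat_of_nonneg (Int.emod_nonneg x (by omega))
  rw [hval]
  exact Int.dvd_self_sub_emod

theorem res_eq_iff {x : ℤ} {a : Fin (m + 1)} : res m x = a ↔ (m + 1 : ℤ) ∣ x - a := by
  refine ⟨fun h => h ▸ dvd_sub_res x, fun h => ?_⟩
  have hdvd : (m + 1 : ℤ) ∣ (res m x : ℤ) - a := by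
    simpa using dvd_sub h (dvd_sub_res x)
  have hzero := Int.eq_zero_of_abs_lt_dvd hdvd (by grind)
  exact Fin.ext (by omega)

theorem res_eq_iff_exists {x : ℤ} {a : Fin (m + 1)} :
    res m x = a ↔ ∃ k : ℤ, x = a + k * (m + 1) := by
  rw [res_eq_iff]
  exact exists_congr fun k => by grind

@[simp] theorem res_natCast (a : Fin (m + 1)) : res m ((a : ℕ) : ℤ) = a :=
  res_eq_iff.2 (by simp)

theorem res_add_mul (x k : ℤ) : res m (x + k * (m + 1)) = res m x := by
  rw [res_eq_iff, add_sub_right_comm]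
  exact dvd_add (dvd_sub_res x) (dvd_mul_left _ _)

theorem res_sub_one (x : ℤ) : res m (x - 1) = rot m (res m x) := by
  obtain ⟨c, hc⟩ := dvd_sub_res (m := m) x
  generalize res m x = a at hc
  rw [res_eq_iff]
  cases a using Fin.cases with
  | zero =>
    rw [Fin.val_zero, Nat.cast_zero] at hc
    rw [rot_zero, Fin.val_last]
    exact ⟨c - 1, by linear_combination hc⟩
  | succ i =>
    rw [Fin.val_succ, Nat.cast_succ] at hc
    rw [rot_succ, Fin.val_castSucc]
    exact ⟨c, by linear_combination hc⟩

theorem res_add_one_eq_iff {x : ℤ} {a : Fin (m + 1)} : res m (x + 1) = a ↔ res m x = rot m a := by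
  rw [← (rot m).injective.eq_iff, ← res_sub_one, add_sub_cancel_right]

theorem res_add_sub_mul {x : ℤ} {j : Fin (m + 1)} (k : ℤ) :
    res m (x + (j - res m x) - k * (m + 1)) = j := by
  obtain ⟨c, hc⟩ := dvd_sub_res (m := m) x
  exact res_eq_iff.2 ⟨c - k, by linear_combination hc⟩

/-- The action of `W` on `ℤ` by affine permutations: `𝔖` permutes the residues `0, …, m`, and `X_j`
lowers the integers of residue `j` by `n = m + 1`. -/
def affineAct (w : W m) (x : ℤ) : ℤ :=
  x + (w.right (res m x) - res m x) - (w.left (w.right (res m x))).toAdd * (m + 1)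

theorem res_affineAct (w : W m) (x : ℤ) : res m (affineAct w x) = w.right (res m x) :=
  res_add_sub_mul _

theorem affineAct_one (x : ℤ) : affineAct (1 : W m) x = x := by simp [affineAct]

theorem affineAct_mul (w w' : W m) (x : ℤ) :
    affineAct (w * w') x = affineAct w (affineAct w' x) := by
  have hleft (j : Fin (m + 1)) :
      (mulAutArrow w.right w'.left : Lattice m) (w.right j) = w'.left j :=
    congrArg w'.left (w.right.symm_apply_apply j)
  rw [affineAct, affineAct, res_affineAct, affineAct]
  simp only [SemidirectProduct.mul_left, SemidirectProduct.mul_right, Pi.mul_apply, toAdd_mul,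
    Equiv.Perm.mul_apply, hleft]
  ring

/-- `affineAct` as a homomorphism to the permutations of `ℤ`. -/
def affinePerm : W m →* Equiv.Perm ℤ :=
  MonoidHom.toHomPerm
    { toFun := affineAct
      map_one' := funext affineAct_one
      map_mul' w w' := funext (affineAct_mul w w') }

theorem affinePerm_apply (w : W m) (x : ℤ) :
    affinePerm w x = x + (w.right (res m x) - res m x) -
      (w.left (w.right (res m x))).toAdd * (m + 1) := rfl

theorem res_affinePerm (w : W m) (x : ℤ) : res m (affinePerm w x) = w.right (res m x) :=
  res_affineAct w x

theorem affinePerm_add_mul (w : W m) (x k : ℤ) :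
    affinePerm w (x + k * (m + 1)) = affinePerm w x + k * (m + 1) := by
  rw [affinePerm_apply, affinePerm_apply, res_add_mul]
  ring

theorem affinePerm_injective : Function.Injective (affinePerm (m := m)) := by
  intro w w' h
  have hright : w.right = w'.right := by
    ext1 j
    rw [← res_natCast j, ← res_affinePerm, ← res_affinePerm, h]
  refine SemidirectProduct.ext ?_ hright
  funext j
  have hj := DFunLike.congr_fun h ((w.right⁻¹ j : Fin (m + 1)) : ℤ)
  rw [affinePerm_apply, affinePerm_apply, ← hright] at hj
  have hm : (m + 1 : ℤ) ≠ 0 := by omega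
  simpa [hm] using hj

theorem affinePerm_inr_apply (σ : Equiv.Perm (Fin (m + 1))) (x : ℤ) :
    affinePerm (SemidirectProduct.inr σ : W m) x = x + (σ (res m x) - res m x) := by
  simp [affinePerm_apply]

theorem affinePerm_X (j : Fin (m + 1)) (x : ℤ) :
    affinePerm (X j) x = if res m x = j then x - (m + 1) else x := by
  simp only [affinePerm_apply, X, SemidirectProduct.left_inl, SemidirectProduct.right_inl,
    Pi.mulSingle_apply]
  split_ifs <;> simp_all

theorem affinePerm_s (i : Fin m) (x : ℤ) :
    affinePerm (s i) x =
      if res m x = i.succ then x - 1 else if res m x = i.castSucc then x + 1 else x := by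
  rw [s, affinePerm_inr_apply]
  split_ifs with hsucc hcast
  · rw [hsucc, Equiv.swap_apply_right]
    simp only [Fin.val_castSucc, Fin.val_succ]
    push_cast
    ring
  · rw [hcast, Equiv.swap_apply_left]
    simp only [Fin.val_castSucc, Fin.val_succ]
    push_cast
    ring
  · rw [Equiv.swap_apply_of_ne_of_ne hcast hsucc]
    ring

theorem affinePerm_descProd_s {j : ℕ} (hj : j ≤ m) (x : ℤ) :
    affinePerm (descProd (extendOne s) j : W m) x =
      if res m x = 0 then x + j else if (res m x : ℕ) ≤ j then x - 1 else x := by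
  induction j with
  | zero => grind [descProd_zero, Equiv.Perm.one_apply, Fin.val_eq_zero_iff]
  | succ j ih =>
    rw [descProd_succ, map_mul, Equiv.Perm.mul_apply, ih (by omega),
      extendOne_of_lt s (show j < m by omega), affinePerm_s]
    by_cases hzero : res m x = 0
    · have hres : res m (x + j) = (⟨j, hj⟩ : Fin m).castSucc := by
        rw [res_eq_iff, Fin.val_castSucc, add_sub_cancel_right]
        simpa [hzero] using dvd_sub_res (m := m) x
      simp [hzero, hres, Fin.ext_iff]
      ring
    · have hres : (res m (x - 1) : ℕ) = res m x - 1 := by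
        rw [res_sub_one, val_rot_of_ne_zero hzero]
      rw [if_neg hzero, if_neg hzero]
      have hpos : (res m x : ℕ) ≠ 0 := fun h => hzero (Fin.ext h)
      simp only [Fin.ext_iff, Fin.val_succ, Fin.val_castSucc]
      split_ifs <;> omega

theorem affinePerm_tau (x : ℤ) : affinePerm (tau m) x = x - 1 := by
  rw [tau_eq_rotator, rotator, extendOne_of_lt X m.succ_pos, map_mul, Equiv.Perm.mul_apply,
    affinePerm_descProd_s le_rfl, affinePerm_X, Fin.zero_eta]
  by_cases hzero : res m x = 0
  · have hres : res m (x - (m + 1)) = 0 := by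
      simpa [hzero, sub_eq_add_neg] using res_add_mul (m := m) x (-1)
    rw [if_pos hzero, if_pos hres]
    ring
  · rw [if_neg hzero, if_neg hzero, if_pos (Nat.lt_succ_iff.1 (res m x).2)]

/-! ### Length and descents -/

theorem affinePerm_tau_zpow (e x : ℤ) : affinePerm (tau m ^ e) x = x - e := by
  induction e generalizing x with
  | zero => simp
  | succ n ih => rw [zpow_add_one, map_mul, Equiv.Perm.mul_apply, affinePerm_tau, ih]; ring
  | pred n ih =>
    have hinv : affinePerm (tau m)⁻¹ x = x + 1 := by
      rw [map_inv, Equiv.Perm.inv_eq_iff_eq, affinePerm_tau, add_sub_cancel_right]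
    rw [zpow_sub_one, map_mul, Equiv.Perm.mul_apply, hinv, ih]; ring

/-- `a` is a right descent of `w`, that is, `w s_a` is shorter than `w`. -/
def Desc (w : W m) (a : Fin (m + 1)) : Prop := affinePerm w a < affinePerm w (a - 1)

theorem not_desc_one (a : Fin (m + 1)) : ¬ Desc (1 : W m) a := by
  simp [Desc]

theorem not_desc_iff {w : W m} {a : Fin (m + 1)} :
    ¬ Desc w a ↔ affinePerm w (a - 1) < affinePerm w a := by
  have hne : affinePerm w a ≠ affinePerm w (a - 1) := (affinePerm w).injective.ne (by omega)
  rw [Desc]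
  omega

theorem desc_iff_of_res {w : W m} {a : Fin (m + 1)} {x : ℤ} (h : res m x = a) :
    Desc w a ↔ affinePerm w x < affinePerm w (x - 1) := by
  obtain ⟨k, rfl⟩ := res_eq_iff_exists.1 h
  rw [add_sub_right_comm, affinePerm_add_mul, affinePerm_add_mul, add_lt_add_iff_right, Desc]

theorem inr_mem_closure (σ : Equiv.Perm (Fin (m + 1))) :
    (SemidirectProduct.inr σ : W m) ∈ Subgroup.closure (Set.range s) := by
  have hσ : σ ∈ Submonoid.closure (Set.range fun i : Fin m => Equiv.swap i.castSucc i.succ) := by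
    rw [Equiv.Perm.mclosure_swap_castSucc_succ]
    exact Submonoid.mem_top σ
  induction hσ using Submonoid.closure_induction with
  | mem _ hx => obtain ⟨i, rfl⟩ := hx; exact Subgroup.subset_closure ⟨i, rfl⟩
  | one => rw [map_one]; exact one_mem _
  | mul _ _ _ _ hx hy => rw [map_mul]; exact mul_mem hx hy

theorem closure_sAff_tau (m : ℕ) :
    Subgroup.closure (insert (tau m) (Set.range sAff)) = ⊤ := by
  set Q := Subgroup.closure (insert (tau m) (Set.range sAff))
  have inr_mem (σ) : (SemidirectProduct.inr σ : W m) ∈ Q := by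
    refine Subgroup.closure_mono ?_ (inr_mem_closure σ)
    rintro _ ⟨i, rfl⟩
    exact Or.inr ⟨i.succ, rfl⟩
  have X_zero_mem : (X 0 : W m) ∈ Q := by
    refine (Subgroup.mul_mem_cancel_left _ (Subgroup.list_prod_mem _ fun x hx => ?_)).1
      (Subgroup.subset_closure (Or.inl rfl) : tau m ∈ Q)
    obtain ⟨i, rfl⟩ := List.mem_ofFn.1 (List.mem_reverse.1 hx)
    exact inr_mem _
  have X_mem (j) : (X j : W m) ∈ Q := by
    have hconj := inr_mul_X (Equiv.swap 0 j) 0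
    rw [Equiv.swap_apply_left] at hconj
    rw [eq_mul_inv_of_mul_eq hconj.symm]
    exact Q.mul_mem (Q.mul_mem (inr_mem _) X_zero_mem) (Q.inv_mem (inr_mem _))
  have inl_mem (f : Lattice m) : (SemidirectProduct.inl f : W m) ∈ Q := by
    have hle : Subgroup.closure (Set.range fun j => (Pi.mulSingle j (Multiplicative.ofAdd 1) :
        Lattice m)) ≤ Q.comap (SemidirectProduct.inl : Lattice m →* W m) := by
      rw [Subgroup.closure_le]
      rintro _ ⟨j, rfl⟩
      exact X_mem j
    rw [closure_mulSingle] at hle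
    exact hle (Subgroup.mem_top f)
  rw [eq_top_iff]
  intro w _
  rw [← SemidirectProduct.inl_left_mul_inr_right w]
  exact Q.mul_mem (inl_mem _) (inr_mem _)

theorem isExpr_sAff (a : Fin (m + 1)) : IsExpr (sAff a) ([a], 0) := by simp [IsExpr]

theorem isExpr_prod (l : List (Fin (m + 1))) : IsExpr (l.map sAff).prod (l, 0) := by simp [IsExpr]

theorem length_le {w : W m} {l : List (Fin (m + 1))} {e : ℤ} (h : IsExpr w (l, e)) :
    length w ≤ l.length := Nat.sInf_le ⟨(l, e), h, rfl⟩

/-- The homomorphism `W → ℤ` that sends `τ` to `1` and the simple reflections to `0`; it recovers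
the exponent of `τ` in an expression. -/
def deg (m : ℕ) : W m →* Multiplicative ℤ where
  toFun w := ∏ j, w.left j
  map_one' := by simp
  map_mul' w w' := by
    simp only [SemidirectProduct.mul_left, Pi.mul_apply, Finset.prod_mul_distrib]
    congr 1
    exact Equiv.prod_comp (w.right⁻¹) w'.left

theorem deg_inr (σ : Equiv.Perm (Fin (m + 1))) : deg m (SemidirectProduct.inr σ) = 1 := by
  simp [deg]

theorem deg_tau (m : ℕ) : deg m (tau m) = Multiplicative.ofAdd 1 := by
  rw [tau, map_mul, map_list_prod, List.prod_eq_one, one_mul]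
  · simp [deg, X]
  · intro x hx
    simp only [List.mem_map, List.mem_reverse, List.mem_ofFn] at hx
    obtain ⟨_, ⟨i, rfl⟩, rfl⟩ := hx
    exact deg_inr _

section NeZero

variable [NeZero m]

theorem affinePerm_sAff (a : Fin (m + 1)) (x : ℤ) :
    affinePerm (sAff a) x =
      if res m x = a then x - 1 else if res m x = rot m a then x + 1 else x := by
  cases a using Fin.cases with
  | succ i => rw [sAff_succ, affinePerm_s, rot_succ]
  | zero =>
    obtain ⟨n, rfl⟩ : ∃ k, m = k + 1 := ⟨m - 1, by have := NeZero.pos m; omega⟩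
    have hconj := DFunLike.congr_fun
      (congrArg affinePerm (tau_mul_sAff (m := n + 1) (Fin.succ 0))) (x + 1)
    rw [rot_succ, Fin.castSucc_zero, map_mul, map_mul, Equiv.Perm.mul_apply, Equiv.Perm.mul_apply,
      affinePerm_tau, affinePerm_tau, add_sub_cancel_right, sAff_succ, affinePerm_s, ← rot_succ]
      at hconj
    simp only [res_add_one_eq_iff, rot_succ, Fin.castSucc_zero] at hconj
    rw [← hconj]
    split_ifs <;> ring

theorem affinePerm_sAff_of_res {a : Fin (m + 1)} {x : ℤ} (h : res m x = a) :
    affinePerm (sAff a) x = x - 1 := by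
  rw [affinePerm_sAff, if_pos h]

theorem affinePerm_sAff_sub_one {a : Fin (m + 1)} {x : ℤ} (h : res m x = a) :
    affinePerm (sAff a) (x - 1) = x := by
  rw [← affinePerm_sAff_of_res h, ← Equiv.Perm.mul_apply, ← map_mul, sAff_mul_self, map_one,
    Equiv.Perm.one_apply]

theorem affinePerm_sAff_of_ne {a : Fin (m + 1)} {x : ℤ} (h : res m x ≠ a)
    (h' : res m x ≠ rot m a) : affinePerm (sAff a) x = x := by
  rw [affinePerm_sAff, if_neg h, if_neg h']

theorem eq_add_one_of_lt_of_affinePerm_sAff_lt {a : Fin (m + 1)} {x y : ℤ} (h : x < y)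
    (h' : affinePerm (sAff a) y < affinePerm (sAff a) x) : y = x + 1 ∧ res m y = a := by
  rw [affinePerm_sAff, affinePerm_sAff] at h'
  have hxy : y = x + 1 := by split_ifs at h' <;> omega
  subst hxy
  simp only [res_add_one_eq_iff] at h' ⊢
  split_ifs at h' <;> first | omega | simp_all

theorem mul_sAff_eq {u : W m} {a : Fin (m + 1)}
    (h : affinePerm u (a - 1) = affinePerm u a - 1) : u * sAff a = sAff (u.right a) * u := by
  have hres (x : ℤ) (b : Fin (m + 1)) : res m (affinePerm u x) = u.right b ↔ res m x = b := by
    rw [res_affinePerm, u.right.injective.eq_iff]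
  have hrot : u.right (rot m a) = rot m (u.right a) := by
    rw [← res_natCast a, ← res_sub_one, ← res_affinePerm, ← res_affinePerm, ← res_sub_one]
    simp [h]
  apply affinePerm_injective
  ext x
  rw [map_mul, map_mul, Equiv.Perm.mul_apply, Equiv.Perm.mul_apply]
  have hsub {y : ℤ} (hy : res m y = a) : affinePerm u (y - 1) = affinePerm u y - 1 := by
    obtain ⟨k, rfl⟩ := res_eq_iff_exists.1 hy
    rw [add_sub_right_comm, affinePerm_add_mul, affinePerm_add_mul, h, sub_add_eq_add_sub]
  simp only [affinePerm_sAff, ← hrot, hres]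
  split_ifs with ha ha'
  · exact hsub ha
  · have := hsub (res_add_one_eq_iff.2 ha')
    rw [add_sub_cancel_right] at this
    omega
  · rfl

theorem exists_eq_append_of_affinePerm_lt (l : List (Fin (m + 1))) {x y : ℤ} (h : x < y)
    (h' : affinePerm (l.map sAff).prod y < affinePerm (l.map sAff).prod x) :
    ∃ l₁ l₂, l = l₁ ++ res m (affinePerm (l₂.map sAff).prod y) :: l₂ ∧
      affinePerm (l₂.map sAff).prod x = affinePerm (l₂.map sAff).prod y - 1 := by
  induction l with
  | nil =>
    rw [List.map_nil, List.prod_nil, map_one, Equiv.Perm.one_apply, Equiv.Perm.one_apply] at h'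
    exact (h.asymm h').elim
  | cons a l ih =>
    rw [List.map_cons, List.prod_cons, map_mul, Equiv.Perm.mul_apply, Equiv.Perm.mul_apply] at h'
    rcases lt_trichotomy (affinePerm (l.map sAff).prod x) (affinePerm (l.map sAff).prod y) with
      hlt | heq | hgt
    · obtain ⟨hadd, hres⟩ := eq_add_one_of_lt_of_affinePerm_sAff_lt hlt h'
      exact ⟨[], l, by rw [hres]; rfl, by omega⟩
    · exact (h.ne ((affinePerm _).injective heq)).elim
    · obtain ⟨l₁, l₂, hl, hsub⟩ := ih hgt
      exact ⟨a :: l₁, l₂, congrArg (a :: ·) hl, hsub⟩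

theorem desc_mul_sAff_iff {w : W m} {a : Fin (m + 1)} : Desc (w * sAff a) a ↔ ¬ Desc w a := by
  have hres := res_natCast a
  rw [not_desc_iff, Desc, map_mul, Equiv.Perm.mul_apply, Equiv.Perm.mul_apply,
    affinePerm_sAff_of_res hres, affinePerm_sAff_sub_one hres]

theorem exchange {x y : W m} {l : List (Fin (m + 1))} {e : ℤ} {a : Fin (m + 1)}
    (hx : IsExpr x (l, e)) (hy : ¬ Desc y a) (h : Desc (x * y) a) :
    ∃ l₁ b l₂, l = l₁ ++ b :: l₂ ∧ IsExpr (x * (y * sAff a * y⁻¹)) (l₁ ++ l₂, e) := by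
  simp only [IsExpr] at hx ⊢
  subst hx
  have hlt : affinePerm (tau m ^ e * y) (a - 1) < affinePerm (tau m ^ e * y) a := by
    rw [map_mul, Equiv.Perm.mul_apply, Equiv.Perm.mul_apply, affinePerm_tau_zpow,
      affinePerm_tau_zpow, sub_lt_sub_iff_right]
    exact not_desc_iff.1 hy
  rw [Desc, mul_assoc, map_mul, Equiv.Perm.mul_apply, Equiv.Perm.mul_apply] at h
  obtain ⟨l₁, l₂, hl, hsub⟩ := exists_eq_append_of_affinePerm_lt l hlt h
  refine ⟨l₁, _, l₂, hl, ?_⟩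
  rw [← Equiv.Perm.mul_apply, ← Equiv.Perm.mul_apply, ← map_mul] at hsub
  have hconj := mul_sAff_eq hsub
  rw [← Equiv.Perm.mul_apply, ← map_mul, res_affinePerm, res_natCast] at hl
  simp only [hl, List.map_append, List.prod_append, List.map_cons, List.prod_cons]
  generalize (l₂.map sAff).prod = z at hconj ⊢
  calc _ = (l₁.map sAff).prod * sAff ((z * (tau m ^ e * y)).right a) *
        (z * (tau m ^ e * y) * sAff a) * y⁻¹ := by group
    _ = (l₁.map sAff).prod * z * tau m ^ e := by
      rw [hconj, ← mul_assoc, mul_sAff_cancel]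
      group

theorem IsExpr.mul {w w' : W m} {l l' : List (Fin (m + 1))} {e e' : ℤ} (h : IsExpr w (l, e))
    (h' : IsExpr w' (l', e')) : IsExpr (w * w') (l ++ l'.map (rot m ^ e), e + e') := by
  simp only [IsExpr] at *
  rw [h, h', List.map_append, List.prod_append, zpow_add, mul_assoc, ← mul_assoc (tau m ^ e),
    tau_zpow_mul_prod]
  simp only [mul_assoc]

theorem IsExpr.inv {w : W m} {l : List (Fin (m + 1))} {e : ℤ} (h : IsExpr w (l, e)) :
    IsExpr w⁻¹ (l.reverse.map (rot m ^ (-e)), -e) := by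
  simp only [IsExpr] at *
  rw [h, ← tau_zpow_mul_prod, mul_inv_rev, zpow_neg, List.prod_inv_reverse]
  congr 2
  simp [List.map_reverse, sAff_inv, Function.comp_def]

theorem exists_isExpr (w : W m) : ∃ l e, IsExpr w (l, e) := by
  have hw : w ∈ Subgroup.closure (insert (tau m) (Set.range sAff)) := by
    rw [closure_sAff_tau]
    exact Subgroup.mem_top w
  induction hw using Subgroup.closure_induction with
  | mem x hx =>
    rcases hx with rfl | ⟨a, rfl⟩
    · exact ⟨[], 1, by simp [IsExpr]⟩
    · exact ⟨_, _, isExpr_sAff a⟩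
  | one => exact ⟨_, _, isExpr_prod []⟩
  | mul _ _ _ _ hx hy =>
    obtain ⟨_, _, hx⟩ := hx
    obtain ⟨_, _, hy⟩ := hy
    exact ⟨_, _, hx.mul hy⟩
  | inv _ _ hx =>
    obtain ⟨_, _, hx⟩ := hx
    exact ⟨_, _, hx.inv⟩

theorem exists_reduced (w : W m) : ∃ l e, IsExpr w (l, e) ∧ l.length = length w := by
  obtain ⟨l, e, h⟩ := exists_isExpr w
  obtain ⟨⟨l', e'⟩, h', hlen⟩ := Nat.sInf_mem
    (s := {r | ∃ e : List (Fin (m + 1)) × ℤ, IsExpr w e ∧ e.1.length = r}) ⟨_, (l, e), h, rfl⟩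
  exact ⟨l', e', h', hlen⟩

theorem length_inv (w : W m) : length w⁻¹ = length w := by
  have length_inv_le (w : W m) : length w⁻¹ ≤ length w := by
    obtain ⟨l, e, hw, hl⟩ := exists_reduced w
    rw [← hl]
    exact (length_le hw.inv).trans (by simp)
  exact le_antisymm (length_inv_le w) (by simpa using length_inv_le w⁻¹)

theorem length_mul_le (w w' : W m) : length (w * w') ≤ length w + length w' := by
  obtain ⟨l, e, hw, hl⟩ := exists_reduced w
  obtain ⟨l', e', hw', hl'⟩ := exists_reduced w'
  rw [← hl, ← hl']
  exact (length_le (hw.mul hw')).trans (by simp)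

theorem length_mul_sAff_le (w : W m) (a : Fin (m + 1)) : length (w * sAff a) ≤ length w + 1 :=
  (length_mul_le w _).trans (Nat.add_le_add_left (length_le (isExpr_sAff a)) _)

theorem length_mul_sAff_of_desc {w : W m} {a : Fin (m + 1)} (h : Desc w a) :
    length w = length (w * sAff a) + 1 := by
  obtain ⟨l, e, hw, hl⟩ := exists_reduced w
  obtain ⟨l₁, b, l₂, rfl, h'⟩ := exchange hw (not_desc_one a) (by rwa [mul_one])
  rw [one_mul, inv_one, mul_one] at h'
  have hle := length_le h'
  have hle' := length_mul_sAff_le (w * sAff a) a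
  rw [mul_sAff_cancel] at hle'
  rw [List.length_append, List.length_cons] at hl
  rw [List.length_append] at hle
  omega

theorem length_mul_sAff_of_not_desc {w : W m} {a : Fin (m + 1)} (h : ¬ Desc w a) :
    length (w * sAff a) = length w + 1 := by
  have := length_mul_sAff_of_desc (desc_mul_sAff_iff.2 h)
  rwa [mul_sAff_cancel] at this

theorem desc_iff_length_lt {w : W m} {a : Fin (m + 1)} :
    Desc w a ↔ length (w * sAff a) < length w := by
  by_cases h : Desc w a
  · simp [h, length_mul_sAff_of_desc h]
  · simp [h, length_mul_sAff_of_not_desc h]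

theorem length_sAff_mul (a : Fin (m + 1)) (w : W m) :
    length (sAff a * w) = length (w⁻¹ * sAff a) := by
  rw [← length_inv, mul_inv_rev, sAff_inv]

theorem length_sAff_mul_of_desc {a : Fin (m + 1)} {w : W m} (h : Desc w⁻¹ a) :
    length w = length (sAff a * w) + 1 := by
  rw [length_sAff_mul, ← length_mul_sAff_of_desc h, length_inv]

theorem desc_inv_iff {w : W m} {a : Fin (m + 1)} :
    Desc w⁻¹ a ↔ length (sAff a * w) < length w := by
  rw [desc_iff_length_lt, length_sAff_mul, length_inv]

theorem deg_sAff (a : Fin (m + 1)) : deg m (sAff a) = 1 := by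
  have hsq := congrArg (deg m) (sAff_mul_self a)
  rw [map_mul, map_one, ← pow_two] at hsq
  have hadd := congrArg Multiplicative.toAdd hsq
  rw [toAdd_pow] at hadd
  apply Multiplicative.toAdd.injective
  simpa using hadd

theorem deg_prod (l : List (Fin (m + 1))) : deg m (l.map sAff).prod = 1 := by
  rw [map_list_prod, List.map_map]
  exact List.prod_eq_one (by simp [deg_sAff])

theorem deg_of_isExpr {w : W m} {l : List (Fin (m + 1))} {e : ℤ} (h : IsExpr w (l, e)) :
    deg m w = Multiplicative.ofAdd e := by
  rw [show w = _ from h, map_mul, deg_prod, one_mul, map_zpow, deg_tau, ← ofAdd_zsmul, smul_eq_mul,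
    mul_one]

end NeZero

/-! ### Matsumoto's theorem -/

/-- The braid relations of affine type `A_m`, that is, of `s_0, …, s_{n-1}`; for `m = 1` there is
no relation between the two generators. -/
structure BraidRel {M : Type*} [Monoid M] (t : Fin (m + 1) → M) : Prop where
  comm : ∀ ⦃a b⦄, a ≠ b → b ≠ a + 1 → a ≠ b + 1 → t a * t b = t b * t a
  braid : 2 ≤ m → ∀ a, t a * t (a + 1) * t a = t (a + 1) * t a * t (a + 1)

/-- `l` spells a reduced word of an element `w` of the subgroup generated by the simple
reflections. -/
def IsReducedWord (w : W m) (l : List (Fin (m + 1))) : Prop :=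
  w = (l.map sAff).prod ∧ l.length = length w

theorem res_natCast_add_one (a : Fin (m + 1)) : res m ((a : ℕ) + 1) = a + 1 := by
  rw [res_add_one_eq_iff, rot_add_one, res_natCast]

theorem rot_eq_iff {a b : Fin (m + 1)} : rot m a = b ↔ a = b + 1 := by
  simp [rot, sub_eq_iff_eq_add]

theorem rot_ne_add_one (hm : 2 ≤ m) (a : Fin (m + 1)) : rot m a ≠ a + 1 := by
  rw [Ne, rot_eq_iff, add_assoc, left_eq_add, Fin.ext_iff, Fin.val_add]
  simp [Nat.mod_eq_of_lt (show 1 < m + 1 by omega), Nat.mod_eq_of_lt (show 2 < m + 1 by omega)]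

section NeZero

variable [NeZero m]

theorem desc_mul_sAff_of_nonadjacent {u : W m} {a b : Fin (m + 1)} (hab : a ≠ b) (hb : b ≠ a + 1)
    (ha : a ≠ b + 1) (h : Desc u b) : Desc (u * sAff a) b := by
  have hres : res m (b - 1) = rot m b := by rw [res_sub_one, res_natCast]
  rw [Desc, map_mul, Equiv.Perm.mul_apply, Equiv.Perm.mul_apply, affinePerm_sAff_of_ne,
    affinePerm_sAff_of_ne]
  · exact h
  · rwa [hres, Ne, rot_eq_iff]
  · rw [hres]
    exact (rot m).injective.ne hab.symm
  · rw [res_natCast]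
    exact hab.symm
  · rw [res_natCast, Ne, eq_comm, rot_eq_iff]
    exact ha

omit [NeZero m] in
theorem two_le_of_desc_of_desc_add_one {u : W m} (hm : 0 < m) {c : Fin (m + 1)} (hc : Desc u c)
    (hc' : Desc u (c + 1)) : 2 ≤ m := by
  by_contra hlt
  obtain rfl : m = 1 := by omega
  have hperiod := affinePerm_add_mul u ((c : ℕ) - 1) 1
  rw [desc_iff_of_res (res_natCast_add_one c), add_sub_cancel_right] at hc'
  rw [Desc] at hc
  norm_num at hperiod
  ring_nf at *
  omega

theorem affinePerm_sAff_add_one (hm : 2 ≤ m) (c : Fin (m + 1)) :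
    affinePerm (sAff c) (c + 1) = c + 1 := by
  rw [affinePerm_sAff_of_ne] <;> rw [res_natCast_add_one]
  · exact fin_add_one_ne (NeZero.pos m) c
  · exact (rot_ne_add_one hm c).symm

theorem desc_mul_sAff_of_adjacent (hm : 2 ≤ m) {u : W m} {c : Fin (m + 1)} (hc : Desc u c)
    (hc' : Desc u (c + 1)) : Desc (u * sAff c) (c + 1) := by
  rw [desc_iff_of_res (res_natCast_add_one c), add_sub_cancel_right] at hc' ⊢
  rw [map_mul, Equiv.Perm.mul_apply, Equiv.Perm.mul_apply, affinePerm_sAff_add_one hm,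
    affinePerm_sAff_of_res (res_natCast c)]
  exact hc'.trans hc

theorem desc_mul_sAff_mul_sAff_of_adjacent (hm : 2 ≤ m) {u : W m} {c : Fin (m + 1)}
    (hc' : Desc u (c + 1)) : Desc (u * sAff c * sAff (c + 1)) c := by
  have hup : affinePerm (sAff (c + 1)) c = c + 1 := by
    simpa using affinePerm_sAff_sub_one (res_natCast_add_one c)
  have hfix : affinePerm (sAff (c + 1)) (c - 1) = c - 1 := by
    rw [affinePerm_sAff_of_ne] <;> rw [res_sub_one, res_natCast]
    · exact rot_ne_add_one hm c
    · rw [Ne, (rot m).injective.eq_iff]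
      exact (fin_add_one_ne (NeZero.pos m) c).symm
  rw [desc_iff_of_res (res_natCast_add_one c), add_sub_cancel_right] at hc'
  rw [Desc, map_mul, map_mul]
  simp only [Equiv.Perm.mul_apply]
  rwa [hup, hfix, affinePerm_sAff_add_one hm, affinePerm_sAff_sub_one (res_natCast c)]

theorem exists_isReducedWord {w : W m} (hw : deg m w = 1) : ∃ l, IsReducedWord w l := by
  obtain ⟨l, e, h, hl⟩ := exists_reduced w
  obtain rfl : e = 0 := congrArg Multiplicative.toAdd ((deg_of_isExpr h).symm.trans hw)
  exact ⟨l, by simpa [IsExpr] using h, hl⟩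

namespace IsReducedWord

variable {w : W m} {a : Fin (m + 1)} {l l' : List (Fin (m + 1))}

omit [NeZero m] in
theorem of_prod_eq (h : IsReducedWord w l) (hprod : (l'.map sAff).prod = (l.map sAff).prod)
    (hlen : l'.length = l.length) : IsReducedWord w l' :=
  ⟨h.1.trans hprod.symm, hlen.trans h.2⟩

theorem deg_eq_one (h : IsReducedWord w l) : deg m w = 1 := h.1 ▸ deg_prod l

theorem sAff_mul_eq (h : IsReducedWord w (a :: l)) : sAff a * w = (l.map sAff).prod := by
  rw [h.1, List.map_cons, List.prod_cons, sAff_mul_cancel]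

theorem desc (h : IsReducedWord w (a :: l)) : Desc w⁻¹ a := by
  rw [desc_inv_iff, h.sAff_mul_eq, ← h.2, List.length_cons]
  exact Nat.lt_succ_of_le (length_le (isExpr_prod l))

theorem tail (h : IsReducedWord w (a :: l)) : IsReducedWord (sAff a * w) l :=
  ⟨h.sAff_mul_eq, Nat.succ_injective (h.2.trans (length_sAff_mul_of_desc h.desc))⟩

theorem cons (h : IsReducedWord (sAff a * w) l) (ha : Desc w⁻¹ a) : IsReducedWord w (a :: l) :=
  ⟨by rw [List.map_cons, List.prod_cons, ← h.1, sAff_mul_cancel],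
    by rw [List.length_cons, h.2, length_sAff_mul_of_desc ha]⟩

end IsReducedWord

section BraidRel

variable {M : Type*} [Monoid M] {t : Fin (m + 1) → M} (ht : BraidRel t)
include ht

theorem exists_isReducedWord_prod_eq_of_adjacent {w : W m} (hw : deg m w = 1) {c : Fin (m + 1)}
    (hc : Desc w⁻¹ c) (hc' : Desc w⁻¹ (c + 1)) :
    ∃ l l', IsReducedWord w (c :: l) ∧ IsReducedWord w ((c + 1) :: l') ∧
      ((c :: l).map t).prod = (((c + 1) :: l').map t).prod := by
  have hm := two_le_of_desc_of_desc_add_one (NeZero.pos m) hc hc'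
  obtain ⟨y, hy⟩ := exists_isReducedWord (w := sAff c * (sAff (c + 1) * (sAff c * w)))
    (by simp [deg_sAff, hw])
  have hword : IsReducedWord w (c :: (c + 1) :: c :: y) := by
    refine ((hy.cons ?_).cons ?_).cons hc <;> simp only [mul_inv_rev, sAff_inv]
    · exact desc_mul_sAff_mul_sAff_of_adjacent hm hc'
    · exact desc_mul_sAff_of_adjacent hm hc hc'
  have hword' := hword.of_prod_eq (l' := (c + 1) :: c :: (c + 1) :: y)
    (by simp only [List.map_cons, List.prod_cons, ← mul_assoc, sAff_braid hm]) rfl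
  refine ⟨_, _, hword, hword', ?_⟩
  simp only [List.map_cons, List.prod_cons, ← mul_assoc, ht.braid hm]

theorem exists_isReducedWord_prod_eq_of_nonadjacent {w : W m} (hw : deg m w = 1)
    {a b : Fin (m + 1)} (hab : a ≠ b) (hb : b ≠ a + 1) (ha : a ≠ b + 1) (hda : Desc w⁻¹ a)
    (hdb : Desc w⁻¹ b) :
    ∃ l l', IsReducedWord w (a :: l) ∧ IsReducedWord w (b :: l') ∧
      ((a :: l).map t).prod = ((b :: l').map t).prod := by
  obtain ⟨y, hy⟩ := exists_isReducedWord (w := sAff b * (sAff a * w)) (by simp [deg_sAff, hw])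
  have hword : IsReducedWord w (a :: b :: y) := by
    refine (hy.cons ?_).cons hda
    rw [mul_inv_rev, sAff_inv]
    exact desc_mul_sAff_of_nonadjacent hab hb ha hdb
  refine ⟨_, _, hword, hword.of_prod_eq (l' := b :: a :: y) ?_ rfl, ?_⟩ <;>
    simp only [List.map_cons, List.prod_cons, ← mul_assoc]
  · rw [sAff_comm hab hb ha]
  · rw [ht.comm hab hb ha]

theorem exists_isReducedWord_prod_eq {w : W m} (hw : deg m w = 1) {a b : Fin (m + 1)}
    (hab : a ≠ b) (hda : Desc w⁻¹ a) (hdb : Desc w⁻¹ b) :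
    ∃ l l', IsReducedWord w (a :: l) ∧ IsReducedWord w (b :: l') ∧
      ((a :: l).map t).prod = ((b :: l').map t).prod := by
  by_cases hb : b = a + 1
  · subst hb
    exact exists_isReducedWord_prod_eq_of_adjacent ht hw hda hdb
  by_cases ha : a = b + 1
  · subst ha
    obtain ⟨l, l', hl, hl', hprod⟩ := exists_isReducedWord_prod_eq_of_adjacent ht hw hdb hda
    exact ⟨l', l, hl', hl, hprod.symm⟩
  exact exists_isReducedWord_prod_eq_of_nonadjacent ht hw hab hb ha hda hdb

theorem IsReducedWord.prod_map_eq {w : W m} {l l' : List (Fin (m + 1))} (hl : IsReducedWord w l)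
    (hl' : IsReducedWord w l') : (l.map t).prod = (l'.map t).prod := by
  induction hn : l.length generalizing w l l' with
  | zero =>
    rw [List.length_eq_zero_iff.1 hn, List.length_eq_zero_iff.1 (hl'.2.trans (hl.2.symm.trans hn))]
  | succ n ih =>
    obtain ⟨a, u, rfl⟩ := List.exists_cons_of_length_eq_add_one hn
    obtain ⟨b, v, rfl⟩ := List.exists_cons_of_length_eq_add_one (hl'.2.trans (hl.2.symm.trans hn))
    have prod_eq_of_head_eq {c : Fin (m + 1)} {x y : List (Fin (m + 1))}
        (hx : IsReducedWord w (c :: x)) (hy : IsReducedWord w (c :: y)) :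
        ((c :: x).map t).prod = ((c :: y).map t).prod := by
      have hlen : x.length = n := Nat.succ_injective (hx.2.trans (hl.2.symm.trans hn))
      rw [List.map_cons, List.prod_cons, ih hx.tail hy.tail hlen, List.map_cons, List.prod_cons]
    by_cases hab : a = b
    · subst hab
      exact prod_eq_of_head_eq hl hl'
    · obtain ⟨x, y, hx, hy, hxy⟩ :=
        exists_isReducedWord_prod_eq ht hl.deg_eq_one hab hl.desc hl'.desc
      rw [prod_eq_of_head_eq hl hx, hxy, prod_eq_of_head_eq hy hl']

end BraidRel

end NeZero

/-! ### Parabolic subgroups and coset representatives -/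

theorem s_mem_parabolic {J : Finset (Fin m)} {j : Fin m} (hj : j ∈ J) : s j ∈ parabolic J :=
  Subgroup.subset_closure ⟨j, hj, rfl⟩

theorem parabolic_mono {J K : Finset (Fin m)} (h : J ⊆ K) : parabolic J ≤ parabolic K :=
  Subgroup.closure_mono (Set.image_mono h)

theorem parabolic_empty : parabolic (∅ : Finset (Fin m)) = ⊥ := by
  simp [parabolic]

theorem prod_mem_parabolic {J : Finset (Fin m)} {l : List (Fin m)} (hl : ∀ i ∈ l, i ∈ J) :
    (l.map s).prod ∈ parabolic J := by
  refine Subgroup.list_prod_mem _ fun x hx => ?_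
  obtain ⟨i, hi, rfl⟩ := List.mem_map.1 hx
  exact s_mem_parabolic (hl i hi)

theorem finite_parabolic (J : Finset (Fin m)) : (parabolic J : Set (W m)).Finite := by
  refine (Set.finite_range (SemidirectProduct.inr :
    Equiv.Perm (Fin (m + 1)) →* W m)).subset ?_
  rw [← MonoidHom.coe_range]
  refine (Subgroup.closure_le _).2 ?_
  rintro _ ⟨i, _, rfl⟩
  exact ⟨_, rfl⟩

theorem prod_map_s (l : List (Fin m)) : (l.map s).prod = ((l.map Fin.succ).map sAff).prod := by
  rw [List.map_map]; rfl

theorem length_prod_map_s_le (l : List (Fin m)) : length (l.map s).prod ≤ l.length := by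
  simpa only [← prod_map_s, List.length_map] using length_le (isExpr_prod (l.map Fin.succ))

theorem length_one : length (1 : W m) = 0 :=
  Nat.le_zero.1 (length_prod_map_s_le [])

/-- `y` has minimal length in `y W_J`. -/
def IsMin (J : Finset (Fin m)) (y : W m) : Prop := ∀ b ∈ parabolic J, length y ≤ length (y * b)

theorem exists_isMin_mul (J : Finset (Fin m)) (w : W m) :
    ∃ y, IsMin J y ∧ ∃ b ∈ parabolic J, w = y * b := by
  obtain ⟨c, hc, hmin⟩ := (finite_parabolic J).exists_minimalFor (fun b => length (w * b)) _
    ⟨1, one_mem _⟩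
  refine ⟨w * c, fun b hb => ?_, c⁻¹, inv_mem hc, by simp⟩
  rw [mul_assoc]
  exact (le_total _ _).elim id (hmin (mul_mem hc hb))

theorem mem_dcoset {K J : Finset (Fin m)} {d w : W m} :
    w ∈ dcoset K J d ↔ ∃ u ∈ parabolic K, ∃ b ∈ parabolic J, w = u * d * b :=
  DoubleCoset.mem_doubleCoset

theorem isMin_of_mem_D {K J : Finset (Fin m)} {d : W m} (hd : d ∈ D K J) : IsMin J d :=
  fun b hb => hd _ (mem_dcoset.2 ⟨1, one_mem _, b, hb, by simp⟩)

theorem mem_DIn_iff {K L : Finset (Fin m)} {a : W m} :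
    a ∈ DIn K ∅ L ↔ a ∈ parabolic K ∧ IsMin L a := by
  refine and_congr_right fun _ => ⟨isMin_of_mem_D, fun h w hw => ?_⟩
  obtain ⟨u, hu, b, hb, rfl⟩ := mem_dcoset.1 hw
  rw [parabolic_empty, Subgroup.mem_bot] at hu
  simpa [hu] using h b hb

theorem mem_interConj {K J : Finset (Fin m)} {d : W m} {i : Fin m} :
    i ∈ interConj K d J ↔ i ∈ K ∧ ∃ j ∈ J, d⁻¹ * s i * d = s j := by
  classical exact Finset.mem_filter

theorem conj_mem_parabolic {K J : Finset (Fin m)} {d c : W m}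
    (hc : c ∈ parabolic (interConj K d J)) : d⁻¹ * c * d ∈ parabolic J := by
  have hle : parabolic (interConj K d J) ≤ (parabolic J).comap (MulAut.conj d⁻¹).toMonoidHom := by
    refine (Subgroup.closure_le _).2 ?_
    rintro _ ⟨i, hi, rfl⟩
    obtain ⟨-, j, hj, hij⟩ := mem_interConj.1 (Finset.mem_coe.1 hi)
    simpa [hij] using s_mem_parabolic hj
  simpa using hle hc

theorem mem_dcoset_iff {K J : Finset (Fin m)} {d w : W m} :
    w ∈ dcoset K J d ↔ ∃ a ∈ DIn K ∅ (interConj K d J), ∃ b ∈ parabolic J, w = a * d * b := by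
  rw [mem_dcoset]
  constructor
  · rintro ⟨u, hu, b, hb, rfl⟩
    obtain ⟨a, ha, c, hc, rfl⟩ := exists_isMin_mul (interConj K d J) u
    have hcK : c ∈ parabolic K := parabolic_mono (Finset.filter_subset _ _) hc
    refine ⟨a, mem_DIn_iff.2 ⟨(Subgroup.mul_mem_cancel_right _ hcK).1 hu, ha⟩, d⁻¹ * c * d * b,
      mul_mem (conj_mem_parabolic hc) hb, by group⟩
  · rintro ⟨a, ha, b, hb, rfl⟩
    exact ⟨a, ha.1, b, hb, rfl⟩

theorem finite_DIn (K L : Finset (Fin m)) : (DIn K ∅ L).Finite :=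
  (finite_parabolic K).subset fun _ h => h.1

theorem finite_dcoset (K J : Finset (Fin m)) (d : W m) : (dcoset K J d).Finite := by
  refine (((finite_parabolic K).prod (finite_parabolic J)).image
    fun p => p.1 * d * p.2).subset fun w hw => ?_
  obtain ⟨u, hu, b, hb, rfl⟩ := mem_dcoset.1 hw
  exact ⟨(u, b), ⟨hu, hb⟩, rfl⟩

section NeZero

variable [NeZero m]

theorem exchange_finite {l : List (Fin m)} {y : W m} {a : Fin (m + 1)} (hy : ¬ Desc y a)
    (h : Desc ((l.map s).prod * y) a) :
    ∃ l' : List (Fin m), l'.Sublist l ∧ l'.length + 1 = l.length ∧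
      (l.map s).prod * (y * sAff a * y⁻¹) = (l'.map s).prod := by
  obtain ⟨_, _, _, hl, h'⟩ := exchange (prod_map_s l ▸ isExpr_prod (l.map Fin.succ)) hy h
  obtain ⟨l₁, _, rfl, rfl, hl'⟩ := List.map_eq_append_iff.1 hl
  obtain ⟨i, l₂, rfl, rfl, rfl⟩ := List.map_eq_cons_iff.1 hl'
  refine ⟨l₁ ++ l₂, by simp, by simp [add_assoc], ?_⟩
  rwa [IsExpr, zpow_zero, mul_one, ← List.map_append, ← prod_map_s] at h'

theorem exists_word_parabolic_mul_s {J : Finset (Fin m)} {l : List (Fin m)} (hl : ∀ i ∈ l, i ∈ J)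
    (hlen : l.length = length (l.map s).prod) {j : Fin m} (hj : j ∈ J) :
    ∃ l' : List (Fin m), (∀ i ∈ l', i ∈ J) ∧ (l.map s).prod * s j = (l'.map s).prod ∧
      l'.length = length ((l.map s).prod * s j) := by
  by_cases hdesc : Desc (l.map s).prod j.succ
  · obtain ⟨l', hsub, hlen', hprod⟩ := exchange_finite (not_desc_one _) (by rwa [mul_one])
    have hlength := length_mul_sAff_of_desc hdesc
    rw [sAff_succ] at hprod hlength
    exact ⟨l', fun i hi => hl i (hsub.subset hi), by simpa using hprod, by omega⟩
  · have hlength := length_mul_sAff_of_not_desc hdesc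
    rw [sAff_succ] at hlength
    refine ⟨l ++ [j], ?_, by simp, by simp [hlength, hlen]⟩
    rintro i hi
    rcases List.mem_append.1 hi with hi | hi
    · exact hl i hi
    · exact List.mem_singleton.1 hi ▸ hj

theorem exists_word_parabolic {J : Finset (Fin m)} {b : W m} (hb : b ∈ parabolic J) :
    ∃ l : List (Fin m), (∀ i ∈ l, i ∈ J) ∧ b = (l.map s).prod ∧ l.length = length b := by
  induction hb using Subgroup.closure_induction_right with
  | one => exact ⟨[], by simp, by simp, length_one.symm⟩
  | mul_right _ _ _ hy ih =>
    obtain ⟨j, hj, rfl⟩ := hy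
    obtain ⟨l, hl, rfl, hlen⟩ := ih
    exact exists_word_parabolic_mul_s hl hlen hj
  | mul_inv_cancel _ _ _ hy ih =>
    obtain ⟨j, hj, rfl⟩ := hy
    obtain ⟨l, hl, rfl, hlen⟩ := ih
    rw [inv_eq_of_mul_eq_one_right (s_mul_self j)]
    exact exists_word_parabolic_mul_s hl hlen hj

theorem eq_one_of_length_eq_zero {J : Finset (Fin m)} {b : W m} (hb : b ∈ parabolic J)
    (h : length b = 0) : b = 1 := by
  obtain ⟨l, _, rfl, hl⟩ := exists_word_parabolic hb
  rw [h, List.length_eq_zero_iff] at hl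
  simp [hl]

namespace IsMin

variable {J : Finset (Fin m)} {y : W m}

theorem not_desc (hy : IsMin J y) {j : Fin m} (hj : j ∈ J) : ¬ Desc y j.succ := by
  rw [desc_iff_length_lt]
  exact not_lt.2 (hy _ (s_mem_parabolic hj))

theorem not_desc_mul (hy : IsMin J y) {b : W m} (hb : b ∈ parabolic J) {j : Fin m} (hj : j ∈ J)
    (h : ¬ Desc b j.succ) : ¬ Desc (y * b) j.succ := by
  intro h'
  obtain ⟨l, e, hl, hlen⟩ := exists_reduced y
  obtain ⟨l₁, c, l₂, rfl, hexpr⟩ := exchange hl h h'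
  have hle := hy (b * sAff j.succ * b⁻¹) (mul_mem (mul_mem hb (s_mem_parabolic hj)) (inv_mem hb))
  have hle' := length_le hexpr
  simp only [List.length_append, List.length_cons] at hlen hle'
  omega

theorem length_mul (hy : IsMin J y) {b : W m} (hb : b ∈ parabolic J) :
    length (y * b) = length y + length b := by
  obtain ⟨l, hl, rfl, hlen⟩ := exists_word_parabolic hb
  clear hb
  induction l using List.reverseRecOn with
  | nil => simp [length_one]
  | append_singleton l j ih =>
    have hl' (i) (hi : i ∈ l) : i ∈ J := hl i (by simp [hi])
    have hj : j ∈ J := hl j (by simp)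
    simp only [List.map_append, List.map_cons, List.map_nil, List.prod_append, List.prod_cons,
      List.prod_nil, mul_one, List.length_append, List.length_cons, List.length_nil] at hlen ⊢
    have hle := length_prod_map_s_le l
    have hsucc := length_mul_sAff_le (l.map s).prod j.succ
    have hdesc : ¬ Desc (l.map s).prod j.succ := by
      rw [desc_iff_length_lt, sAff_succ]; omega
    have hmul := length_mul_sAff_of_not_desc (hy.not_desc_mul (prod_mem_parabolic hl') hj hdesc)
    rw [sAff_succ] at hsucc hmul
    rw [← mul_assoc, hmul, ih hl' (by omega)]
    omega

theorem length_mul_left (hy : IsMin J y⁻¹) {u : W m} (hu : u ∈ parabolic J) :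
    length (u * y) = length u + length y := by
  rw [← length_inv, mul_inv_rev, hy.length_mul (inv_mem hu), length_inv, length_inv, add_comm]

theorem eq_of_mul_eq {y' b b' : W m} (hy : IsMin J y) (hy' : IsMin J y') (hb : b ∈ parabolic J)
    (hb' : b' ∈ parabolic J) (h : y * b = y' * b') : y = y' ∧ b = b' := by
  have hmem := mul_mem hb (inv_mem hb')
  have hy'_eq : y' = y * (b * b'⁻¹) := by rw [← mul_assoc, h]; simp
  have hlen := hy.length_mul hmem
  have hle := hy' _ (inv_mem hmem)
  rw [hy'_eq, mul_inv_cancel_right] at hle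
  have hone := eq_one_of_length_eq_zero hmem (by omega)
  exact ⟨by rw [hy'_eq, hone, mul_one], mul_inv_eq_one.1 hone⟩

end IsMin

theorem isMin_iff {J : Finset (Fin m)} {y : W m} : IsMin J y ↔ ∀ j ∈ J, ¬ Desc y j.succ := by
  refine ⟨fun h j => h.not_desc, fun h => ?_⟩
  obtain ⟨z, hz, b, hb, rfl⟩ := exists_isMin_mul J y
  obtain ⟨l, hl, rfl, hlen⟩ := exists_word_parabolic hb
  rcases List.eq_nil_or_concat' l with rfl | ⟨l, j, rfl⟩
  · simpa using hz
  have hl' (i) (hi : i ∈ l) : i ∈ J := hl i (by simp [hi])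
  have hcancel : z * ((l ++ [j]).map s).prod * s j = z * (l.map s).prod := by
    simp [mul_assoc, s_mul_self]
  have hle := length_prod_map_s_le l
  refine (h j (hl j (by simp)) ?_).elim
  rw [desc_iff_length_lt, hz.length_mul hb, ← hlen, sAff_succ, hcancel,
    hz.length_mul (prod_mem_parabolic hl'), List.length_append, List.length_singleton]
  omega

theorem isMin_inv_of_mem_D {K J : Finset (Fin m)} {d : W m} (hd : d ∈ D K J) :
    IsMin K d⁻¹ := fun u hu => by
  rw [length_inv, ← length_inv (d⁻¹ * u)]
  exact hd _ (mem_dcoset.2 ⟨u⁻¹, inv_mem hu, 1, one_mem _, by simp⟩)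

theorem exists_conj_eq_of_desc {K J : Finset (Fin m)} {d u : W m} (hd : d ∈ D K J)
    (hu : u ∈ parabolic K) {j : Fin m} (hj : j ∈ J) (h : Desc (u * d) j.succ) :
    ∃ i ∈ K, d⁻¹ * s i * d = s j := by
  have hdesc := (isMin_of_mem_D hd).not_desc hj
  have hmem : d * s j * d⁻¹ ∈ parabolic K := by
    obtain ⟨l, hl, rfl, -⟩ := exists_word_parabolic hu
    obtain ⟨l', hsub, -, hprod⟩ := exchange_finite hdesc h
    rw [sAff_succ] at hprod
    rw [← Subgroup.mul_mem_cancel_left _ hu, hprod]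
    exact prod_mem_parabolic fun i hi => hl i (hsub.subset hi)
  have hlen := (isMin_inv_of_mem_D hd).length_mul_left hmem
  rw [inv_mul_cancel_right, ← sAff_succ, length_mul_sAff_of_not_desc hdesc, sAff_succ] at hlen
  obtain ⟨l, hl, hprod, hlen'⟩ := exists_word_parabolic hmem
  obtain ⟨i, rfl⟩ := List.length_eq_one_iff.1 (show l.length = 1 by omega)
  refine ⟨i, hl i (by simp), ?_⟩
  rw [show s i = d * s j * d⁻¹ by simpa using hprod.symm]
  group

theorem isMin_mul {K J : Finset (Fin m)} {d a : W m} (hd : d ∈ D K J)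
    (ha : a ∈ DIn K ∅ (interConj K d J)) : IsMin J (a * d) := by
  obtain ⟨haK, hmin⟩ := mem_DIn_iff.1 ha
  refine isMin_iff.2 fun j hj h => ?_
  obtain ⟨i, hi, hij⟩ := exists_conj_eq_of_desc hd haK hj h
  have hconj : a * d * sAff j.succ = a * s i * d := by rw [sAff_succ, ← hij]; group
  have hd' := isMin_inv_of_mem_D hd
  rw [desc_iff_length_lt, hconj, hd'.length_mul_left haK,
    hd'.length_mul_left (mul_mem haK (s_mem_parabolic hi))] at h
  have hle := hmin _ (s_mem_parabolic (mem_interConj.2 ⟨hi, j, hj, hij⟩))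
  omega

end NeZero

/-! ### The Iwahori-Matsumoto relations -/

section Hecke

variable {k : Type*} [Field k]

theorem T_quad (q : k) (i : Fin m) : (T q i - algebraMap k _ q) * (T q i + 1) = 0 := by
  simpa [T] using toHecke_rel (q := q) (.quad i)

theorem T_mul_self (q : k) (i : Fin m) : T q i * T q i = (q - 1) • T q i + algebraMap k _ q := by
  rw [← sub_eq_zero, ← T_quad q i, Algebra.smul_def, map_sub, map_one]
  noncomm_ring

theorem T_mul_one_add_T (q : k) (i : Fin m) : T q i * (1 + T q i) = q • (1 + T q i) := by
  rw [← sub_eq_zero, Algebra.smul_def, ← sub_mul, add_comm, T_quad]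

theorem T_comm (q : k) {i j : Fin m} (h : (i : ℕ) + 1 < j) : T q i * T q j = T q j * T q i := by
  simpa [T] using toHecke_rel (q := q) (.comm i j (.inl h))

theorem T_braid (q : k) {i j : Fin m} (h : (j : ℕ) = i + 1) :
    T q i * T q j * T q i = T q j * T q i * T q j := by
  simpa [T] using toHecke_rel (q := q) (.braid i j h)

theorem T_mul_XH (q : k) {i : Fin m} {j : Fin (m + 1)} (h₁ : j ≠ i.castSucc) (h₂ : j ≠ i.succ) :
    T q i * (XH q j : (Hecke q m)ˣ) = (XH q j : (Hecke q m)ˣ) * T q i := by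
  simpa [T, XH] using toHecke_rel (q := q) (.T_X_comm i j h₁ h₂)

theorem T_mul_XH_mul_T (q : k) (i : Fin m) :
    T q i * (XH q i.castSucc : (Hecke q m)ˣ) * T q i =
      algebraMap k _ q * (XH q i.succ : (Hecke q m)ˣ) := by
  simpa [T, XH] using toHecke_rel (q := q) (.T_X_T i)

theorem T_mul_sub (q : k) (i : Fin m) : T q i * (T q i - (q - 1) • 1) = q • 1 := by
  rw [mul_sub, T_mul_self, mul_smul_comm, mul_one, Algebra.algebraMap_eq_smul_one,
    add_sub_cancel_left]

/-- The nonzero scalar `c`, as a unit of `ℋ`. -/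
def scalarUnit (q : k) (m : ℕ) (c : kˣ) : (Hecke q m)ˣ :=
  Units.map (algebraMap k (Hecke q m) : k →* Hecke q m) c

theorem scalarUnit_val (q : k) (m : ℕ) (c : kˣ) :
    (scalarUnit q m c : Hecke q m) = algebraMap k _ (c : k) := rfl

theorem scalarUnit_mul_comm (q : k) (m : ℕ) (c : kˣ) (u : (Hecke q m)ˣ) :
    scalarUnit q m c * u = u * scalarUnit q m c :=
  Units.ext (Algebra.commutes _ _)

section NeZeroScalar

variable (q r : k) [NeZero q] [NeZero r]

/-- `T_i` as a unit of `ℋ`. -/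
def TU (i : Fin m) : (Hecke q m)ˣ where
  val := T q i
  inv := q⁻¹ • (T q i - (q - 1) • 1)
  val_inv := by rw [mul_smul_comm, T_mul_sub, inv_smul_smul₀ (NeZero.ne q)]
  inv_val := by
    have hcomm : Commute (T q i) (T q i - (q - 1) • 1) :=
      (Commute.refl _).sub_right ((Commute.one_right _).smul_right _)
    rw [smul_mul_assoc, ← hcomm.eq, T_mul_sub, inv_smul_smul₀ (NeZero.ne q)]

theorem bernsteinRel_Hecke (m : ℕ) :
    BernsteinRel m (extendOne (TU (m := m) q)) (extendOne (XH q))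
      (scalarUnit q m (Units.mk0 q (NeZero.ne q))) where
  comm i j hij hj := by
    rw [extendOne_of_lt _ hj, extendOne_of_lt _ (show i < m by omega)]
    exact Units.ext (T_comm q hij)
  braid i hi := by
    rw [extendOne_of_lt _ hi, extendOne_of_lt _ (show i < m by omega)]
    exact Units.ext (T_braid q rfl)
  x_comm i j hi hj := by
    rw [extendOne_of_lt _ (Nat.lt_succ_of_le hi), extendOne_of_lt _ (Nat.lt_succ_of_le hj)]
    exact XH_commute q _ _
  t_x_comm i j hi hj hne hne' := by
    rw [extendOne_of_lt _ (Nat.lt_succ_of_le hj), extendOne_of_lt _ hi]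
    exact Units.ext (T_mul_XH q (by simpa [Fin.ext_iff]) (by simpa [Fin.ext_iff]))
  t_x_t i hi := by
    rw [extendOne_of_lt _ hi, extendOne_of_lt _ (show i < m + 1 by omega),
      extendOne_of_lt _ (show i + 1 < m + 1 by omega)]
    exact Units.ext (T_mul_XH_mul_T q ⟨i, hi⟩)
  central := scalarUnit_mul_comm q m _

/-- `T_{s_0}, T_{s_1}, …, T_{s_{n-1}}` as units of `ℋ`. -/
def TAffU : Fin (m + 1) → (Hecke q m)ˣ := affineGen m (extendOne (TU q)) (extendOne (XH q))

/-- `T_τ` as a unit of `ℋ`. -/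
def TtauU (m : ℕ) : (Hecke q m)ˣ :=
  scalarUnit q m (Units.mk0 r (NeZero.ne r) ^ m)⁻¹ * rotator m (extendOne (TU q)) (extendOne (XH q))

theorem TAffU_succ (i : Fin m) : TAffU q i.succ = TU q i := extendOne_val _ i

theorem ofFn_T (m : ℕ) :
    List.ofFn (T (m := m) q) = (List.ofFn (TU (m := m) q)).map (Units.coeHom _) := by
  rw [List.map_ofFn]; rfl

theorem Ttau_eq (m : ℕ) : Ttau q r m = TtauU q r m := by
  rw [Ttau, ofFn_T, ← List.map_reverse, ← map_list_prod, ← descProd_extendOne, TtauU, rotator,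
    extendOne_of_lt (XH q) m.succ_pos, Units.val_mul, Units.val_mul, scalarUnit_val,
    ← Algebra.smul_def]
  simp

theorem TtauPow_eq (m : ℕ) (e : ℤ) : TtauPow q r m e = (TtauU q r m ^ e : (Hecke q m)ˣ) := by
  cases e with
  | ofNat a => simp [TtauPow, Ttau_eq]
  | negSucc a => simp [TtauPow, Ttau_eq, zpow_negSucc, ← inv_pow]

section NeZero

variable [NeZero m]

theorem T0_eq : T0 q m = TAffU (m := m) q 0 := by
  have hm := NeZero.pos m
  rw [TAffU, (bernsteinRel_Hecke q m).affineGen_zero hm, T0, ofFn_T, ← List.map_reverse,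
    ← List.map_tail, ← map_list_prod, ← map_list_prod, ← map_mul, Units.coeHom_apply,
    Ring.inverse_unit, prod_tail_ofFn hm, ← descProd_extendOne,
    extendOne_of_lt (XH q) m.succ_pos, extendOne_of_lt (XH q) m.lt_succ_self, Units.val_mul,
    Units.val_mul, Units.val_mul, Units.val_mul, Units.val_pow_eq_pow_val, scalarUnit_val,
    Algebra.smul_def, map_pow]
  exact (mul_assoc _ _ _).symm

theorem TAff_eq (a : Fin (m + 1)) : TAff q a = TAffU q a := by
  cases a using Fin.cases with
  | zero => exact T0_eq q
  | succ i => rw [TAffU_succ]; rfl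

theorem braidRel_TAffU : BraidRel (TAffU (m := m) q) where
  comm _ _ := (bernsteinRel_Hecke q m).affineGen_comm (NeZero.pos m)
  braid := (bernsteinRel_Hecke q m).affineGen_braid

theorem TtauU_mul_TAffU (a : Fin (m + 1)) :
    TtauU q r m * TAffU q a = TAffU q (rot m a) * TtauU q r m := by
  rw [TtauU, mul_assoc, TAffU, (bernsteinRel_Hecke q m).rotator_mul_affineGen (NeZero.pos m),
    ← mul_assoc, scalarUnit_mul_comm, mul_assoc]

/-! ### The elements `T_w` -/

variable {q r}

theorem Tw_eq {w : W m} {l : List (Fin (m + 1))} {e : ℤ} (hw : IsExpr w (l, e))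
    (hl : l.length = length w) :
    Tw q r w = ((l.map (TAffU q)).prod * TtauU q r m ^ e : (Hecke q m)ˣ) := by
  obtain ⟨hred, hred_length⟩ : IsExpr w (reducedExpr w) ∧ (reducedExpr w).1.length = length w :=
    Classical.epsilon_spec
      (p := fun e : List (Fin (m + 1)) × ℤ => IsExpr w e ∧ e.1.length = length w) ⟨(l, e), hw, hl⟩
  rw [Tw, TtauPow_eq, show TAff q = Units.coeHom _ ∘ TAffU q from funext (TAff_eq q),
    ← List.map_map, ← map_list_prod, Units.coeHom_apply, ← Units.val_mul]
  generalize reducedExpr w = expr at hred hred_length ⊢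
  obtain ⟨l', e'⟩ := expr
  obtain rfl : e = e' :=
    Multiplicative.ofAdd.injective ((deg_of_isExpr hw).symm.trans (deg_of_isExpr hred))
  have hprod : (l.map sAff).prod = (l'.map sAff).prod := mul_right_cancel (hw.symm.trans hred)
  obtain ⟨l'', hl''⟩ := exists_isReducedWord (deg_prod l)
  have hle : length w ≤ l''.length := length_le (e := e) (by rw [IsExpr, ← hl''.1, hw])
  have hle' := length_le (isExpr_prod l)
  have hlen : l.length = length (l.map sAff).prod := by have := hl''.2; omega
  rw [IsReducedWord.prod_map_eq (braidRel_TAffU q) ⟨rfl, hlen⟩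
    ⟨hprod, hred_length.trans (hl.symm.trans hlen)⟩]

theorem Tw_mul {x y : W m} (h : length (x * y) = length x + length y) :
    Tw q r (x * y) = Tw q r x * Tw q r y := by
  obtain ⟨l, e, hx, hl⟩ := exists_reduced x
  obtain ⟨l', e', hy, hl'⟩ := exists_reduced y
  rw [Tw_eq hx hl, Tw_eq hy hl', Tw_eq (hx.mul hy) (by simp [hl, hl', h]), ← Units.val_mul,
    List.map_append, List.prod_append, zpow_add]
  simp only [mul_assoc]
  rw [← mul_assoc (TtauU q r m ^ e) (l'.map (TAffU q)).prod,
    zpow_mul_prod_map_of_mul_eq (TtauU_mul_TAffU q r), mul_assoc]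

theorem Tw_one : Tw q r (1 : W m) = 1 := by
  rw [Tw_eq (l := []) (e := 0) (by simp [IsExpr]) length_one.symm]
  simp

theorem length_s (i : Fin m) : length (s i) = 1 := by
  have h := length_mul_sAff_of_not_desc (not_desc_one i.succ)
  rwa [one_mul, sAff_succ, length_one] at h

theorem Tw_s (i : Fin m) : Tw q r (s i) = T q i := by
  rw [← sAff_succ, Tw_eq (isExpr_sAff i.succ) (by simp [sAff_succ, length_s])]
  simp [TAffU_succ, TU]

end NeZero

end NeZeroScalar

end Hecke

/-! ### Sums of the `T_w` over cosets -/

theorem finsum_mem_mul_finsum_mem {α β γ R : Type*} [Semiring R] {A : Set α} {B : Set β}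
    {C : Set γ} {f : α → R} {g : β → R} {h : γ → R} (e : α → β → γ) (hA : A.Finite)
    (hB : B.Finite) (he : Set.BijOn (fun p : α × β => e p.1 p.2) (A ×ˢ B) C)
    (heq : ∀ a ∈ A, ∀ b ∈ B, h (e a b) = f a * g b) :
    ∑ᶠ c ∈ C, h c = (∑ᶠ a ∈ A, f a) * ∑ᶠ b ∈ B, g b := by
  rw [← finsum_mem_eq_of_bijOn (f := fun p : α × β => f p.1 * g p.2) _ he
    fun p hp => (heq _ hp.1 _ hp.2).symm]
  rw [← hA.coe_toFinset, ← hB.coe_toFinset, ← Finset.coe_product, finsum_mem_coe_finset,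
    finsum_mem_coe_finset, finsum_mem_coe_finset, Finset.sum_mul_sum, Finset.sum_product]

theorem coe_parabolic_singleton (i : Fin m) : (parabolic {i} : Set (W m)) = {1, s i} := by
  have hsq : s i ^ 2 = 1 := by rw [sq, s_mul_self]
  rw [parabolic, Finset.coe_singleton, Set.image_singleton, ← Subgroup.zpowers_eq_closure]
  ext w
  refine ⟨?_, ?_⟩
  · rintro ⟨e, rfl⟩
    rcases Int.even_or_odd' e with ⟨c, rfl | rfl⟩
    · exact .inl (by simp [zpow_mul, hsq])
    · exact .inr (by simp [zpow_add, zpow_mul, hsq])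
  · rintro (rfl | rfl)
    exacts [one_mem _, Subgroup.mem_zpowers _]

section Hecke

variable {k : Type*} [Field k] {q r : k}

theorem mem_vIdeal {J : Finset (Fin m)} {x : Hecke q m} :
    x ∈ vIdeal q r J ↔ ∃ h, x = v q r J * h := by
  rw [vIdeal, Submodule.mem_span_singleton]
  exact ⟨fun ⟨h, hh⟩ => ⟨h.unop, hh.symm⟩, fun ⟨h, hh⟩ => ⟨MulOpposite.op h, hh.symm⟩⟩

theorem coe_map_v_mul {J K : Finset (Fin m)}
    (φ : vIdeal q r J →ₗ[(Hecke q m)ᵐᵒᵖ] vIdeal q r K) (h : Hecke q m)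
    (hmem : v q r J * h ∈ vIdeal q r J) :
    (φ ⟨v q r J * h, hmem⟩ : Hecke q m) = φ (vGen q r J) * h := by
  rw [show (⟨v q r J * h, hmem⟩ : vIdeal q r J) = MulOpposite.op h • vGen q r J from rfl, map_smul]
  rfl

/-- Left multiplication by `h`, as a homomorphism `v_J ℋ → v_K ℋ`. -/
def mulLeftHom {J K : Finset (Fin m)} (h : Hecke q m) (hJK : h * v q r J ∈ vIdeal q r K) :
    vIdeal q r J →ₗ[(Hecke q m)ᵐᵒᵖ] vIdeal q r K where
  toFun x := ⟨h * x, by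
    obtain ⟨y, hy⟩ := mem_vIdeal.1 x.2
    obtain ⟨z, hz⟩ := mem_vIdeal.1 hJK
    exact mem_vIdeal.2 ⟨z * y, by rw [hy, ← mul_assoc, hz, mul_assoc]⟩⟩
  map_add' x y := Subtype.ext (mul_add h (x : Hecke q m) y)
  map_smul' c x := Subtype.ext (mul_assoc h (x : Hecke q m) c.unop).symm

variable [NeZero q] [NeZero r] [NeZero m]

theorem finsum_Tw_eq_mul_v {A : Set (W m)} (hA : A.Finite) {J : Finset (Fin m)}
    (hJ : ∀ w ∈ A, ∀ b ∈ parabolic J, w * b ∈ A) :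
    ∑ᶠ w ∈ A, Tw q r w = (∑ᶠ y ∈ {y | y ∈ A ∧ IsMin J y}, Tw q r y) * v q r J := by
  refine finsum_mem_mul_finsum_mem (fun y b => y * b) (hA.subset fun _ h => h.1)
    (finite_parabolic J) ⟨?_, ?_, ?_⟩ fun y hy b hb => Tw_mul (hy.2.length_mul hb)
  · rintro ⟨y, b⟩ ⟨hy, hb⟩
    exact hJ y hy.1 b hb
  · rintro ⟨y, b⟩ ⟨hy, hb⟩ ⟨y', b'⟩ ⟨hy', hb'⟩ h
    exact Prod.ext_iff.2 (hy.2.eq_of_mul_eq hy'.2 hb hb' h)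
  · intro w hw
    obtain ⟨y, hy, b, hb, rfl⟩ := exists_isMin_mul J w
    refine ⟨(y, b), ⟨⟨?_, hy⟩, hb⟩, rfl⟩
    simpa using hJ _ hw _ (inv_mem hb)

theorem finsum_Tw_eq_v_mul {A : Set (W m)} (hA : A.Finite) {K : Finset (Fin m)}
    (hK : ∀ w ∈ A, ∀ u ∈ parabolic K, u * w ∈ A) :
    ∑ᶠ w ∈ A, Tw q r w = v q r K * ∑ᶠ y ∈ {y | y ∈ A ∧ IsMin K y⁻¹}, Tw q r y := by
  refine finsum_mem_mul_finsum_mem (fun u y => u * y) (finite_parabolic K)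
    (hA.subset fun _ h => h.1) ⟨?_, ?_, ?_⟩ fun u hu y hy => Tw_mul (hy.2.length_mul_left hu)
  · rintro ⟨u, y⟩ ⟨hu, hy⟩
    exact hK y hy.1 u hu
  · rintro ⟨u, y⟩ ⟨hu, hy⟩ ⟨u', y'⟩ ⟨hu', hy'⟩ h
    have hinv : y⁻¹ * u⁻¹ = y'⁻¹ * u'⁻¹ := by
      rw [← mul_inv_rev, ← mul_inv_rev]
      exact congrArg _ h
    obtain ⟨hy_eq, hu_eq⟩ := hy.2.eq_of_mul_eq hy'.2 (inv_mem hu) (inv_mem hu') hinv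
    exact Prod.ext_iff.2 ⟨inv_injective hu_eq, inv_injective hy_eq⟩
  · intro w hw
    obtain ⟨y, hy, b, hb, h⟩ := exists_isMin_mul K w⁻¹
    obtain rfl : w = b⁻¹ * y⁻¹ := by rw [← mul_inv_rev, ← h, inv_inv]
    refine ⟨(b⁻¹, y⁻¹), ⟨inv_mem hb, ?_, by rwa [inv_inv]⟩, rfl⟩
    simpa using hK _ hw _ hb

theorem finsum_Tw_dcoset {K J : Finset (Fin m)} {d : W m} (hd : d ∈ D K J) :
    ∑ᶠ w ∈ dcoset K J d, Tw q r w =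
      (∑ᶠ a ∈ DIn K ∅ (interConj K d J), Tw q r a * Tw q r d) * v q r J := by
  refine finsum_mem_mul_finsum_mem (fun a b => a * d * b) (finite_DIn _ _) (finite_parabolic J)
    ⟨?_, ?_, ?_⟩ fun a ha b hb => ?_
  · rintro ⟨a, b⟩ ⟨ha, hb⟩
    exact mem_dcoset_iff.2 ⟨a, ha, b, hb, rfl⟩
  · rintro ⟨a, b⟩ ⟨ha, hb⟩ ⟨a', b'⟩ ⟨ha', hb'⟩ h
    obtain ⟨had, hb⟩ := (isMin_mul hd ha).eq_of_mul_eq (isMin_mul hd ha') hb hb' h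
    exact Prod.ext_iff.2 ⟨mul_right_cancel had, hb⟩
  · intro w hw
    obtain ⟨a, ha, b, hb, rfl⟩ := mem_dcoset_iff.1 hw
    exact ⟨(a, b), ⟨ha, hb⟩, rfl⟩
  · rw [Tw_mul ((isMin_mul hd ha).length_mul hb),
      Tw_mul ((isMin_inv_of_mem_D hd).length_mul_left ha.1)]

theorem finsum_Tw_dcoset_mem (K J : Finset (Fin m)) (d : W m) :
    ∑ᶠ w ∈ dcoset K J d, Tw q r w ∈ vIdeal q r K := by
  refine mem_vIdeal.2 ⟨_, finsum_Tw_eq_v_mul (finite_dcoset K J d) fun w hw u hu => ?_⟩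
  obtain ⟨u', hu', b, hb, rfl⟩ := mem_dcoset.1 hw
  exact mem_dcoset.2 ⟨u * u', mul_mem hu hu', b, hb, by simp only [mul_assoc]⟩

theorem v_singleton (i : Fin m) : v q r {i} = 1 + T q i := by
  have hne : (1 : W m) ≠ s i := fun h => by simpa [length_one, length_s] using congrArg length h
  rw [v, coe_parabolic_singleton, finsum_mem_pair hne, Tw_one, Tw_s]

theorem T_mul_v {K : Finset (Fin m)} {i : Fin m} (hi : i ∈ K) : T q i * v q r K = q • v q r K := by
  rw [v, finsum_Tw_eq_v_mul (finite_parabolic K) fun w hw u hu =>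
    mul_mem (parabolic_mono (Finset.singleton_subset_iff.2 hi) hu) hw, v_singleton, ← mul_assoc,
    T_mul_one_add_T, smul_mul_assoc]

theorem v_mul_T {K : Finset (Fin m)} {i : Fin m} (hi : i ∈ K) : v q r K * T q i = q • v q r K := by
  have hcomm : (1 + T q i) * T q i = T q i * (1 + T q i) := by rw [one_add_mul, mul_one_add]
  rw [v, finsum_Tw_eq_mul_v (finite_parabolic K) fun w hw u hu =>
    mul_mem hw (parabolic_mono (Finset.singleton_subset_iff.2 hi) hu), v_singleton, mul_assoc,
    hcomm, T_mul_one_add_T, mul_smul_comm]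

theorem exists_v_univ_eq (J : Finset (Fin m)) : ∃ h, v q r Finset.univ = v q r J * h :=
  ⟨_, finsum_Tw_eq_v_mul (finite_parabolic Finset.univ) fun _ hw _ hu =>
    mul_mem (parabolic_mono (Finset.subset_univ J) hu) hw⟩

theorem existsUnique_isB {J K : Finset (Fin m)} {d : W m} (hd : d ∈ D K J) :
    ∃! φ : vIdeal q r J →ₗ[(Hecke q m)ᵐᵒᵖ] vIdeal q r K, IsB d φ := by
  have hsum := finsum_Tw_dcoset (q := q) (r := r) hd
  refine ⟨mulLeftHom _ (hsum ▸ finsum_Tw_dcoset_mem K J d), hsum.symm,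
    fun φ hφ => LinearMap.ext fun ⟨x, hx⟩ => Subtype.ext ?_⟩
  obtain ⟨y, rfl⟩ := mem_vIdeal.1 hx
  rw [coe_map_v_mul, coe_map_v_mul, hφ.trans hsum]
  rfl

end Hecke

/-! ### The polynomial representation of the Hecke algebra -/

section Hecke

variable {k : Type*} [Field k]

/-- The variable `X_j` of the Laurent polynomial ring. -/
def xL (k : Type*) [Field k] (j : Fin (m + 1)) : Laurent k m :=
  MonoidAlgebra.single (Pi.mulSingle j (Multiplicative.ofAdd 1)) 1

theorem permAct_xL (σ : Equiv.Perm (Fin (m + 1))) (j : Fin (m + 1)) :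
    permAct k σ (xL k j) = xL k (σ j) := by
  rw [xL, permAct, MonoidAlgebra.domCongr_single, mulAutArrow_mulSingle]; rfl

theorem permAct_mul (σ τ : Equiv.Perm (Fin (m + 1))) (f : Laurent k m) :
    permAct k (σ * τ) f = permAct k σ (permAct k τ f) := by
  induction f using MonoidAlgebra.induction_linear with
  | zero => simp
  | add f g hf hg => simp only [map_add, hf, hg]
  | single a c => simp only [permAct, MonoidAlgebra.domCongr_single, map_mul]; rfl

theorem permAct_one (f : Laurent k m) : permAct k 1 f = f := by
  have hmul := permAct_mul 1 1 f
  rw [mul_one] at hmul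
  exact ((permAct k 1).injective hmul).symm

theorem xL_injective : Function.Injective (xL k : Fin (m + 1) → Laurent k m) := by
  intro i j h
  by_contra hij
  have hsingle := congrFun (MonoidAlgebra.single_left_injective one_ne_zero h) i
  rw [Pi.mulSingle_eq_same, Pi.mulSingle_eq_of_ne hij] at hsingle
  simp at hsingle

theorem xL_sub_smul_ne_zero {i j : Fin (m + 1)} (hij : i ≠ j) (c : k) :
    xL k i - c • xL k j ≠ 0 := by
  intro h
  have hne : (Pi.mulSingle i (Multiplicative.ofAdd 1) : Lattice m) ≠
      Pi.mulSingle j (Multiplicative.ofAdd 1) := fun heq => hij <| by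
    apply xL_injective (k := k); rw [xL, heq, xL]
  have hcoeff := congrArg
    (fun f : Laurent k m => f.coeff (Pi.mulSingle i (Multiplicative.ofAdd 1))) h
  simp [xL, MonoidAlgebra.coeff_sub, hne.symm] at hcoeff

/-- The field of fractions of the Laurent polynomial ring. -/
abbrev Frac (k : Type*) [Field k] (m : ℕ) : Type _ := FractionRing (Laurent k m)

/-- The permutation action on rational functions. -/
def permF (k : Type*) [Field k] (σ : Equiv.Perm (Fin (m + 1))) : Frac k m ≃ₐ[k] Frac k m :=
  IsFractionRing.fieldEquivOfAlgEquiv k _ _ (permAct k σ)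

theorem permF_algebraMap (σ : Equiv.Perm (Fin (m + 1))) (f : Laurent k m) :
    permF k σ (algebraMap _ (Frac k m) f) = algebraMap _ _ (permAct k σ f) :=
  IsFractionRing.fieldEquivOfAlgEquiv_algebraMap _ _ _ _ _

theorem permF_mul (σ τ : Equiv.Perm (Fin (m + 1))) (f : Frac k m) :
    permF k (σ * τ) f = permF k σ (permF k τ f) := by
  obtain ⟨a, b, -, rfl⟩ := IsFractionRing.div_surjective (A := Laurent k m) f
  simp only [map_div₀, permF_algebraMap, permAct_mul]

theorem permF_one (f : Frac k m) : permF k 1 f = f := by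
  have hmul := permF_mul 1 1 f
  rw [mul_one] at hmul
  exact ((permF k 1).injective hmul).symm

/-- The variable `X_j` as a rational function. -/
def xF (k : Type*) [Field k] (j : Fin (m + 1)) : Frac k m := algebraMap _ _ (xL k j)

theorem permF_xF (σ : Equiv.Perm (Fin (m + 1))) (j : Fin (m + 1)) :
    permF k σ (xF k j) = xF k (σ j) := by
  rw [xF, permF_algebraMap, permAct_xL, xF]

theorem xF_injective : Function.Injective (xF k : Fin (m + 1) → Frac k m) :=
  (IsFractionRing.injective (Laurent k m) (Frac k m)).comp xL_injective

theorem xF_ne_zero (j : Fin (m + 1)) : (xF k j : Frac k m) ≠ 0 := by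
  rw [xF, Ne, FaithfulSMul.algebraMap_eq_zero_iff, xL, MonoidAlgebra.single_eq_zero]
  exact one_ne_zero

/-- The transposition of neighbours underlying the simple reflection `s i`. -/
abbrev adjSwap (i : Fin m) : Equiv.Perm (Fin (m + 1)) := Equiv.swap i.castSucc i.succ

/-- The coefficient `(X_{i+1} - q X_i) / (X_{i+1} - X_i)` of `s_i` in the Demazure-Lusztig
operator. -/
def swapCoeff (q : k) (i : Fin m) : Frac k m :=
  (xF k i.succ - algebraMap k _ q * xF k i.castSucc) / (xF k i.succ - xF k i.castSucc)

/-- The coefficient `(q - 1) X_{i+1} / (X_{i+1} - X_i)` of `1` in the Demazure-Lusztig operator. -/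
def idCoeff (q : k) (i : Fin m) : Frac k m :=
  (algebraMap k _ q - 1) * xF k i.succ / (xF k i.succ - xF k i.castSucc)

/-- The Demazure-Lusztig operator on rational functions, by which `T_i` acts. -/
def demazureLusztig (q : k) (i : Fin m) : Module.End k (Frac k m) :=
  Algebra.lmul k _ (swapCoeff q i) * (permF k (adjSwap i)).toLinearMap +
    Algebra.lmul k _ (idCoeff q i)

theorem demazureLusztig_apply (q : k) (i : Fin m) (f : Frac k m) :
    demazureLusztig q i f = swapCoeff q i * permF k (adjSwap i) f + idCoeff q i * f := rfl

theorem xF_sub_ne_zero {i j : Fin (m + 1)} (h : i ≠ j) : (xF k i - xF k j : Frac k m) ≠ 0 :=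
  sub_ne_zero.2 fun h' => h (xF_injective h')

theorem permF_adjSwap_adjSwap (i : Fin m) (f : Frac k m) :
    permF k (adjSwap i) (permF k (adjSwap i) f) = f := by
  rw [← permF_mul, Equiv.swap_mul_self, permF_one]

theorem demazureLusztig_quad (q : k) (i : Fin m) :
    (demazureLusztig q i - algebraMap k _ q) * (demazureLusztig q i + 1) = 0 := by
  ext1 f
  have hne := xF_sub_ne_zero (k := k) i.castSucc_lt_succ.ne
  have hne' := xF_sub_ne_zero (k := k) i.castSucc_lt_succ.ne'
  simp only [Module.End.mul_apply, LinearMap.sub_apply, LinearMap.add_apply, Module.End.one_apply,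
    demazureLusztig_apply, map_add, map_mul, permF_adjSwap_adjSwap, swapCoeff, idCoeff,
    map_div₀, map_sub, permF_xF, Equiv.swap_apply_left, Equiv.swap_apply_right, AlgEquiv.commutes,
    map_one, Module.algebraMap_end_apply, Algebra.smul_def, LinearMap.zero_apply]
  field_simp
  ring

theorem demazureLusztig_mul_X_mul_self (q : k) (i : Fin m) :
    demazureLusztig q i * Algebra.lmul k _ (xF k i.castSucc) * demazureLusztig q i =
      algebraMap k _ q * Algebra.lmul k _ (xF k i.succ) := by
  ext1 f
  have hne := xF_sub_ne_zero (k := k) i.castSucc_lt_succ.ne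
  have hne' := xF_sub_ne_zero (k := k) i.castSucc_lt_succ.ne'
  simp only [Module.End.mul_apply, Algebra.coe_lmul_eq_mul, LinearMap.mul_apply',
    demazureLusztig_apply, map_add, map_mul, permF_adjSwap_adjSwap, swapCoeff, idCoeff,
    map_div₀, map_sub, permF_xF, Equiv.swap_apply_left, Equiv.swap_apply_right, AlgEquiv.commutes,
    map_one, Module.algebraMap_end_apply, Algebra.smul_def]
  field_simp
  ring

theorem demazureLusztig_mul_X (q : k) {i : Fin m} {j : Fin (m + 1)} (h₁ : j ≠ i.castSucc)
    (h₂ : j ≠ i.succ) :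
    demazureLusztig q i * Algebra.lmul k _ (xF k j) =
      Algebra.lmul k _ (xF k j) * demazureLusztig q i := by
  ext1 f
  simp only [Module.End.mul_apply, Algebra.coe_lmul_eq_mul, LinearMap.mul_apply',
    demazureLusztig_apply, map_mul, permF_xF, Equiv.swap_apply_of_ne_of_ne h₁ h₂]
  ring

theorem adjSwap_comm {i j : Fin m} (h : (i : ℕ) + 1 < j) :
    adjSwap i * adjSwap j = adjSwap j * adjSwap i :=
  congrArg SemidirectProduct.right (s_comm h)

theorem adjSwap_braid {i j : Fin m} (h : (j : ℕ) = i + 1) :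
    adjSwap i * adjSwap j * adjSwap i = adjSwap j * adjSwap i * adjSwap j :=
  congrArg SemidirectProduct.right (s_braid h)

theorem demazureLusztig_comm (q : k) {i j : Fin m} (h : (i : ℕ) + 1 < j) :
    demazureLusztig q i * demazureLusztig q j = demazureLusztig q j * demazureLusztig q i := by
  ext1 f
  have hi_castSucc : adjSwap i j.castSucc = j.castSucc :=
    Equiv.swap_apply_of_ne_of_ne (by grind [Fin.castSucc_inj]) (by grind [Fin.castSucc_inj])
  have hi_succ : adjSwap i j.succ = j.succ :=
    Equiv.swap_apply_of_ne_of_ne (by grind [Fin.castSucc_inj]) (by grind [Fin.castSucc_inj])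
  have hj_castSucc : adjSwap j i.castSucc = i.castSucc :=
    Equiv.swap_apply_of_ne_of_ne (by grind [Fin.castSucc_inj]) (by grind [Fin.castSucc_inj])
  have hj_succ : adjSwap j i.succ = i.succ :=
    Equiv.swap_apply_of_ne_of_ne (by grind [Fin.castSucc_inj]) (by grind [Fin.castSucc_inj])
  simp only [Module.End.mul_apply, demazureLusztig_apply, map_add, map_mul, ← permF_mul,
    adjSwap_comm h, swapCoeff, idCoeff, map_div₀, map_sub, permF_xF, hi_castSucc, hi_succ,
    hj_castSucc, hj_succ, AlgEquiv.commutes, map_one]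
  ring

theorem demazureLusztig_braid (q : k) {i j : Fin m} (h : (j : ℕ) = i + 1) :
    demazureLusztig q i * demazureLusztig q j * demazureLusztig q i =
      demazureLusztig q j * demazureLusztig q i * demazureLusztig q j := by
  ext1 f
  have hj : j.castSucc = i.succ := by grind
  have hi_succ : adjSwap i j.succ = j.succ := Equiv.swap_apply_of_ne_of_ne (by grind) (by grind)
  have hj_castSucc : adjSwap j i.castSucc = i.castSucc :=
    Equiv.swap_apply_of_ne_of_ne (by grind) (by grind)
  have hj_left : adjSwap j i.succ = j.succ := by rw [← hj]; exact Equiv.swap_apply_left _ _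
  have hj_right : adjSwap j j.succ = i.succ := by rw [← hj]; exact Equiv.swap_apply_right _ _
  have hne {a b : Fin (m + 1)} (hab : a < b) : xF k a - xF k b ≠ 0 ∧ xF k b - xF k a ≠ 0 :=
    ⟨xF_sub_ne_zero hab.ne, xF_sub_ne_zero hab.ne'⟩
  obtain ⟨h₁₂, h₂₁⟩ := hne i.castSucc_lt_succ
  obtain ⟨h₂₃, h₃₂⟩ := hne (show i.succ < j.succ by grind)
  have h₃₁ := (hne (show i.castSucc < j.succ by grind)).2
  have hbraid := congrArg (fun σ => permF k σ f) (adjSwap_braid h)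
  simp only [permF_mul] at hbraid
  simp only [Module.End.mul_apply, demazureLusztig_apply, map_add, map_mul,
    permF_adjSwap_adjSwap, hbraid, swapCoeff, idCoeff, map_div₀, map_sub, permF_xF, hj, hi_succ,
    hj_castSucc, hj_left, hj_right, AlgEquiv.commutes, map_one, Equiv.swap_apply_left,
    Equiv.swap_apply_right]
  generalize permF k (adjSwap i) (permF k (adjSwap j) f) = f₁₂
  generalize permF k (adjSwap j) (permF k (adjSwap i) f) = f₂₁
  generalize permF k (adjSwap i) f = f₁
  generalize permF k (adjSwap j) f = f₂
  field_simp
  ring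

/-- The operators by which the generators of `ℋ` act on rational functions. -/
def genOp (q : k) : Gen m → Module.End k (Frac k m)
  | .T i => demazureLusztig q i
  | .X j => Algebra.lmul k _ (xF k j)
  | .Xinv j => Algebra.lmul k _ (xF k j)⁻¹

theorem lift_genOp_eq_of_rel {q : k} {x y : FreeAlgebra k (Gen m)} (h : Rel q m x y) :
    FreeAlgebra.lift k (genOp q) x = FreeAlgebra.lift k (genOp q) y := by
  induction h with
  | quad i => simpa [genOp] using demazureLusztig_quad q i
  | comm i j h =>
    rcases h with h | h
    · simpa [genOp] using demazureLusztig_comm q h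
    · simpa [genOp] using (demazureLusztig_comm q h).symm
  | braid i j h => simpa [genOp] using demazureLusztig_braid q h
  | mul_inv j =>
    simp only [map_mul, FreeAlgebra.lift_ι_apply, genOp, map_one]
    rw [← map_mul, mul_inv_cancel₀ (xF_ne_zero j), map_one]
  | inv_mul j =>
    simp only [map_mul, FreeAlgebra.lift_ι_apply, genOp, map_one]
    rw [← map_mul, inv_mul_cancel₀ (xF_ne_zero j), map_one]
  | X_comm i j =>
    simp only [map_mul, FreeAlgebra.lift_ι_apply, genOp]
    rw [← map_mul, mul_comm, map_mul]
  | T_X_comm i j h₁ h₂ => simpa [genOp] using demazureLusztig_mul_X q h₁ h₂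
  | T_X_T i => simpa [genOp] using demazureLusztig_mul_X_mul_self q i

/-- The polynomial representation of `ℋ`, on rational functions, where the denominators of the
Demazure-Lusztig operators are invertible. -/
def polyRep (q : k) (m : ℕ) : Hecke q m →ₐ[k] Module.End k (Frac k m) :=
  RingQuot.liftAlgHom k ⟨FreeAlgebra.lift k (genOp q), fun _ _ => lift_genOp_eq_of_rel⟩

theorem polyRep_toHecke (q : k) (x : FreeAlgebra k (Gen m)) :
    polyRep q m (toHecke q m x) = FreeAlgebra.lift k (genOp q) x :=
  RingQuot.liftAlgHom_mkAlgHom_apply _ _ _ _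

theorem polyRep_T (q : k) (i : Fin m) : polyRep q m (T q i) = demazureLusztig q i := by
  rw [T, polyRep_toHecke, FreeAlgebra.lift_ι_apply]; rfl

theorem polyRep_X (q : k) (j : Fin (m + 1)) :
    polyRep q m (XH q j : (Hecke q m)ˣ) = Algebra.lmul k _ (xF k j) := by
  change polyRep q m (toHecke q m _) = _
  rw [polyRep_toHecke, FreeAlgebra.lift_ι_apply]; rfl

end Hecke

/-! ### Bernstein's relation and the module `ℋ / U` -/

section Hecke

variable {k : Type*} [Field k]

theorem latticeToHecke_mulSingle (q : k) (j : Fin (m + 1)) :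
    latticeToHecke q m (Pi.mulSingle j (Multiplicative.ofAdd 1)) = XH q j := by
  refine (MonoidHom.noncommPiCoprod_mulSingle _ j _).trans ?_
  simp [zpowersHom_apply]

theorem laurentToHecke_single (q : k) (a : Lattice m) (c : k) :
    laurentToHecke q m (MonoidAlgebra.single a c) = c • (latticeToHecke q m a : Hecke q m) :=
  MonoidAlgebra.lift_single _ _ _

theorem laurentToHecke_xL (q : k) (j : Fin (m + 1)) :
    laurentToHecke q m (xL k j) = (XH q j : (Hecke q m)ˣ) := by
  rw [xL, laurentToHecke_single, latticeToHecke_mulSingle, one_smul]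

theorem toHecke_surjective (q : k) (m : ℕ) : Function.Surjective (toHecke q m) :=
  RingQuot.mkAlgHom_surjective k (Rel q m)

theorem hecke_induction {q : k} {P : Hecke q m → Prop} (laurent : ∀ f, P (laurentToHecke q m f))
    (T : ∀ i, P (T q i)) (add : ∀ x y, P x → P y → P (x + y))
    (mul : ∀ x y, P x → P y → P (x * y)) (x : Hecke q m) : P x := by
  obtain ⟨x, rfl⟩ := toHecke_surjective q m x
  induction x using FreeAlgebra.induction with
  | grade0 c =>
    rw [AlgHom.commutes, ← (laurentToHecke q m).commutes]
    exact laurent _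
  | grade1 g => cases g with
    | T i => exact T i
    | X j =>
      have hX := laurent (xL k j)
      rwa [laurentToHecke_xL] at hX
    | Xinv j =>
      have hXinv := laurent (MonoidAlgebra.single (Pi.mulSingle j (Multiplicative.ofAdd 1))⁻¹ 1)
      rwa [laurentToHecke_single, map_inv, latticeToHecke_mulSingle, one_smul] at hXinv
  | mul x y hx hy => rw [map_mul]; exact mul _ _ hx hy
  | add x y hx hy => rw [map_add]; exact add _ _ hx hy

theorem smul_mem_of_stable {q : k} {M : Type*} [AddCommGroup M] [Module k M]
    [Module (Hecke q m) M] {N : Submodule k M}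
    (hT : ∀ i : Fin m, ∀ x ∈ N, T q i • x ∈ N)
    (hX : ∀ f : Laurent k m, ∀ x ∈ N, laurentToHecke q m f • x ∈ N)
    (h : Hecke q m) : ∀ x ∈ N, h • x ∈ N := by
  induction h using hecke_induction with
  | laurent f => exact hX f
  | T i => exact hT i
  | add h₁ h₂ hh₁ hh₂ =>
    intro x hx
    rw [add_smul]
    exact N.add_mem (hh₁ x hx) (hh₂ x hx)
  | mul h₁ h₂ hh₁ hh₂ =>
    intro x hx
    rw [mul_smul]
    exact hh₁ _ (hh₂ x hx)

theorem laurent_induction {P : Laurent k m → Prop} (x : ∀ j, P (xL k j))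
    (inv : ∀ f g, f * g = 1 → P f → P g) (smul : ∀ (c : k) f, P f → P (c • f))
    (add : ∀ f g, P f → P g → P (f + g)) (mul : ∀ f g, P f → P g → P (f * g))
    (f : Laurent k m) : P f := by
  have single_mul_single_inv (a : Lattice m) :
      MonoidAlgebra.single a (1 : k) * MonoidAlgebra.single a⁻¹ 1 = 1 := by
    rw [MonoidAlgebra.single_mul_single, mul_inv_cancel, one_mul]; rfl
  have one : P 1 := by
    have hmul := mul _ _ (x 0) (inv _ _ (single_mul_single_inv _) (x 0))
    rwa [xL, single_mul_single_inv] at hmul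
  have monomial (a : Lattice m) : P (MonoidAlgebra.single a 1) := by
    have ha : a ∈ Subgroup.closure
        (Set.range fun j => (Pi.mulSingle j (Multiplicative.ofAdd 1) : Lattice m)) := by
      rw [closure_mulSingle]; trivial
    induction ha using Subgroup.closure_induction with
    | mem _ h => obtain ⟨j, rfl⟩ := h; exact x j
    | one => exact one
    | mul a b _ _ ha hb =>
      have hmul := mul _ _ ha hb
      rwa [MonoidAlgebra.single_mul_single, one_mul] at hmul
    | inv a _ ha => exact inv _ _ (single_mul_single_inv a) ha
  induction f using MonoidAlgebra.induction_linear with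
  | zero => simpa using smul 0 1 one
  | add f g hf hg => exact add f g hf hg
  | single a c => simpa using smul c _ (monomial a)

/-- Bernstein's relation `T_i f = s_i(f) T_i + g`, where
`g = (q - 1) X_{i+1} (f - s_i(f)) / (X_{i+1} - X_i)` is a Laurent polynomial. -/
structure IsBernsteinPair (q : k) (i : Fin m) (f g : Laurent k m) : Prop where
  T_mul : T q i * laurentToHecke q m f =
    laurentToHecke q m (permAct k (adjSwap i) f) * T q i + laurentToHecke q m g
  sub_mul : (xL k i.succ - xL k i.castSucc) * g =
    (q - 1) • (xL k i.succ * (f - permAct k (adjSwap i) f))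

namespace IsBernsteinPair

variable {q : k} {i : Fin m} {f f₁ f₂ g g₁ g₂ : Laurent k m}

theorem smul (h : IsBernsteinPair q i f g) (c : k) : IsBernsteinPair q i (c • f) (c • g) where
  T_mul := by simp only [map_smul, mul_smul_comm, smul_mul_assoc, h.T_mul, smul_add]
  sub_mul := by
    rw [mul_smul_comm, h.sub_mul, map_smul, ← smul_sub, mul_smul_comm, smul_comm]

theorem add (h₁ : IsBernsteinPair q i f₁ g₁) (h₂ : IsBernsteinPair q i f₂ g₂) :
    IsBernsteinPair q i (f₁ + f₂) (g₁ + g₂) where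
  T_mul := by simp only [map_add, mul_add, add_mul, h₁.T_mul, h₂.T_mul]; abel
  sub_mul := by
    rw [mul_add, h₁.sub_mul, h₂.sub_mul, ← smul_add, map_add]
    congr 1
    ring

theorem mul (h₁ : IsBernsteinPair q i f₁ g₁) (h₂ : IsBernsteinPair q i f₂ g₂) :
    IsBernsteinPair q i (f₁ * f₂) (permAct k (adjSwap i) f₁ * g₂ + g₁ * f₂) where
  T_mul := by
    simp only [map_add, map_mul]
    rw [← mul_assoc, h₁.T_mul, add_mul, mul_assoc, h₂.T_mul, mul_add]
    simp only [mul_assoc, add_assoc]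
  sub_mul := by
    rw [map_mul, mul_add, mul_left_comm, h₂.sub_mul, ← mul_assoc, h₁.sub_mul, mul_smul_comm,
      smul_mul_assoc, ← smul_add]
    congr 1
    ring

theorem of_mul_eq_one (h : IsBernsteinPair q i f₁ g) (hf : f₁ * f₂ = 1) :
    IsBernsteinPair q i f₂ (-(permAct k (adjSwap i) f₂ * g * f₂)) := by
  have hperm : permAct k (adjSwap i) f₂ * permAct k (adjSwap i) f₁ = 1 := by
    rw [← map_mul, mul_comm, hf, map_one]
  constructor
  · have hθ : laurentToHecke q m f₁ * laurentToHecke q m f₂ = 1 := by rw [← map_mul, hf, map_one]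
    have hθ_perm : laurentToHecke q m (permAct k (adjSwap i) f₂) *
        laurentToHecke q m (permAct k (adjSwap i) f₁) = 1 := by rw [← map_mul, hperm, map_one]
    calc T q i * laurentToHecke q m f₂
        = laurentToHecke q m (permAct k (adjSwap i) f₂) *
            (laurentToHecke q m (permAct k (adjSwap i) f₁) * T q i) * laurentToHecke q m f₂ := by
          rw [← mul_assoc, hθ_perm, one_mul]
      _ = laurentToHecke q m (permAct k (adjSwap i) f₂) *
            (T q i * laurentToHecke q m f₁ - laurentToHecke q m g) * laurentToHecke q m f₂ := by
          rw [h.T_mul, add_sub_cancel_right]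
      _ = _ := by
          rw [mul_sub, _root_.sub_mul, mul_assoc _ (_ * _), mul_assoc (T q i), hθ, mul_one,
            ← map_mul, ← map_mul, sub_eq_add_neg, ← map_neg]
  · have hsub : (xL k i.succ - xL k i.castSucc) * -(permAct k (adjSwap i) f₂ * g * f₂) =
        -((permAct k (adjSwap i) f₂ * f₂) * ((xL k i.succ - xL k i.castSucc) * g)) := by ring
    rw [hsub, h.sub_mul, mul_smul_comm, ← smul_neg]
    congr 1
    linear_combination (-xL k i.succ * permAct k (adjSwap i) f₂) * hf +
      (xL k i.succ * f₂) * hperm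

theorem T_smul_mulV (h : IsBernsteinPair q i f g) :
    T q i • mulV q m f = mulV q m (q • permAct k (adjSwap i) f + g) := by
  have hmem : laurentToHecke q m (permAct k (adjSwap i) f) • (T q i - algebraMap k _ q) ∈ U q m :=
    Submodule.smul_mem _ _ (Submodule.subset_span ⟨i, rfl⟩)
  change Submodule.Quotient.mk (T q i * laurentToHecke q m f) = Submodule.Quotient.mk _
  rw [Submodule.Quotient.eq]
  convert hmem using 1
  rw [h.T_mul, AlgHom.coe_toLinearMap, map_add, map_smul, add_sub_add_right_eq_sub, smul_eq_mul,
    mul_sub, ← Algebra.commutes, Algebra.smul_def]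

end IsBernsteinPair

theorem polyRep_laurentToHecke (q : k) (f : Laurent k m) :
    polyRep q m (laurentToHecke q m f) = Algebra.lmul k _ (algebraMap _ (Frac k m) f) := by
  induction f using laurent_induction with
  | x j => rw [laurentToHecke_xL, polyRep_X]; rfl
  | inv f g hfg hf =>
    have hleft : polyRep q m (laurentToHecke q m g) * polyRep q m (laurentToHecke q m f) = 1 := by
      rw [← map_mul, ← map_mul, mul_comm, hfg, map_one, map_one]
    rw [hf] at hleft
    refine left_inv_eq_right_inv hleft ?_
    rw [← map_mul, ← map_mul, hfg, map_one, map_one]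
  | smul c f hf =>
    rw [map_smul, map_smul, hf, Algebra.smul_def c f, map_mul,
      ← IsScalarTower.algebraMap_apply k (Laurent k m) (Frac k m), map_mul, AlgHom.commutes,
      ← Algebra.smul_def]
  | add f g hf hg => rw [map_add, map_add, hf, hg, map_add, map_add]
  | mul f g hf hg => rw [map_mul, map_mul, hf, hg, map_mul, map_mul]

theorem mulV_apply (q : k) (f : Laurent k m) :
    mulV q m f = Submodule.Quotient.mk (laurentToHecke q m f) := rfl

theorem polyRep_apply_one_of_mem_U {q : k} {x : Hecke q m} (hx : x ∈ U q m) :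
    polyRep q m x 1 = 0 := by
  induction hx using Submodule.span_induction with
  | mem x hx =>
    obtain ⟨i, rfl⟩ := hx
    have hne := xF_sub_ne_zero (k := k) i.castSucc_lt_succ.ne'
    simp only [map_sub, polyRep_T, AlgHom.commutes, LinearMap.sub_apply, demazureLusztig_apply,
      map_one, mul_one, Module.algebraMap_end_apply, swapCoeff, idCoeff, Algebra.smul_def]
    field_simp
    ring
  | zero => rw [map_zero, LinearMap.zero_apply]
  | add x y _ _ hx hy => rw [map_add, LinearMap.add_apply, hx, hy, add_zero]
  | smul c x _ hx => rw [smul_eq_mul, map_mul, Module.End.mul_apply, hx, map_zero]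

theorem mulV_injective (q : k) (m : ℕ) : Function.Injective (mulV q m) := by
  rw [injective_iff_map_eq_zero]
  intro f hf
  rw [mulV_apply, Submodule.Quotient.mk_eq_zero] at hf
  have hzero := polyRep_apply_one_of_mem_U hf
  rw [polyRep_laurentToHecke] at hzero
  simpa using hzero

section NeZeroScalar

variable (q : k) [NeZero q]

theorem T_mul_XH_castSucc (i : Fin m) :
    T q i * (XH q i.castSucc : (Hecke q m)ˣ) =
      (XH q i.succ : (Hecke q m)ˣ) * (T q i - (q - 1) • 1) := by
  refine (TU q i).isUnit.mul_right_cancel ?_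
  have hcomm : (T q i - (q - 1) • 1) * T q i = q • 1 := by
    rw [_root_.sub_mul, T_mul_self, smul_mul_assoc, one_mul, add_sub_cancel_left,
      Algebra.algebraMap_eq_smul_one]
  change _ * T q i = _ * T q i
  rw [T_mul_XH_mul_T, mul_assoc, hcomm, mul_smul_comm, mul_one, Algebra.smul_def]

theorem T_mul_XH_succ (i : Fin m) :
    T q i * (XH q i.succ : (Hecke q m)ˣ) =
      (XH q i.castSucc : (Hecke q m)ˣ) * T q i + (q - 1) • (XH q i.succ : (Hecke q m)ˣ).val := by
  refine smul_right_injective _ (NeZero.ne q) ?_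
  calc q • (T q i * (XH q i.succ : (Hecke q m)ˣ))
      = T q i * T q i * ((XH q i.castSucc : (Hecke q m)ˣ) * T q i) := by
        rw [← mul_smul_comm, Algebra.smul_def, ← T_mul_XH_mul_T]
        simp only [mul_assoc]
    _ = q • ((XH q i.castSucc : (Hecke q m)ˣ) * T q i +
          (q - 1) • (XH q i.succ : (Hecke q m)ˣ).val) := by
        rw [T_mul_self, add_mul, smul_mul_assoc, ← mul_assoc (T q i), T_mul_XH_mul_T,
          ← Algebra.smul_def, ← Algebra.smul_def, smul_add, smul_comm q (q - 1), add_comm]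

theorem exists_isBernsteinPair_xL (i : Fin m) (j : Fin (m + 1)) :
    ∃ g, IsBernsteinPair q i (xL k j) g := by
  by_cases hcast : j = i.castSucc
  · subst hcast
    refine ⟨-((q - 1) • xL k i.succ), ?_, ?_⟩
    · rw [permAct_xL, Equiv.swap_apply_left, map_neg, map_smul, laurentToHecke_xL,
        laurentToHecke_xL, T_mul_XH_castSucc, mul_sub, mul_smul_comm, mul_one, sub_eq_add_neg]
    · rw [permAct_xL, Equiv.swap_apply_left, mul_neg, mul_smul_comm, ← smul_neg]
      congr 1
      ring
  by_cases hsucc : j = i.succ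
  · subst hsucc
    refine ⟨(q - 1) • xL k i.succ, ?_, ?_⟩
    · rw [permAct_xL, Equiv.swap_apply_right, map_smul, laurentToHecke_xL, laurentToHecke_xL,
        T_mul_XH_succ]
    · rw [permAct_xL, Equiv.swap_apply_right, mul_smul_comm, mul_comm]
  · refine ⟨0, ?_, ?_⟩
    · rw [permAct_xL, Equiv.swap_apply_of_ne_of_ne hcast hsucc, laurentToHecke_xL,
        T_mul_XH q hcast hsucc, map_zero, add_zero]
    · rw [permAct_xL, Equiv.swap_apply_of_ne_of_ne hcast hsucc, sub_self, mul_zero, mul_zero,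
        smul_zero]

theorem exists_isBernsteinPair (i : Fin m) (f : Laurent k m) : ∃ g, IsBernsteinPair q i f g := by
  induction f using laurent_induction with
  | x j => exact exists_isBernsteinPair_xL q i j
  | inv f g hfg hf =>
    obtain ⟨f', hf'⟩ := hf
    exact ⟨_, hf'.of_mul_eq_one hfg⟩
  | smul c f hf =>
    obtain ⟨f', hf'⟩ := hf
    exact ⟨_, hf'.smul c⟩
  | add f g hf hg =>
    obtain ⟨f', hf'⟩ := hf
    obtain ⟨g', hg'⟩ := hg
    exact ⟨_, hf'.add hg'⟩
  | mul f g hf hg =>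
    obtain ⟨f', hf'⟩ := hf
    obtain ⟨g', hg'⟩ := hg
    exact ⟨_, hf'.mul hg'⟩

theorem mulV_surjective (m : ℕ) : Function.Surjective (mulV q m) := by
  rw [← LinearMap.range_eq_top, eq_top_iff]
  rintro x -
  obtain ⟨x, rfl⟩ := Submodule.Quotient.mk_surjective _ x
  have hmem := smul_mem_of_stable (N := LinearMap.range (mulV q m)) ?_ ?_ x (mulV q m 1) ⟨1, rfl⟩
  · rwa [mulV_apply, map_one, ← Submodule.Quotient.mk_smul, smul_eq_mul, mul_one] at hmem
  · rintro i _ ⟨f, rfl⟩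
    obtain ⟨g, hg⟩ := exists_isBernsteinPair q i f
    exact ⟨_, hg.T_smul_mulV.symm⟩
  · rintro f _ ⟨g, rfl⟩
    exact ⟨f * g, by rw [mulV_apply, mulV_apply, map_mul]; rfl⟩

end NeZeroScalar

end Hecke

/-! ### The basis `X^λ T_w` of the Hecke algebra -/

theorem s_mul_inr (i : Fin m) (σ : Equiv.Perm (Fin (m + 1))) :
    (s i * SemidirectProduct.inr σ : W m) = SemidirectProduct.inr (adjSwap i * σ) :=
  (map_mul SemidirectProduct.inr _ _).symm

theorem inr_mul_s (σ : Equiv.Perm (Fin (m + 1))) (i : Fin m) :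
    (SemidirectProduct.inr σ * s i : W m) = SemidirectProduct.inr (σ * adjSwap i) :=
  (map_mul SemidirectProduct.inr _ _).symm

theorem inr_mem_parabolic_univ (σ : Equiv.Perm (Fin (m + 1))) :
    (SemidirectProduct.inr σ : W m) ∈ parabolic Finset.univ := by
  refine (Subgroup.closure_le (parabolic Finset.univ)).2 ?_ (inr_mem_closure σ)
  rintro _ ⟨i, rfl⟩
  exact s_mem_parabolic (Finset.mem_univ i)

theorem coe_parabolic_univ : (parabolic (Finset.univ : Finset (Fin m)) : Set (W m)) =
    Set.range (SemidirectProduct.inr : Equiv.Perm (Fin (m + 1)) →* W m) := by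
  refine Set.Subset.antisymm ?_ (Set.range_subset_iff.2 inr_mem_parabolic_univ)
  rw [← MonoidHom.coe_range]
  refine (Subgroup.closure_le _).2 ?_
  rintro _ ⟨i, _, rfl⟩
  exact ⟨_, rfl⟩

theorem v_univ {k : Type*} [Field k] (q r : k) : v q r (Finset.univ : Finset (Fin m)) =
    ∑ σ : Equiv.Perm (Fin (m + 1)), Tw q r (SemidirectProduct.inr σ) := by
  rw [v, coe_parabolic_univ, finsum_mem_range SemidirectProduct.inr_injective,
    finsum_eq_sum_of_fintype]

section Length

variable [NeZero m]

theorem length_s_mul_of_not_desc {i : Fin m} {w : W m} (h : ¬ Desc w⁻¹ i.succ) :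
    length (s i * w) = length w + 1 := by
  rw [← sAff_succ, length_sAff_mul, length_mul_sAff_of_not_desc h, length_inv]

theorem length_s_mul_le (i : Fin m) (w : W m) : length (s i * w) ≤ length w + 1 := by
  have hle := length_mul_le (s i) w
  rw [length_s] at hle
  omega

theorem perm_induction_of_not_desc {P : Equiv.Perm (Fin (m + 1)) → Prop} (one : P 1)
    (mul : ∀ (i : Fin m) (σ : Equiv.Perm (Fin (m + 1))),
      ¬ Desc (SemidirectProduct.inr σ : W m)⁻¹ i.succ → P σ → P (adjSwap i * σ))
    (σ : Equiv.Perm (Fin (m + 1))) : P σ := by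
  obtain ⟨l, -, hσ, hlen⟩ := exists_word_parabolic (inr_mem_parabolic_univ σ)
  induction l generalizing σ with
  | nil =>
    rwa [← SemidirectProduct.inr_injective (hσ.trans (map_one SemidirectProduct.inr).symm :
      (SemidirectProduct.inr σ : W m) = SemidirectProduct.inr 1)] at one
  | cons i l ih =>
    have hprod : (SemidirectProduct.inr (adjSwap i * σ) : W m) = (l.map s).prod := by
      rw [← s_mul_inr, hσ, List.map_cons, List.prod_cons, ← mul_assoc, s_mul_self, one_mul]
    have hσ' : σ = adjSwap i * (adjSwap i * σ) := by
      rw [← mul_assoc, Equiv.swap_mul_self, one_mul]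
    have hle : length (l.map s).prod ≤ l.length := by
      simpa [Function.comp_def, sAff_succ] using length_le (isExpr_prod (l.map Fin.succ))
    have hge := length_s_mul_le i (l.map s).prod
    rw [hσ, List.map_cons, List.prod_cons, List.length_cons] at hlen
    rw [hσ']
    refine mul i _ ?_ (ih _ hprod (by rw [hprod]; omega))
    rw [desc_inv_iff, sAff_succ, hprod]
    omega

end Length

section Hecke

variable {k : Type*} [Field k] {q r : k}

theorem swapCoeff_ne_zero (q : k) (i : Fin m) : swapCoeff q i ≠ 0 := by
  refine div_ne_zero ?_ (xF_sub_ne_zero i.castSucc_lt_succ.ne')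
  have hnum : xF k i.succ - algebraMap k _ q * xF k i.castSucc =
      algebraMap (Laurent k m) (Frac k m) (xL k i.succ - q • xL k i.castSucc) := by
    rw [map_sub, Algebra.smul_def, map_mul,
      ← IsScalarTower.algebraMap_apply k (Laurent k m) (Frac k m)]
    rfl
  rw [hnum, Ne, FaithfulSMul.algebraMap_eq_zero_iff]
  exact xL_sub_smul_ne_zero i.castSucc_lt_succ.ne' q

/-- The coefficients, in terms of permutations of the variables, of the composition of the
Demazure-Lusztig operator of index `i` with the operator `∑ u, c u • permF k u`. -/
def demazureLusztigMul (q : k) (i : Fin m) (c : Equiv.Perm (Fin (m + 1)) → Frac k m)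
    (u : Equiv.Perm (Fin (m + 1))) : Frac k m :=
  swapCoeff q i * permF k (adjSwap i) (c (adjSwap i * u)) + idCoeff q i * c u

theorem demazureLusztig_sum (q : k) (i : Fin m) (c : Equiv.Perm (Fin (m + 1)) → Frac k m)
    (g : Frac k m) : demazureLusztig q i (∑ u, c u * permF k u g) =
      ∑ u, demazureLusztigMul q i c u * permF k u g := by
  rw [demazureLusztig_apply, map_sum, Finset.mul_sum, Finset.mul_sum,
    ← Equiv.sum_comp (Equiv.mulLeft (adjSwap i)), ← Finset.sum_add_distrib]
  refine Finset.sum_congr rfl fun u _ => ?_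
  simp only [demazureLusztigMul, map_mul, ← permF_mul, Equiv.coe_mulLeft, ← mul_assoc,
    Equiv.swap_mul_self, one_mul]
  ring

/-- The permutation `σ` is the unique longest one in the support of `c`. -/
def HasLeadingTerm (σ : Equiv.Perm (Fin (m + 1))) (c : Equiv.Perm (Fin (m + 1)) → Frac k m) :
    Prop :=
  c σ ≠ 0 ∧ ∀ u, c u ≠ 0 → u = σ ∨
    length (SemidirectProduct.inr u : W m) < length (SemidirectProduct.inr σ : W m)

theorem HasLeadingTerm.demazureLusztigMul [NeZero m] {σ : Equiv.Perm (Fin (m + 1))}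
    {c : Equiv.Perm (Fin (m + 1)) → Frac k m} (h : HasLeadingTerm σ c) (q : k) {i : Fin m}
    (hi : ¬ Desc (SemidirectProduct.inr σ : W m)⁻¹ i.succ) :
    HasLeadingTerm (adjSwap i * σ) (demazureLusztigMul q i c) := by
  have hlen := length_s_mul_of_not_desc hi
  rw [s_mul_inr] at hlen
  have swap_swap (u : Equiv.Perm (Fin (m + 1))) : adjSwap i * (adjSwap i * u) = u := by
    rw [← mul_assoc, Equiv.swap_mul_self, one_mul]
  constructor
  · have hzero : c (adjSwap i * σ) = 0 := by
      by_contra hne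
      rcases h.2 _ hne with heq | hlt
      · rw [heq] at hlen
        omega
      · omega
    rw [AffSchur.demazureLusztigMul, swap_swap, hzero, mul_zero, add_zero]
    exact mul_ne_zero (swapCoeff_ne_zero q i) ((map_ne_zero _).2 h.1)
  · intro u hu
    by_cases hcu : c u = 0
    · have hne : c (adjSwap i * u) ≠ 0 := by
        intro hswap
        rw [AffSchur.demazureLusztigMul, hcu, hswap, map_zero, mul_zero, mul_zero, add_zero] at hu
        exact hu rfl
      rcases h.2 _ hne with heq | hlt
      · exact Or.inl (by rw [← heq, swap_swap])
      · have hle := length_s_mul_le i (SemidirectProduct.inr (adjSwap i * u))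
        rw [s_mul_inr, swap_swap] at hle
        exact Or.inr (by omega)
    · rcases h.2 _ hcu with rfl | hlt
      · exact Or.inr (by omega)
      · exact Or.inr (by omega)

theorem permAct_injective : Function.Injective (permAct (m := m) k) := fun σ τ h => by
  ext j
  have hj := DFunLike.congr_fun h (xL k j)
  rw [permAct_xL, permAct_xL] at hj
  rw [xL_injective hj]

/-- The permutation action, as a homomorphism from Laurent polynomials to rational functions. -/
def laurentHom (k : Type*) [Field k] (σ : Equiv.Perm (Fin (m + 1))) : Laurent k m →* Frac k m :=
  (algebraMap (Laurent k m) (Frac k m)).toMonoidHom.comp (permAct k σ : Laurent k m →* Laurent k m)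

theorem laurentHom_apply (σ : Equiv.Perm (Fin (m + 1))) (f : Laurent k m) :
    laurentHom k σ f = permF k σ (algebraMap _ _ f) := (permF_algebraMap σ f).symm

theorem laurentHom_injective : Function.Injective (laurentHom (m := m) k) := fun _ _ h =>
  permAct_injective <| AlgEquiv.ext fun f =>
    IsFractionRing.injective (Laurent k m) (Frac k m) (DFunLike.congr_fun h f)

theorem linearIndependent_laurentHom (k : Type*) [Field k] (m : ℕ) :
    LinearIndependent (Frac k m)
      (fun σ : Equiv.Perm (Fin (m + 1)) => (laurentHom k σ : Laurent k m → Frac k m)) :=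
  (linearIndependent_monoidHom (Laurent k m) (Frac k m)).comp _ laurentHom_injective

/-- The map `f ↦ ∑ σ, f_σ T_σ`, the sum being over the finite Weyl group: it identifies `ℋ` with
the free left module on the `T_σ` over the Laurent polynomials. -/
def pbw (q r : k) : (Equiv.Perm (Fin (m + 1)) → Laurent k m) →ₗ[k] Hecke q m :=
  ∑ σ, LinearMap.mulRight k (Tw q r (SemidirectProduct.inr σ)) ∘ₗ
    (laurentToHecke q m).toLinearMap ∘ₗ LinearMap.proj σ

theorem pbw_apply (f : Equiv.Perm (Fin (m + 1)) → Laurent k m) :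
    pbw q r f = ∑ σ, laurentToHecke q m (f σ) * Tw q r (SemidirectProduct.inr σ) := by
  rw [pbw, LinearMap.sum_apply]
  rfl

theorem pbw_single [DecidableEq (Equiv.Perm (Fin (m + 1)))] (σ : Equiv.Perm (Fin (m + 1)))
    (f : Laurent k m) :
    pbw q r (Pi.single σ f) = laurentToHecke q m f * Tw q r (SemidirectProduct.inr σ) := by
  rw [pbw_apply, Finset.sum_eq_single σ]
  · rw [Pi.single_eq_same]
  · intro τ _ hτ
    rw [Pi.single_eq_of_ne hτ, map_zero, zero_mul]
  · exact fun h => (h (Finset.mem_univ σ)).elim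

theorem laurentToHecke_mul_pbw (g : Laurent k m) (f : Equiv.Perm (Fin (m + 1)) → Laurent k m) :
    laurentToHecke q m g * pbw q r f = pbw q r (g • f) := by
  simp only [pbw_apply, Finset.mul_sum, Pi.smul_apply, smul_eq_mul, map_mul, mul_assoc]

theorem laurentToHecke_mul_v_univ (f : Laurent k m) :
    laurentToHecke q m f * v q r Finset.univ = pbw q r fun _ => f := by
  rw [v_univ, pbw_apply, Finset.mul_sum]

theorem laurentToHecke_mul_Tw_mem_range_pbw (f : Laurent k m) (σ : Equiv.Perm (Fin (m + 1))) :
    laurentToHecke q m f * Tw q r (SemidirectProduct.inr σ) ∈ LinearMap.range (pbw q r) := by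
  classical exact ⟨_, pbw_single σ f⟩

theorem polyRep_pbw {c : Equiv.Perm (Fin (m + 1)) → Equiv.Perm (Fin (m + 1)) → Frac k m}
    (hc : ∀ σ g, polyRep q m (Tw q r (SemidirectProduct.inr σ)) g = ∑ u, c σ u * permF k u g)
    (f : Equiv.Perm (Fin (m + 1)) → Laurent k m) (g : Laurent k m) :
    polyRep q m (pbw q r f) (algebraMap _ _ g) =
      ∑ u, (∑ σ, algebraMap _ (Frac k m) (f σ) * c σ u) * laurentHom k u g := by
  simp only [pbw_apply, map_sum, LinearMap.sum_apply, map_mul, polyRep_laurentToHecke,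
    Module.End.mul_apply, hc, laurentHom_apply, Algebra.coe_lmul_eq_mul, LinearMap.mul_apply',
    Finset.sum_mul, mul_assoc]
  exact Finset.sum_comm

theorem eq_zero_of_sum_mul_hasLeadingTerm_eq_zero
    {c : Equiv.Perm (Fin (m + 1)) → Equiv.Perm (Fin (m + 1)) → Frac k m}
    (hc : ∀ σ, HasLeadingTerm σ (c σ)) {f : Equiv.Perm (Fin (m + 1)) → Frac k m}
    (h : ∀ u, ∑ σ, f σ * c σ u = 0) : f = 0 := by
  by_contra hf
  obtain ⟨σ₀, hσ₀⟩ := Function.ne_iff.1 hf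
  obtain ⟨σ, hσ, hmax⟩ := Set.exists_max_image {σ | f σ ≠ 0}
    (fun σ => length (SemidirectProduct.inr σ : W m)) (Set.toFinite _) ⟨σ₀, hσ₀⟩
  refine mul_ne_zero hσ (hc σ).1 ?_
  rw [← h σ, Finset.sum_eq_single σ]
  · intro τ _ hτσ
    by_contra hne
    obtain ⟨hfτ, hcτ⟩ := mul_ne_zero_iff.1 hne
    rcases (hc τ).2 σ hcτ with heq | hlt
    · exact hτσ heq.symm
    · exact hlt.not_ge (hmax τ hfτ)
  · exact fun hσ => (hσ (Finset.mem_univ σ)).elim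

section NeZeroScalar

variable [NeZero q] [NeZero r] [NeZero m]

theorem T_mul_Tw_of_not_desc {i : Fin m} {w : W m} (h : ¬ Desc w⁻¹ i.succ) :
    T q i * Tw q r w = Tw q r (s i * w) := by
  rw [Tw_mul (by rw [length_s_mul_of_not_desc h, length_s, add_comm]), Tw_s]

theorem T_mul_Tw_of_desc {i : Fin m} {w : W m} (h : Desc w⁻¹ i.succ) :
    T q i * Tw q r w = (q - 1) • Tw q r w + q • Tw q r (s i * w) := by
  have hdesc : ¬ Desc (s i * w)⁻¹ i.succ := by
    rwa [← sAff_succ, mul_inv_rev, sAff_inv, desc_mul_sAff_iff, not_not]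
  have hw := T_mul_Tw_of_not_desc (q := q) (r := r) hdesc
  rw [← mul_assoc, s_mul_self, one_mul] at hw
  rw [← hw, ← mul_assoc, T_mul_self, add_mul, smul_mul_assoc, Algebra.smul_def q]

theorem Tw_mul_T_of_not_desc {i : Fin m} {w : W m} (h : ¬ Desc w i.succ) :
    Tw q r w * T q i = Tw q r (w * s i) := by
  rw [Tw_mul (by rw [length_s, ← sAff_succ, length_mul_sAff_of_not_desc h]), Tw_s]

theorem Tw_mul_T_of_desc {i : Fin m} {w : W m} (h : Desc w i.succ) :
    Tw q r w * T q i = (q - 1) • Tw q r w + q • Tw q r (w * s i) := by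
  have hdesc : ¬ Desc (w * s i) i.succ := by rwa [← sAff_succ, desc_mul_sAff_iff, not_not]
  have hw := Tw_mul_T_of_not_desc (q := q) (r := r) hdesc
  rw [mul_assoc, s_mul_self, mul_one] at hw
  rw [← hw, mul_assoc, T_mul_self, mul_add, mul_smul_comm, ← Algebra.commutes, Algebra.smul_def q]

theorem exists_hasLeadingTerm_polyRep_Tw (q r : k) [NeZero q] [NeZero r]
    (σ : Equiv.Perm (Fin (m + 1))) :
    ∃ c : Equiv.Perm (Fin (m + 1)) → Frac k m, HasLeadingTerm σ c ∧
      ∀ g, polyRep q m (Tw q r (SemidirectProduct.inr σ)) g = ∑ u, c u * permF k u g := by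
  classical
  induction σ using perm_induction_of_not_desc with
  | one =>
    refine ⟨Pi.single 1 1, ⟨?_, fun u hu => Or.inl ?_⟩, fun g => ?_⟩
    · rw [Pi.single_eq_same]
      exact one_ne_zero
    · by_contra hne
      exact hu (Pi.single_eq_of_ne hne _)
    · simp [Pi.single_apply, permF_one, Tw_one]
  | mul i σ hi ih =>
    obtain ⟨c, hlead, hexp⟩ := ih
    refine ⟨demazureLusztigMul q i c, hlead.demazureLusztigMul q hi, fun g => ?_⟩
    rw [← s_mul_inr, ← T_mul_Tw_of_not_desc hi, map_mul, Module.End.mul_apply, hexp, polyRep_T,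
      demazureLusztig_sum]

theorem eq_zero_of_polyRep_pbw {f : Equiv.Perm (Fin (m + 1)) → Laurent k m}
    (h : ∀ g : Laurent k m, polyRep q m (pbw q r f) (algebraMap _ _ g) = 0) : f = 0 := by
  choose c hlead hexp using exists_hasLeadingTerm_polyRep_Tw (m := m) q r
  have hsum : ∑ u, (∑ σ, algebraMap _ (Frac k m) (f σ) * c σ u) •
      (laurentHom k u : Laurent k m → Frac k m) = 0 := by
    funext g
    simp only [Finset.sum_apply, Pi.smul_apply, smul_eq_mul, ← polyRep_pbw hexp, h, Pi.zero_apply]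
  have hcoeff := Fintype.linearIndependent_iff.1 (linearIndependent_laurentHom k m) _ hsum
  have hf := eq_zero_of_sum_mul_hasLeadingTerm_eq_zero hlead hcoeff
  exact funext fun σ => FaithfulSMul.algebraMap_eq_zero_iff _ (Frac k m) |>.1 (congrFun hf σ)

theorem pbw_injective (q r : k) [NeZero q] [NeZero r] : Function.Injective (pbw (m := m) q r) := by
  rw [injective_iff_map_eq_zero]
  intro f hf
  exact eq_zero_of_polyRep_pbw (q := q) (r := r) fun g => by rw [hf, map_zero, LinearMap.zero_apply]

theorem laurentToHecke_mul_T_mul_Tw_mem_range_pbw (f : Laurent k m) (i : Fin m)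
    (σ : Equiv.Perm (Fin (m + 1))) :
    laurentToHecke q m f * (T q i * Tw q r (SemidirectProduct.inr σ)) ∈
      LinearMap.range (pbw q r) := by
  by_cases hdesc : Desc (SemidirectProduct.inr σ : W m)⁻¹ i.succ
  · rw [T_mul_Tw_of_desc hdesc, s_mul_inr, mul_add, mul_smul_comm, mul_smul_comm]
    exact add_mem (Submodule.smul_mem _ _ (laurentToHecke_mul_Tw_mem_range_pbw _ _))
      (Submodule.smul_mem _ _ (laurentToHecke_mul_Tw_mem_range_pbw _ _))
  · rw [T_mul_Tw_of_not_desc hdesc, s_mul_inr]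
    exact laurentToHecke_mul_Tw_mem_range_pbw _ _

theorem pbw_surjective (q r : k) [NeZero q] [NeZero r] :
    Function.Surjective (pbw (m := m) q r) := by
  rw [← LinearMap.range_eq_top, eq_top_iff]
  rintro x -
  have one_mem : (1 : Hecke q m) ∈ LinearMap.range (pbw q r) := by
    simpa [Tw_one] using laurentToHecke_mul_Tw_mem_range_pbw (q := q) (r := r) (1 : Laurent k m) 1
  rw [← mul_one x, ← smul_eq_mul]
  refine smul_mem_of_stable ?_ ?_ x 1 one_mem
  · rintro i _ ⟨f, rfl⟩
    rw [pbw_apply, smul_eq_mul, Finset.mul_sum]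
    refine sum_mem fun σ _ => ?_
    obtain ⟨g, hg⟩ := exists_isBernsteinPair q i (f σ)
    rw [← mul_assoc, hg.T_mul, add_mul, mul_assoc]
    exact add_mem (laurentToHecke_mul_T_mul_Tw_mem_range_pbw _ _ _)
      (laurentToHecke_mul_Tw_mem_range_pbw _ _)
  · rintro g _ ⟨f, rfl⟩
    exact ⟨_, (laurentToHecke_mul_pbw g f).symm⟩

theorem eq_zero_of_polyRep (r : k) [NeZero r] {x : Hecke q m}
    (h : ∀ g : Laurent k m, polyRep q m x (algebraMap _ _ g) = 0) : x = 0 := by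
  obtain ⟨f, rfl⟩ := pbw_surjective q r x
  rw [eq_zero_of_polyRep_pbw h, map_zero]

theorem laurentToHecke_mul_v_univ_injective (q r : k) [NeZero q] [NeZero r] :
    Function.Injective fun f : Laurent k m => laurentToHecke q m f * v q r Finset.univ := by
  intro f g h
  simp only [laurentToHecke_mul_v_univ] at h
  exact congrFun (pbw_injective q r h) 1

open Classical in
theorem Tw_mul_T (w : W m) (i : Fin m) : Tw q r w * T q i =
    (if Desc w i.succ then q - 1 else 0) • Tw q r w +
      (if Desc w i.succ then q else 1) • Tw q r (w * s i) := by
  by_cases hw : Desc w i.succ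
  · rw [Tw_mul_T_of_desc hw, if_pos hw, if_pos hw]
  · rw [Tw_mul_T_of_not_desc hw, if_neg hw, if_neg hw, zero_smul, zero_add, one_smul]

open Classical in
theorem pbw_mul_T (f : Equiv.Perm (Fin (m + 1)) → Laurent k m) (i : Fin m) :
    pbw q r f * T q i = pbw q r fun σ => if Desc (SemidirectProduct.inr σ : W m) i.succ
      then (q - 1) • f σ + f (σ * adjSwap i) else q • f (σ * adjSwap i) := by
  let a (σ : Equiv.Perm (Fin (m + 1))) : k :=
    if Desc (SemidirectProduct.inr σ : W m) i.succ then q - 1 else 0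
  let b (σ : Equiv.Perm (Fin (m + 1))) : k :=
    if Desc (SemidirectProduct.inr σ : W m) i.succ then q else 1
  have expand (σ : Equiv.Perm (Fin (m + 1))) : Tw q r (SemidirectProduct.inr σ) * T q i =
      a σ • Tw q r (SemidirectProduct.inr σ) +
        b σ • Tw q r (SemidirectProduct.inr (σ * adjSwap i)) := by
    rw [Tw_mul_T, inr_mul_s]
  have hcoeff : pbw q r f * T q i =
      pbw q r fun σ => a σ • f σ + b (σ * adjSwap i) • f (σ * adjSwap i) := by
    simp only [pbw_apply, Finset.sum_mul, mul_assoc, expand, mul_add, map_add, add_mul,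
      Finset.sum_add_distrib, map_smul, mul_smul_comm, smul_mul_assoc]
    congr 1
    rw [← Equiv.sum_comp (Equiv.mulRight (adjSwap i))]
    simp only [Equiv.coe_mulRight, mul_assoc, Equiv.swap_mul_self, mul_one]
  rw [hcoeff]
  congr 1
  funext σ
  have hdesc : Desc (SemidirectProduct.inr (σ * adjSwap i) : W m) i.succ ↔
      ¬ Desc (SemidirectProduct.inr σ : W m) i.succ := by
    rw [← inr_mul_s, ← sAff_succ, desc_mul_sAff_iff]
  by_cases hσ : Desc (SemidirectProduct.inr σ : W m) i.succ
  · simp only [a, b, hdesc, hσ, not_true_eq_false, if_true, if_false, one_smul]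
  · simp only [a, b, hdesc, hσ, not_false_eq_true, if_true, if_false, zero_smul, zero_add]

theorem apply_mul_adjSwap_of_pbw_mul_T {f : Equiv.Perm (Fin (m + 1)) → Laurent k m} {i : Fin m}
    (h : pbw q r f * T q i = q • pbw q r f) (σ : Equiv.Perm (Fin (m + 1))) :
    f (σ * adjSwap i) = f σ := by
  rw [pbw_mul_T, ← map_smul] at h
  have hf := congrFun (pbw_injective q r h)
  have of_not_desc (τ : Equiv.Perm (Fin (m + 1)))
      (hτ : ¬ Desc (SemidirectProduct.inr τ : W m) i.succ) : f (τ * adjSwap i) = f τ := by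
    have hfτ := hf τ
    rw [if_neg hτ] at hfτ
    exact smul_right_injective _ (NeZero.ne q) hfτ
  by_cases hσ : Desc (SemidirectProduct.inr σ : W m) i.succ
  · have hdesc : ¬ Desc (SemidirectProduct.inr (σ * adjSwap i) : W m) i.succ := by
      rwa [← inr_mul_s, ← sAff_succ, desc_mul_sAff_iff, not_not]
    rw [← of_not_desc _ hdesc, mul_assoc, Equiv.swap_mul_self, mul_one]
  · exact of_not_desc σ hσ

theorem exists_eq_laurentToHecke_mul_v_univ (r : k) [NeZero r] {x : Hecke q m}
    (hx : ∀ i, x * T q i = q • x) : ∃ f, x = laurentToHecke q m f * v q r Finset.univ := by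
  obtain ⟨f, rfl⟩ := pbw_surjective q r x
  have hconst (σ : Equiv.Perm (Fin (m + 1))) : f σ = f 1 := by
    have hσ : σ ∈ Submonoid.closure (Set.range fun i : Fin m => adjSwap i) := by
      rw [Equiv.Perm.mclosure_swap_castSucc_succ]
      exact Submonoid.mem_top σ
    induction hσ using Submonoid.closure_induction_right with
    | one => rfl
    | mul_right τ _ _ hi ih =>
      obtain ⟨i, rfl⟩ := hi
      rw [apply_mul_adjSwap_of_pbw_mul_T (hx i), ih]
  exact ⟨f 1, by rw [laurentToHecke_mul_v_univ, ← funext hconst]⟩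

end NeZeroScalar

end Hecke

/-! ### The representation of the affine Schur algebra -/

section EndOfStable

variable {k A V M : Type*} [Field k] [Semiring A] [Algebra k A] [AddCommGroup V] [Module k V]
  [AddCommGroup M] [Module k M] [Module A M] [IsScalarTower k A M]

/-- The endomorphism of `V` induced by an endomorphism of `M` that stabilizes the image of an
injection `V → M`. -/
def restrictAlong (e : V →ₗ[k] M) (he : Function.Injective e) (g : Module.End k M)
    (h : ∀ x, g (e x) ∈ LinearMap.range e) : Module.End k V :=
  (LinearEquiv.ofInjective e he).symm ∘ₗ (g ∘ₗ e).codRestrict (LinearMap.range e) h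

theorem apply_restrictAlong (e : V →ₗ[k] M) (he : Function.Injective e) (g : Module.End k M)
    (h : ∀ x, g (e x) ∈ LinearMap.range e) (x : V) : e (restrictAlong e he g h x) = g (e x) :=
  LinearEquiv.ofInjective_symm_apply (h := he) e _

/-- The representation of an algebra on `V` induced by an injection of `V` onto a stable subspace
of a module. -/
def endOfStable (e : V →ₗ[k] M) (he : Function.Injective e)
    (h : ∀ (a : A) x, a • e x ∈ LinearMap.range e) : A →ₐ[k] Module.End k V :=
  AlgHom.ofLinearMap
    { toFun := fun a => restrictAlong e he (Algebra.lsmul k k M a) (by simpa using h a)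
      map_add' := fun a b => LinearMap.ext fun x => he <| by
        simp [apply_restrictAlong]
      map_smul' := fun c a => LinearMap.ext fun x => he <| by
        simp [apply_restrictAlong] }
    (LinearMap.ext fun x => he <| by simp [apply_restrictAlong])
    fun a b => LinearMap.ext fun x => he <| by simp [apply_restrictAlong]

theorem apply_endOfStable (e : V →ₗ[k] M) (he : Function.Injective e)
    (h : ∀ (a : A) x, a • e x ∈ LinearMap.range e) (a : A) (x : V) :
    e (endOfStable e he h a x) = a • e x :=
  apply_restrictAlong e he _ _ x

end EndOfStable

section Hecke

variable {k : Type*} [Field k] {q r : k}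

theorem permAct_adjSwap_of_mem_Inv {J : Finset (Fin m)} {f : Laurent k m} (hf : f ∈ Inv k J)
    {j : Fin m} (hj : j ∈ J) : permAct k (adjSwap j) f = f :=
  hf (s j) (s_mem_parabolic hj)

theorem mem_Inv_of_forall_adjSwap {J : Finset (Fin m)} {f : Laurent k m}
    (hf : ∀ j ∈ J, permAct k (adjSwap j) f = f) : f ∈ Inv k J := by
  intro w hw
  induction hw using Subgroup.closure_induction with
  | mem _ h =>
    obtain ⟨j, hj, rfl⟩ := h
    exact hf j hj
  | one => exact permAct_one f
  | mul x y _ _ hx hy => rw [SemidirectProduct.mul_right, permAct_mul, hy, hx]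
  | inv x _ hx =>
    rw [SemidirectProduct.inv_right]
    conv_lhs => rw [← hx]
    rw [← permAct_mul, inv_mul_cancel, permAct_one]

theorem ofHom_single {J K : Finset (Fin m)} (φ : vIdeal q r J →ₗ[(Hecke q m)ᵐᵒᵖ] vIdeal q r K)
    (x : vIdeal q r J) : ofHom φ (Pi.single J x) = Pi.single K (φ x) := by
  rw [ofHom, LinearMap.comp_apply, LinearMap.comp_apply, LinearMap.proj_apply, Pi.single_eq_same,
    LinearMap.single_apply]

theorem ofHom_single_of_ne {J K L : Finset (Fin m)}
    (φ : vIdeal q r J →ₗ[(Hecke q m)ᵐᵒᵖ] vIdeal q r K) (hL : L ≠ J) (x : vIdeal q r L) :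
    ofHom φ (Pi.single L x) = 0 := by
  rw [ofHom, LinearMap.comp_apply, LinearMap.comp_apply, LinearMap.proj_apply,
    Pi.single_eq_of_ne hL.symm, map_zero, map_zero]

theorem IsBernsteinPair.permAct_eq_self {i : Fin m} {f g : Laurent k m}
    (hfg : IsBernsteinPair q i f g) (h : q • permAct k (adjSwap i) f + g = q • f) :
    permAct k (adjSwap i) f = f := by
  have hmul : (xL k i.succ - q • xL k i.castSucc) * (f - permAct k (adjSwap i) f) = 0 := by
    have hsub := hfg.sub_mul
    rw [eq_sub_of_add_eq' h] at hsub
    simp only [Algebra.smul_def, map_sub, map_one] at hsub ⊢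
    linear_combination hsub
  have hne := xL_sub_smul_ne_zero i.castSucc_lt_succ.ne' q
  exact (sub_eq_zero.1 ((mul_eq_zero.1 hmul).resolve_left hne)).symm

theorem commute_laurentToHecke_T (q : k) [NeZero q] {i : Fin m} {f : Laurent k m}
    (hf : permAct k (adjSwap i) f = f) : Commute (laurentToHecke q m f) (T q i) := by
  obtain ⟨g, hT, hsub⟩ := exists_isBernsteinPair q i f
  rw [hf, sub_self, mul_zero, smul_zero] at hsub
  have hne : xL k i.succ - xL k i.castSucc ≠ 0 :=
    sub_ne_zero.2 (xL_injective.ne i.castSucc_lt_succ.ne')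
  rw [hf, (mul_eq_zero.1 hsub).resolve_left hne, map_zero, add_zero] at hT
  exact hT.symm

section NeZeroScalar

variable [NeZero q] [NeZero r] [NeZero m]

theorem commute_laurentToHecke_Tw (q r : k) [NeZero q] [NeZero r] {J : Finset (Fin m)}
    {f : Laurent k m} (hf : f ∈ Inv k J) {w : W m} (hw : w ∈ parabolic J) :
    Commute (laurentToHecke q m f) (Tw q r w) := by
  obtain ⟨l, hl, rfl, hlen⟩ := exists_word_parabolic hw
  have hexpr : IsExpr (l.map s).prod (l.map Fin.succ, 0) := by
    simpa [Function.comp_def, sAff_succ] using isExpr_prod (l.map Fin.succ)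
  rw [Tw_eq hexpr (by rwa [List.length_map]), zpow_zero, mul_one,
    ← Units.coeHom_apply, map_list_prod]
  refine Commute.list_prod_right _ _ fun x hx => ?_
  obtain ⟨i, hi, rfl⟩ : ∃ i ∈ l, T q i = x := by simpa [TAffU_succ, TU] using hx
  exact commute_laurentToHecke_T q (permAct_adjSwap_of_mem_Inv hf (hl i hi))

theorem commute_laurentToHecke_v (q r : k) [NeZero q] [NeZero r] {J : Finset (Fin m)}
    {f : Laurent k m} (hf : f ∈ Inv k J) : Commute (laurentToHecke q m f) (v q r J) :=
  finsum_mem_induction (p := fun x => Commute (laurentToHecke q m f) x)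
    (Commute.zero_right _) (fun _ _ hx hy => hx.add_right hy)
    fun _ hw => commute_laurentToHecke_Tw q r hf hw

theorem exists_laurentToHecke_mul_v_univ_eq (q r : k) [NeZero q] [NeZero r] {J : Finset (Fin m)}
    {f : Laurent k m} (hf : f ∈ Inv k J) : ∃ h,
      laurentToHecke q m f * v q r Finset.univ = v q r J * (laurentToHecke q m f * h) := by
  obtain ⟨h, hh⟩ := exists_v_univ_eq (q := q) (r := r) J
  exact ⟨h, by rw [hh, ← mul_assoc, (commute_laurentToHecke_v q r hf).eq, mul_assoc]⟩

theorem laurentToHecke_mul_v_univ_mem_vIdeal_iff {J : Finset (Fin m)} {f : Laurent k m} :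
    laurentToHecke q m f * v q r Finset.univ ∈ vIdeal q r J ↔ f ∈ Inv k J := by
  refine ⟨fun hf => mem_Inv_of_forall_adjSwap fun j hj => ?_, fun hf => ?_⟩
  · obtain ⟨h, hh⟩ := mem_vIdeal.1 hf
    obtain ⟨g, hg⟩ := exists_isBernsteinPair q j f
    have hT : T q j * (laurentToHecke q m f * v q r Finset.univ) =
        q • (laurentToHecke q m f * v q r Finset.univ) := by
      rw [hh, ← mul_assoc, T_mul_v hj, smul_mul_assoc]
    rw [← mul_assoc, hg.T_mul, add_mul, mul_assoc, T_mul_v (Finset.mem_univ j), mul_smul_comm,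
      ← smul_mul_assoc, ← smul_mul_assoc, ← add_mul] at hT
    refine hg.permAct_eq_self (laurentToHecke_mul_v_univ_injective q r ?_)
    simpa only [map_add, map_smul] using hT
  · obtain ⟨h, hh⟩ := exists_laurentToHecke_mul_v_univ_eq q r hf
    exact mem_vIdeal.2 ⟨_, hh⟩

theorem mul_v_univ_of_mem_U (r : k) [NeZero r] {x : Hecke q m} (hx : x ∈ U q m) :
    x * v q r Finset.univ = 0 := by
  induction hx using Submodule.span_induction with
  | mem _ hx =>
    obtain ⟨i, rfl⟩ := hx
    rw [sub_mul, T_mul_v (Finset.mem_univ i), Algebra.smul_def, sub_self]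
  | zero => exact zero_mul _
  | add x y _ _ hx hy => rw [add_mul, hx, hy, add_zero]
  | smul c x _ hx => rw [smul_eq_mul, mul_assoc, hx, mul_zero]

theorem mem_U_iff_mul_v_univ (r : k) [NeZero r] {x : Hecke q m} :
    x ∈ U q m ↔ x * v q r Finset.univ = 0 := by
  refine ⟨mul_v_univ_of_mem_U r, fun hx => ?_⟩
  obtain ⟨f, hf⟩ := mulV_surjective q m (Submodule.Quotient.mk x)
  rw [mulV_apply, Submodule.Quotient.eq] at hf
  have hzero := mul_v_univ_of_mem_U r hf
  rw [sub_mul, hx, sub_zero] at hzero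
  have hf0 : f = 0 := laurentToHecke_mul_v_univ_injective q r (by simpa using hzero)
  rwa [hf0, map_zero, zero_sub, Submodule.neg_mem_iff] at hf

theorem eq_zero_of_mul_laurentToHecke_mul_v_univ (r : k) [NeZero r] {x : Hecke q m}
    (hx : ∀ g : Laurent k m, x * laurentToHecke q m g * v q r Finset.univ = 0) : x = 0 := by
  refine eq_zero_of_polyRep r fun g => ?_
  have h := polyRep_apply_one_of_mem_U ((mem_U_iff_mul_v_univ r).2 (hx g))
  rw [map_mul, polyRep_laurentToHecke, Module.End.mul_apply] at h
  simpa using h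

/-- The map `f v ↦ f v_𝕀` from the `W_J`-invariants to `v_J ℋ`. -/
def mulVUniv (q r : k) [NeZero q] [NeZero r] (J : Finset (Fin m)) : Inv k J →ₗ[k] vIdeal q r J where
  toFun f := ⟨laurentToHecke q m f * v q r Finset.univ,
    laurentToHecke_mul_v_univ_mem_vIdeal_iff.2 f.2⟩
  map_add' f g := Subtype.ext <| by simp only [Submodule.coe_add, map_add, add_mul]
  map_smul' c f := Subtype.ext <| by
    simp only [Submodule.coe_smul, map_smul, smul_mul_assoc, RingHom.id_apply,
      Submodule.coe_smul_of_tower]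

theorem coe_mulVUniv {J : Finset (Fin m)} (f : Inv k J) :
    (mulVUniv q r J f : Hecke q m) = laurentToHecke q m f * v q r Finset.univ := rfl

theorem mulVUniv_injective (q r : k) [NeZero q] [NeZero r] (J : Finset (Fin m)) :
    Function.Injective (mulVUniv q r J) := fun _ _ h =>
  Subtype.ext (laurentToHecke_mul_v_univ_injective q r (congrArg Subtype.val h))

theorem exists_mulVUniv_eq {J : Finset (Fin m)} {x : vIdeal q r J}
    (hx : ∀ i, (x : Hecke q m) * T q i = q • (x : Hecke q m)) : ∃ f, mulVUniv q r J f = x := by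
  obtain ⟨f, hf⟩ := exists_eq_laurentToHecke_mul_v_univ r hx
  exact ⟨⟨f, laurentToHecke_mul_v_univ_mem_vIdeal_iff.1 (hf ▸ x.2)⟩, Subtype.ext hf.symm⟩

theorem coe_mulVUniv_mul_T {J : Finset (Fin m)} (f : Inv k J) (i : Fin m) :
    (mulVUniv q r J f : Hecke q m) * T q i = q • (mulVUniv q r J f : Hecke q m) := by
  rw [coe_mulVUniv, mul_assoc, v_mul_T (Finset.mem_univ i), mul_smul_comm]

/-- The embedding `f v^{(J)} ↦ f v_𝕀` of `ℙ(𝒮)` into `⨁_J v_J ℋ`, by which `𝒮` acts on `ℙ(𝒮)`. -/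
def embPS (q r : k) (m : ℕ) [NeZero q] [NeZero r] [NeZero m] :
    PS k m →ₗ[k] ∀ J : Finset (Fin m), vIdeal q r J :=
  LinearMap.piMap (mulVUniv q r)

theorem embPS_injective (q r : k) [NeZero q] [NeZero r] : Function.Injective (embPS q r m) :=
  fun _ _ h => funext fun J => mulVUniv_injective q r J (congrFun h J)

theorem embPS_single {J : Finset (Fin m)} (f : Inv k J) :
    embPS q r m (single f) = Pi.single J (mulVUniv q r J f) := by
  funext L
  change mulVUniv q r L (single f L) = _
  rw [single]
  by_cases h : L = J
  · subst h
    rw [Pi.single_eq_same, Pi.single_eq_same]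
  · rw [Pi.single_eq_of_ne h, Pi.single_eq_of_ne h, map_zero]

theorem mem_range_embPS_iff {x : ∀ J : Finset (Fin m), vIdeal q r J} :
    x ∈ LinearMap.range (embPS q r m) ↔
      ∀ i : Fin m,
        MulOpposite.op (T q i) • x = MulOpposite.op (algebraMap k (Hecke q m) q) • x := by
  have op_smul_iff (i : Fin m) :
      MulOpposite.op (T q i) • x = MulOpposite.op (algebraMap k (Hecke q m) q) • x ↔
        ∀ J, (x J : Hecke q m) * T q i = q • (x J : Hecke q m) := by
    simp only [funext_iff, Subtype.ext_iff, Algebra.smul_def, Algebra.commutes]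
    rfl
  simp only [op_smul_iff]
  constructor
  · rintro ⟨f, rfl⟩ i J
    exact coe_mulVUniv_mul_T (f J) i
  · intro hx
    choose f hf using fun J => exists_mulVUniv_eq fun i => hx i J
    exact ⟨f, funext hf⟩

theorem smul_embPS_mem_range (φ : Schur q r m) (f : PS k m) :
    φ • embPS q r m f ∈ LinearMap.range (embPS q r m) := by
  refine mem_range_embPS_iff.2 fun i => ?_
  have hf := mem_range_embPS_iff.1 (LinearMap.mem_range_self (embPS q r m) f) i
  rw [Module.End.smul_def, ← map_smul, hf, map_smul]

theorem op_v_univ_smul_mem_range_embPS (x : ∀ J : Finset (Fin m), vIdeal q r J) :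
    MulOpposite.op (v q r (Finset.univ : Finset (Fin m))) • x ∈ LinearMap.range (embPS q r m) := by
  refine mem_range_embPS_iff.2 fun i => ?_
  rw [smul_smul, smul_smul, ← MulOpposite.op_mul, ← MulOpposite.op_mul,
    v_mul_T (Finset.mem_univ i), ← Algebra.commutes, Algebra.smul_def]

/-- The representation of `𝒮` on `ℙ(𝒮)`. -/
def rho (q r : k) (m : ℕ) [NeZero q] [NeZero r] [NeZero m] :
    Schur q r m →ₐ[k] Module.End k (PS k m) :=
  endOfStable (embPS q r m) (embPS_injective q r) smul_embPS_mem_range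

theorem embPS_rho (φ : Schur q r m) (f : PS k m) :
    embPS q r m (rho q r m φ f) = φ (embPS q r m f) :=
  apply_endOfStable _ _ _ _ _

theorem rho_injective (q r : k) (m : ℕ) [NeZero q] [NeZero r] [NeZero m] :
    Function.Injective (rho q r m) := by
  rw [injective_iff_map_eq_zero]
  intro φ hφ
  have map_op_v_univ_smul (x : ∀ J : Finset (Fin m), vIdeal q r J) :
      φ (MulOpposite.op (v q r (Finset.univ : Finset (Fin m))) • x) = 0 := by
    obtain ⟨f, hf⟩ := op_v_univ_smul_mem_range_embPS x
    rw [← hf, ← embPS_rho, hφ, LinearMap.zero_apply, map_zero]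
  refine LinearMap.ext fun x => funext fun K => Subtype.ext ?_
  refine eq_zero_of_mul_laurentToHecke_mul_v_univ r fun g => ?_
  have hx := map_op_v_univ_smul (MulOpposite.op (laurentToHecke q m g) • x)
  rw [map_smul, map_smul] at hx
  exact congrArg Subtype.val (congrFun hx K)

theorem rho_ofHom_single_of_ne {J K L : Finset (Fin m)}
    (φ : vIdeal q r J →ₗ[(Hecke q m)ᵐᵒᵖ] vIdeal q r K) (hL : L ≠ J) (f : Inv k L) :
    rho q r m (ofHom φ) (single f) = 0 := by
  apply embPS_injective q r
  rw [embPS_rho, embPS_single, ofHom_single_of_ne φ hL, map_zero]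

theorem rho_ofHom_single {J K : Finset (Fin m)}
    {φ : vIdeal q r J →ₗ[(Hecke q m)ᵐᵒᵖ] vIdeal q r K} {f : Inv k J} {g : Inv k K}
    (h : φ (mulVUniv q r J f) = mulVUniv q r K g) :
    rho q r m (ofHom φ) (single f) = single g := by
  apply embPS_injective q r
  rw [embPS_rho, embPS_single, embPS_single, ofHom_single, h]

theorem coe_map_mulVUniv {J K : Finset (Fin m)}
    {φ : vIdeal q r J →ₗ[(Hecke q m)ᵐᵒᵖ] vIdeal q r K} {h : Hecke q m}
    (hφ : (φ (vGen q r J) : Hecke q m) = h * v q r J) (f : Inv k J) :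
    (φ (mulVUniv q r J f) : Hecke q m) =
      h * (laurentToHecke q m f * v q r Finset.univ) := by
  obtain ⟨y, hy⟩ := exists_laurentToHecke_mul_v_univ_eq q r f.2
  have hf : mulVUniv q r J f = ⟨v q r J * (laurentToHecke q m f * y), mem_vIdeal.2 ⟨_, rfl⟩⟩ :=
    Subtype.ext hy
  rw [hf, coe_map_v_mul, hφ, mul_assoc, ← hy]

theorem mulV_eq_smul_mulV_iff (r : k) [NeZero r] {h : Hecke q m} {f g : Laurent k m} :
    mulV q m g = h • mulV q m f ↔ laurentToHecke q m g * v q r Finset.univ =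
      h * (laurentToHecke q m f * v q r Finset.univ) := by
  rw [mulV_apply, mulV_apply, ← Submodule.Quotient.mk_smul, Submodule.Quotient.eq,
    mem_U_iff_mul_v_univ r, sub_mul, sub_eq_zero, smul_eq_mul, mul_assoc]

theorem exists_rho_ofHom_single {J K : Finset (Fin m)} {d : W m} (hd : d ∈ D K J)
    {φ : vIdeal q r J →ₗ[(Hecke q m)ᵐᵒᵖ] vIdeal q r K} (hφ : IsB d φ) (f : Inv k J) :
    ∃ g : Inv k K, rho q r m (ofHom φ) (single f) = single g ∧
      mulV q m g = ∑ᶠ x ∈ DIn K ∅ (interConj K d J), (Tw q r x * Tw q r d) • mulV q m f := by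
  have hfin := finite_DIn K (interConj K d J)
  rw [← hfin.coe_toFinset, finsum_mem_coe_finset, ← Finset.sum_smul, ← finsum_mem_coe_finset,
    hfin.coe_toFinset]
  have hφf := coe_map_mulVUniv (hφ.trans (finsum_Tw_dcoset hd)) f
  obtain ⟨g, hg⟩ := exists_mulVUniv_eq (x := φ (mulVUniv q r J f)) fun i => by
    rw [hφf, mul_assoc, mul_assoc, v_mul_T (Finset.mem_univ i), mul_smul_comm, mul_smul_comm]
  refine ⟨g, rho_ofHom_single hg.symm, (mulV_eq_smul_mulV_iff r).2 ?_⟩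
  rw [← hφf, ← hg, coe_mulVUniv]

end NeZeroScalar

end Hecke

theorem mainTheorem2_general {k : Type*} [Field k] {q r : k} (hq : q ≠ 0) (hr : r ^ 2 = q) {m : ℕ}
    (hm : 1 ≤ m) :
    Function.Bijective (mulV q m) ∧
    (∀ J K : Finset (Fin m), ∀ d ∈ D K J,
      ∃! φ : vIdeal q r J →ₗ[(Hecke q m)ᵐᵒᵖ] vIdeal q r K, IsB d φ) ∧
    ∃ ρ : Schur q r m →ₐ[k] Module.End k (PS k m),
      Function.Injective ρ ∧
      ∀ J K : Finset (Fin m), ∀ d ∈ D K J,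
        ∀ φ : vIdeal q r J →ₗ[(Hecke q m)ᵐᵒᵖ] vIdeal q r K, IsB d φ →
          (∀ L ≠ J, ∀ f : Inv k L, ρ (ofHom φ) (single f) = 0) ∧
          ∀ f : Inv k J, ∃ g : Inv k K,
            ρ (ofHom φ) (single f) = single g ∧
            mulV q m g =
              ∑ᶠ x ∈ DIn K ∅ (interConj K d J), (Tw q r x * Tw q r d) • mulV q m f := by
  have : NeZero q := ⟨hq⟩
  have : NeZero r := ⟨fun hr0 => hq (by rw [← hr, hr0, zero_pow two_ne_zero])⟩
  have : NeZero m := .of_pos hm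
  exact ⟨⟨mulV_injective q m, mulV_surjective q m⟩, fun J K d hd => existsUnique_isB hd,
    rho q r m, rho_injective q r m, fun J K d hd φ hφ =>
      ⟨fun L hL f => rho_ofHom_single_of_ne φ hL f, fun f => exists_rho_ofHom_single hd hφ f⟩⟩

end

end AffSchur

theorem mainTheorem2
    (p a q : ℕ) (hp : p.Prime) (ha : 1 ≤ a) (hq : q = p ^ a)
    (k : Type*) [Field k] [IsAlgClosed k] (ℓ : ℕ) [CharP k ℓ] (hℓ : ℓ ≠ p)
    (hqℓ : ¬ q ≡ 1 [MOD ℓ])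
    (r : k) (hr : r ^ 2 = (q : k))
    (m : ℕ) (hm : 1 ≤ m) :
    Function.Bijective (AffSchur.mulV (q : k) m) ∧
    (∀ (J K : Finset (Fin m)), ∀ d ∈ AffSchur.D K J,
      ∃! φ : AffSchur.vIdeal (q : k) r J →ₗ[(AffSchur.Hecke (q : k) m)ᵐᵒᵖ]
          AffSchur.vIdeal (q : k) r K,
        AffSchur.IsB d φ) ∧
    ∃ ρ : AffSchur.Schur (q : k) r m →ₐ[k] Module.End k (AffSchur.PS k m),
      Function.Injective ρ ∧
      ∀ (J K : Finset (Fin m)), ∀ d ∈ AffSchur.D K J,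
        ∀ φ : AffSchur.vIdeal (q : k) r J →ₗ[(AffSchur.Hecke (q : k) m)ᵐᵒᵖ]
            AffSchur.vIdeal (q : k) r K,
          AffSchur.IsB d φ →
          (∀ L : Finset (Fin m), L ≠ J → ∀ f : AffSchur.Inv k L,
            ρ (AffSchur.ofHom φ) (AffSchur.single f) = 0) ∧
          ∀ f : AffSchur.Inv k J, ∃ g : AffSchur.Inv k K,
            ρ (AffSchur.ofHom φ) (AffSchur.single f) = AffSchur.single g ∧
            AffSchur.mulV (q : k) m g =
              ∑ᶠ x ∈ AffSchur.DIn K ∅ (AffSchur.interConj K d J),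
                (AffSchur.Tw (q : k) r x * AffSchur.Tw (q : k) r d) •
                  AffSchur.mulV (q : k) m f := by
  refine AffSchur.mainTheorem2_general ?_ hr hm
  rw [hq, Nat.cast_pow]
  exact pow_ne_zero a (CharP.cast_ne_zero_of_ne_of_prime k hp hℓ)
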